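/- Let $L_\omega$ be the language of higher-order arithmetic in all finite types ($0$ is a type, and $\sigma\to\tau$ is a type whenever $\sigma,\tau$ are; $1:=0\to 0$, $2:=1\to 0$). Primitive equality $=_0$ and order $<_0$ are between objects of type $0$, and equality at higher types is the defined pointwise one. Let $\mathsf{RCA}_0^\omega$ be Kohlenbach's base theory, in classical many-sorted logic: the basic axioms of arithmetic for $0,S,+,\times,<$; the defining axioms of the combinators $\Pi,\Sigma$ and of the recursor $R_0$ of type $0$; the axiom of extensionality at all types; induction for quantifier-free formulas of $L_\omega$; and $\mathsf{QF\text{-}AC}^{1,0}$, i.e. $(\forall x^1)(\exists y^0)A(x,y)\to(\exists Y^2)(\forall x^1)A(x,Y(x))$ for quantifier-free $A$. Let $\mathsf{ACA}_0^\omega$ be $\mathsf{RCA}_0^\omega$ plus $$(\exists^2):\qquad (\exists \varphi^2\le_2 1)(\forall f^1)\big[(\exists n)(f(n)=0)\leftrightarrow \varphi(f)=0\big].$$ In this language, a real number is a sequence $x=(q_k)_{k\in\mathbb N}$ of (codes of) rationals with $|q_k-q_{k+i}|\le 2^{-k}$ for all $k,i$; for reals $x=(q_k)$ and $y=(r_k)$,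 $x=_{\mathbb R}y$ means $|q_k-r_k|\le 2^{-k+1}$ for all $k$, and $x\le_{\mathbb R}y$ means $q_k\le r_k+2^{-k+1}$ for all $k$. For $X$ equal to $[0,1]$, $\mathbb R$ (with equality $=_{\mathbb R}$) or $\mathbb N^{\mathbb N}$ (all objects of type $1$, with equality $=_1$), let $\mathsf{NBI}^X$ be the sentence stating that there is no bijection from $X$ to $\mathbb N$, i.e. no $Y^2$ that maps equal elements of $X$ to equal numbers, maps elements of $X$ with equal values to equal elements only (injectivity), and takes every $n\in\mathbb N$ as value at some element of $X$ (surjectivity). Write $\mathsf{NBI}$ for $\mathsf{NBI}^{[0,1]}$. **Theorem.** The system $\mathsf{ACA}_0^\omega$ proves $\mathsf{NBI}\leftrightarrow\mathsf{NBI}^{\mathbb R}$, and it proves $\mathsf{NBI}\to\mathsf{NBI}^{\mathbb N^{\mathbb N}}$. -/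

import Mathlib

/-! Higher-order arithmetic in all finite types: the language, classical natural deduction,
the theories RCA₀^ω and ACA₀^ω, real numbers as fast-converging Cauchy sequences of rationals,
and the principles stating that there is no bijection from `[0,1]`, `ℝ`, `ℕ^ℕ` to `ℕ`. -/

namespace HigherOrderArith

/-- The finite types: type `0` and function types. -/
inductive Ty : Type
  | nat : Ty
  | arrow : Ty → Ty → Ty
  deriving DecidableEq

infixr:60 " ⇾ " => Ty.arrow

/-- Type `1`: functions from numbers to numbers. -/
abbrev Ty.one : Ty := Ty.nat ⇾ Ty.nat

/-- Type `2`: functionals from type `1` to type `0`. -/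
abbrev Ty.two : Ty := Ty.one ⇾ Ty.nat

/-- Typed terms. There are countably many variables `var σ 0, var σ 1, …` of each type `σ`; they
are used as de Bruijn indices, counted separately for each type. The constants are zero, successor,
addition, multiplication, the combinators `Π` (`K`) and `Σ` (`S`), and the recursor `R₀` of
type `0`. -/
inductive Tm : Ty → Type
  | var (σ : Ty) (i : ℕ) : Tm σ
  | zero : Tm Ty.nat
  | succ : Tm (Ty.nat ⇾ Ty.nat)
  | add : Tm (Ty.nat ⇾ Ty.nat ⇾ Ty.nat)
  | mul : Tm (Ty.nat ⇾ Ty.nat ⇾ Ty.nat)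
  | combK (ρ τ : Ty) : Tm (ρ ⇾ τ ⇾ ρ)
  | combS (δ ρ τ : Ty) : Tm ((δ ⇾ ρ ⇾ τ) ⇾ (δ ⇾ ρ) ⇾ δ ⇾ τ)
  | recursor : Tm (Ty.nat ⇾ (Ty.nat ⇾ Ty.nat ⇾ Ty.nat) ⇾ Ty.nat ⇾ Ty.nat)
  | app {σ τ : Ty} : Tm (σ ⇾ τ) → Tm σ → Tm τ

infixl:90 " ⬝ " => Tm.app

/-- Formulas of the language `L_ω`. The only primitive relations are `=₀` and `<₀` between objects
of type `0`. The quantifier `all σ φ` binds the variable `var σ 0` of `φ`; in `φ`, the index of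
every other variable of type `σ` is raised by one, and variables of other types are unaffected. -/
inductive Formula : Type
  | eq : Tm Ty.nat → Tm Ty.nat → Formula
  | lt : Tm Ty.nat → Tm Ty.nat → Formula
  | falsum : Formula
  | imp : Formula → Formula → Formula
  | all : Ty → Formula → Formula

infix:50 " ≐ " => Formula.eq
infix:50 " ≺ " => Formula.lt
infixr:30 " ⟹ " => Formula.imp

/-! ### Renaming and substitution -/

/-- A renaming of variables. -/
abbrev Ren := Ty → ℕ → ℕ

/-- A simultaneous substitution of terms for variables. -/
abbrev Subst := (σ : Ty) → ℕ → Tm σ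

/-- Raise by one the indices of the variables of type `σ`. -/
def shift (σ : Ty) : Ren := fun τ i => if τ = σ then i + 1 else i

def Tm.rename (r : Ren) : {σ : Ty} → Tm σ → Tm σ
  | _, .var σ i => .var σ (r σ i)
  | _, .zero => .zero
  | _, .succ => .succ
  | _, .add => .add
  | _, .mul => .mul
  | _, .combK ρ τ => .combK ρ τ
  | _, .combS δ ρ τ => .combS δ ρ τ
  | _, .recursor => .recursor
  | _, .app f x => .app (f.rename r) (x.rename r)

def Tm.subst (s : Subst) : {σ : Ty} → Tm σ → Tm σ
  | _, .var σ i => s σ i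
  | _, .zero => .zero
  | _, .succ => .succ
  | _, .add => .add
  | _, .mul => .mul
  | _, .combK ρ τ => .combK ρ τ
  | _, .combS δ ρ τ => .combS δ ρ τ
  | _, .recursor => .recursor
  | _, .app f x => .app (f.subst s) (x.subst s)

/-- The substitution `s` carried under a quantifier of type `σ`. -/
def Subst.under (σ : Ty) (s : Subst) : Subst := fun τ i =>
  if τ = σ then
    match i with
    | 0 => .var τ 0
    | j + 1 => (s τ j).rename (shift σ)
  else (s τ i).rename (shift σ)

def Formula.subst : Formula → Subst → Formula
  | .eq t u, s => .eq (t.subst s) (u.subst s)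
  | .lt t u, s => .lt (t.subst s) (u.subst s)
  | .falsum, _ => .falsum
  | .imp φ ψ, s => .imp (φ.subst s) (ψ.subst s)
  | .all σ φ, s => .all σ (φ.subst (s.under σ))

/-- Weakening of `φ` by one fresh variable `var σ 0`. -/
def Formula.lift (σ : Ty) (φ : Formula) : Formula :=
  φ.subst fun τ i => .var τ (shift σ τ i)

/-- The substitution of `t` for `var σ 0` that lowers by one the other variables of type `σ`. -/
def Subst.single {σ : Ty} (t : Tm σ) : Subst := fun τ i =>
  if h : τ = σ then
    match i with
    | 0 => h ▸ t
    | j + 1 => .var τ j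
  else .var τ i

/-- The instance `φ(t)` of the body `φ` of a quantifier of type `σ`. -/
def Formula.inst {σ : Ty} (φ : Formula) (t : Tm σ) : Formula := φ.subst (Subst.single t)

/-- The substitution of `S n` for `n = var 0 0`, leaving the other variables alone. -/
def Subst.succZero : Subst
  | .nat, 0 => .succ ⬝ .var .nat 0
  | τ, i => .var τ i

/-! ### Defined connectives and quantifiers (classical logic) -/

def Formula.neg (φ : Formula) : Formula := φ ⟹ .falsum

def Formula.and (φ ψ : Formula) : Formula := (φ ⟹ ψ.neg).neg

def Formula.or (φ ψ : Formula) : Formula := φ.neg ⟹ ψ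

def Formula.iff (φ ψ : Formula) : Formula := (φ ⟹ ψ).and (ψ ⟹ φ)

def Formula.ex (σ : Ty) (φ : Formula) : Formula := (Formula.all σ φ.neg).neg

/-- Quantifier-free formulas. -/
def Formula.QF : Formula → Prop
  | .eq _ _ => True
  | .lt _ _ => True
  | .falsum => True
  | .imp φ ψ => φ.QF ∧ ψ.QF
  | .all _ _ => False

/-- Equality `s =_τ t` at type `τ`, i.e. `∀ x₁ … xₖ, s x₁ … xₖ =₀ t x₁ … xₖ`. -/
def eqAt : (τ : Ty) → Tm τ → Tm τ → Formula
  | .nat, s, t => s ≐ t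
  | .arrow σ τ, s, t =>
      .all σ (eqAt τ (s.rename (shift σ) ⬝ .var σ 0) (t.rename (shift σ) ⬝ .var σ 0))

/-! ### Derivability -/

/-- `Proves T Γ φ`: there is a derivation of `φ` from the axioms `T` and the assumptions `Γ` in
classical many-sorted natural deduction with equality at type `0`. Free variables of axioms are read
as universally quantified; free variables of `Γ` and `φ` are parameters. -/
inductive Proves (T : Set Formula) : List Formula → Formula → Prop
  | ax {Γ : List Formula} {φ : Formula} : φ ∈ T → Proves T Γ φ
  | hyp {Γ : List Formula} {φ : Formula} : φ ∈ Γ → Proves T Γ φ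
  | impIntro {Γ : List Formula} {φ ψ : Formula} : Proves T (φ :: Γ) ψ → Proves T Γ (φ ⟹ ψ)
  | impElim {Γ : List Formula} {φ ψ : Formula} :
      Proves T Γ (φ ⟹ ψ) → Proves T Γ φ → Proves T Γ ψ
  | byContra {Γ : List Formula} {φ : Formula} :
      Proves T (φ.neg :: Γ) .falsum → Proves T Γ φ
  | allIntro {Γ : List Formula} {σ : Ty} {φ : Formula} :
      Proves T (Γ.map (Formula.lift σ)) φ → Proves T Γ (.all σ φ)
  | allElim {Γ : List Formula} {σ : Ty} {φ : Formula} (t : Tm σ) :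
      Proves T Γ (.all σ φ) → Proves T Γ (φ.inst t)
  | eqRefl {Γ : List Formula} (t : Tm Ty.nat) : Proves T Γ (t ≐ t)
  | eqSubst {Γ : List Formula} {s t : Tm Ty.nat} (φ : Formula) :
      Proves T Γ (s ≐ t) → Proves T Γ (φ.inst s) → Proves T Γ (φ.inst t)

/-! ### The theories -/

/-- The axioms of `RCA₀^ω`: the basic axioms of arithmetic, the defining axioms of the combinators
and of the recursor `R₀`, extensionality at all types, quantifier-free induction, and
quantifier-free choice `QF-AC^{1,0}`. In `induction`, the formula `A(n)` has `n = var 0 0`; in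
`choice`, the formula `A(x, y)` has `x = var 1 0` and `y = var 0 0`. Both may contain further
variables of all types as parameters. -/
inductive RCA : Formula → Prop
  | succ_ne_zero (x : Tm Ty.nat) : RCA (.neg (.succ ⬝ x ≐ .zero))
  | succ_inj (x y : Tm Ty.nat) : RCA (.succ ⬝ x ≐ .succ ⬝ y ⟹ x ≐ y)
  | add_zero (x : Tm Ty.nat) : RCA (.add ⬝ x ⬝ .zero ≐ x)
  | add_succ (x y : Tm Ty.nat) :
      RCA (.add ⬝ x ⬝ (.succ ⬝ y) ≐ .succ ⬝ (.add ⬝ x ⬝ y))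
  | mul_zero (x : Tm Ty.nat) : RCA (.mul ⬝ x ⬝ .zero ≐ .zero)
  | mul_succ (x y : Tm Ty.nat) :
      RCA (.mul ⬝ x ⬝ (.succ ⬝ y) ≐ .add ⬝ (.mul ⬝ x ⬝ y) ⬝ x)
  | not_lt_zero (x : Tm Ty.nat) : RCA (.neg (x ≺ .zero))
  | lt_succ (x y : Tm Ty.nat) :
      RCA (.iff (x ≺ .succ ⬝ y) (.or (x ≺ y) (x ≐ y)))
  | combK {ρ τ : Ty} (x : Tm ρ) (y : Tm τ) : RCA (eqAt ρ (.combK ρ τ ⬝ x ⬝ y) x)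
  | combS {δ ρ τ : Ty} (x : Tm (δ ⇾ ρ ⇾ τ)) (y : Tm (δ ⇾ ρ)) (z : Tm δ) :
      RCA (eqAt τ (.combS δ ρ τ ⬝ x ⬝ y ⬝ z) (x ⬝ z ⬝ (y ⬝ z)))
  | rec_zero (m : Tm Ty.nat) (f : Tm (Ty.nat ⇾ Ty.nat ⇾ Ty.nat)) :
      RCA (.recursor ⬝ m ⬝ f ⬝ .zero ≐ m)
  | rec_succ (m : Tm Ty.nat) (f : Tm (Ty.nat ⇾ Ty.nat ⇾ Ty.nat)) (n : Tm Ty.nat) :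
      RCA (.recursor ⬝ m ⬝ f ⬝ (.succ ⬝ n) ≐ f ⬝ n ⬝ (.recursor ⬝ m ⬝ f ⬝ n))
  | ext {ρ τ : Ty} (F : Tm (ρ ⇾ τ)) (x y : Tm ρ) :
      RCA (eqAt ρ x y ⟹ eqAt τ (F ⬝ x) (F ⬝ y))
  | induction (A : Formula) (hA : A.QF) :
      RCA (A.inst Tm.zero ⟹ .all .nat (A ⟹ A.subst Subst.succZero) ⟹ .all .nat A)
  | choice (A : Formula) (hA : A.QF) :
      RCA (.all .one (.ex .nat A) ⟹
        .ex .two (.all .one ((A.lift .two).inst (Tm.var .two 0 ⬝ .var .one 0))))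

/-- `s ≤₀ t`, i.e. `s < t + 1`. -/
def le (s t : Tm Ty.nat) : Formula := s ≺ .succ ⬝ t

/-- The axiom `(∃²)`: there is `E` of type `2`, bounded by `1`, such that for all `f` of type `1`,
`∃ n, f n = 0` if and only if `E f = 0`. -/
def existsTwo : Formula :=
  .ex .two (.and
    (.all .one (le (.var .two 0 ⬝ .var .one 0) (.succ ⬝ .zero)))
    (.all .one (.iff (.ex .nat (.var .one 0 ⬝ .var .nat 0 ≐ .zero))
      (.var .two 0 ⬝ .var .one 0 ≐ .zero))))

/-- `ACA₀^ω`, which is `RCA₀^ω` together with `(∃²)`. -/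
def ACA : Set Formula := {φ | RCA φ ∨ φ = existsTwo}

/-! ### Rational and real numbers -/

/-- The numeral of `n`. -/
def num : ℕ → Tm Ty.nat
  | 0 => .zero
  | n + 1 => .succ ⬝ num n

/-- `2 ^ k`, by recursion. -/
def pow2 (k : Tm Ty.nat) : Tm Ty.nat :=
  .recursor ⬝ num 1 ⬝ (.combK _ _ ⬝ (.mul ⬝ num 2)) ⬝ k

/-- The injective pairing `(i, j) ↦ (i + j)² + i` of natural numbers. -/
def pair (i j : Tm Ty.nat) : Tm Ty.nat :=
  .add ⬝ (.mul ⬝ (.add ⬝ i ⬝ j) ⬝ (.add ⬝ i ⬝ j)) ⬝ i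

/-- The code of the rational number `(a - b) / (d + 1)`. -/
def ratCode (a b d : Tm Ty.nat) : Tm Ty.nat := pair (pair a b) d

/-- Raise by `m` the indices of the variables of type `0`. -/
def Tm.liftNat (m : ℕ) {σ : Ty} (t : Tm σ) : Tm σ :=
  t.rename fun τ i => if τ = Ty.nat then i + m else i

/-- `q` and `r` are codes of rational numbers with `q - r ≤ c / 2 ^ k`: there are `a b d a' b' d'`
(the variables `5, …, 0` of type `0`) with `q = (a - b) / (d + 1)`, `r = (a' - b') / (d' + 1)` and
`2 ^ k * (a * (d' + 1) + b' * (d + 1)) ≤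
  c * ((d + 1) * (d' + 1)) + 2 ^ k * (b * (d' + 1) + a' * (d + 1))`. -/
def diffLe (q r k : Tm Ty.nat) (c : ℕ) : Formula :=
  let a : Tm Ty.nat := .var .nat 5
  let b : Tm Ty.nat := .var .nat 4
  let d : Tm Ty.nat := .var .nat 3
  let a' : Tm Ty.nat := .var .nat 2
  let b' : Tm Ty.nat := .var .nat 1
  let d' : Tm Ty.nat := .var .nat 0
  let e : Tm Ty.nat := pow2 (k.liftNat 6)
  .ex .nat (.ex .nat (.ex .nat (.ex .nat (.ex .nat (.ex .nat (.and
    (q.liftNat 6 ≐ ratCode a b d) (.and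
    (r.liftNat 6 ≐ ratCode a' b' d')
    (le (.mul ⬝ e ⬝ (.add ⬝ (.mul ⬝ a ⬝ (.succ ⬝ d')) ⬝ (.mul ⬝ b' ⬝ (.succ ⬝ d))))
      (.add ⬝ (.mul ⬝ num c ⬝ (.mul ⬝ (.succ ⬝ d) ⬝ (.succ ⬝ d')))
        ⬝ (.mul ⬝ e ⬝ (.add ⬝ (.mul ⬝ b ⬝ (.succ ⬝ d')) ⬝ (.mul ⬝ a' ⬝ (.succ ⬝ d)))))))))))))

/-- `q` and `r` are codes of rational numbers with `|q - r| ≤ c / 2 ^ k`. -/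
def distLe (q r k : Tm Ty.nat) (c : ℕ) : Formula := (diffLe q r k c).and (diffLe r q k c)

/-- `x ∈ ℝ`: `x` is a sequence of rationals with `|x k - x (k + i)| ≤ 2 ^ (-k)` for all `k`, `i`
(the variables `1` and `0` of type `0`). -/
def isReal (x : Tm Ty.one) : Formula :=
  .all .nat (.all .nat (distLe (x.liftNat 2 ⬝ .var .nat 1)
    (x.liftNat 2 ⬝ (.add ⬝ .var .nat 1 ⬝ .var .nat 0)) (.var .nat 1) 1))

/-- `x =_ℝ y`: `|x k - y k| ≤ 2 ^ (-k + 1)` for all `k`. -/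
def realEq (x y : Tm Ty.one) : Formula :=
  .all .nat (distLe (x.liftNat 1 ⬝ .var .nat 0) (y.liftNat 1 ⬝ .var .nat 0) (.var .nat 0) 2)

/-- `x ≤_ℝ y`: `x k ≤ y k + 2 ^ (-k + 1)` for all `k`. -/
def realLe (x y : Tm Ty.one) : Formula :=
  .all .nat (diffLe (x.liftNat 1 ⬝ .var .nat 0) (y.liftNat 1 ⬝ .var .nat 0) (.var .nat 0) 2)

/-- The real number `0`, as a constant sequence. -/
def realZero : Tm Ty.one := .combK _ _ ⬝ ratCode (num 0) (num 0) (num 0)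

/-- The real number `1`, as a constant sequence. -/
def realOne : Tm Ty.one := .combK _ _ ⬝ ratCode (num 1) (num 0) (num 0)

/-- `x ∈ [0, 1]`. -/
def inUnitInterval (x : Tm Ty.one) : Formula :=
  (isReal x).and ((realLe realZero x).and (realLe x realOne))

/-! ### Absence of bijections -/

/-- There is no bijection from `X` to `ℕ`, where `X` is a class of objects of type `1` with
equality `E`: no `Y` of type `2` respects `E` on `X`, is injective on `X` with respect to `E`, and
takes every value on `X`. In the first two clauses `var 1 1` and `var 1 0` are two elements of `X`;
in the third, `var 0 0` is a number and `var 1 0` an element of `X`. -/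
def noBijection (X : Tm Ty.one → Formula) (E : Tm Ty.one → Tm Ty.one → Formula) : Formula :=
  let Y : Tm Ty.two := .var .two 0
  let f : Tm Ty.one := .var .one 1
  let g : Tm Ty.one := .var .one 0
  .neg (.ex .two (.and
    (.all .one (.all .one (X f ⟹ X g ⟹ E f g ⟹ Y ⬝ f ≐ Y ⬝ g))) (.and
    (.all .one (.all .one (X f ⟹ X g ⟹ Y ⬝ f ≐ Y ⬝ g ⟹ E f g)))
    (.all .nat (.ex .one ((X g).and (Y ⬝ g ≐ .var .nat 0)))))))

/-- `NBI`: there is no bijection from `[0, 1]` to `ℕ`. -/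
def NBI : Formula := noBijection inUnitInterval realEq

/-- `NBI^ℝ`: there is no bijection from `ℝ` to `ℕ`. -/
def NBIReal : Formula := noBijection isReal realEq

/-- `NBI` for Baire space `ℕ^ℕ`: there is no bijection from `ℕ^ℕ` to `ℕ`. Every object of type `1`
is an element of Baire space, and equality is that of type `1`. -/
def NBIBaire : Formula := noBijection (fun _ => .neg .falsum) (eqAt .one)

end HigherOrderArith

namespace HigherOrderArith

/-! ### Substitution algebra -/

/-! Derivability is reduced to truth. By a Henkin argument (`Proves.of_forall_sat`), a sentence is
derivable as soon as it holds in every extensional structure satisfying the axioms. The structure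
built from an underivable sentence consists of terms modulo provable extensional equality. It is a
genuine model in which equality at every type is identity, but its numbers may be nonstandard. The
rest is therefore ordinary mathematics inside an arbitrary model `M` of `ACA`, with one restriction:
a function or predicate may be used as an object of `M`, or in an induction, only if it is
representable (`Rep`). Combinators give closure under abstraction, quantifier-free choice gives the
propositional connectives, and `(∃²)` together with choice gives number quantifiers (`Rep.exists`).
Hence everything arithmetical in the parameters is representable.

In `M` the three classes are compared through binary expansions. A real `x` is located in left-open
dyadic intervals `(n / 2 ^ p, (n + 1) / 2 ^ p]`, so each real has exactly one expansion, and that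
expansion has infinitely many digits `1` (`IsReal.exists_bit`). Such an expansion amounts to an
integer together with the position of the first `1` and the lengths of the gaps between successive
ones. These data form an arbitrary sequence of numbers. So `toBaire` and `fromBaire` are
representable, respect equality, and are mutually inverse up to `=_ℝ` (`toBaire_fromBaire`,
`realEq_fromBaire_toBaire`).

Integer part `0` picks out `(0, 1]`. Dropping that leading entry identifies `(0, 1]` with all of
Baire space, and `[0, 1]` has only the point `0` in addition. A bijection with the numbers absorbs
or loses one point by a shift (`bij_unit_of_bij_baire`, `bij_baire_of_bij_unit`). Composing, a
bijection with the numbers exists for one of the three classes if and only if it exists for the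
others. -/

theorem Tm.rename_eq_subst (r : Ren) {σ : Ty} (t : Tm σ) :
    t.rename r = t.subst fun τ i => .var τ (r τ i) := by
  induction t <;> simp_all [Tm.rename, Tm.subst]

theorem Tm.subst_subst (s s' : Subst) {σ : Ty} (t : Tm σ) :
    (t.subst s).subst s' = t.subst fun τ i => (s τ i).subst s' := by
  induction t <;> simp_all [Tm.subst]

@[simp] theorem Tm.subst_var {σ : Ty} (t : Tm σ) : t.subst (fun τ i => .var τ i) = t := by
  induction t <;> simp_all [Tm.subst]

theorem Tm.subst_rename (s : Subst) (r : Ren) {σ : Ty} (t : Tm σ) :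
    (t.subst s).rename r = t.subst fun τ i => (s τ i).rename r := by
  simp only [Tm.rename_eq_subst, Tm.subst_subst]

theorem Tm.rename_subst (r : Ren) (s : Subst) {σ : Ty} (t : Tm σ) :
    (t.rename r).subst s = t.subst fun τ i => s τ (r τ i) := by
  simp only [Tm.rename_eq_subst, Tm.subst_subst, Tm.subst]

theorem Tm.shift_subst_under (σ : Ty) (s : Subst) {τ : Ty} (t : Tm τ) :
    (t.rename (shift σ)).subst (s.under σ) = (t.subst s).rename (shift σ) := by
  rw [Tm.rename_subst, Tm.subst_rename]
  congr 1
  funext τ i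
  by_cases h : τ = σ <;> simp [shift, Subst.under, h]

theorem Subst.under_comp (σ : Ty) (s s' : Subst) :
    (fun τ i => ((s.under σ) τ i).subst (s'.under σ)) =
      Subst.under σ (fun τ i => (s τ i).subst s') := by
  funext τ i
  by_cases h : τ = σ
  · subst h
    cases i with
    | zero => simp [Subst.under, Tm.subst]
    | succ j => simp only [Subst.under, if_true, Tm.shift_subst_under]
  · simp only [Subst.under, if_neg h, Tm.shift_subst_under]

theorem Subst.under_var (σ : Ty) :
    Subst.under σ (fun τ i => .var τ i) = fun τ i => .var τ i := by
  funext τ i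
  by_cases h : τ = σ
  · subst h
    cases i <;> simp [Subst.under, Tm.rename, shift]
  · simp [Subst.under, h, Tm.rename, shift]

theorem Formula.subst_subst (φ : Formula) (s s' : Subst) :
    (φ.subst s).subst s' = φ.subst fun τ i => (s τ i).subst s' := by
  induction φ generalizing s s' with
  | eq t u => simp [Formula.subst, Tm.subst_subst]
  | lt t u => simp [Formula.subst, Tm.subst_subst]
  | falsum => rfl
  | imp φ ψ ih₁ ih₂ => simp [Formula.subst, ih₁, ih₂]
  | all σ φ ih => simp only [Formula.subst, ih, Subst.under_comp]

@[simp] theorem Formula.subst_var (φ : Formula) : φ.subst (fun τ i => .var τ i) = φ := by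
  induction φ with
  | all σ φ ih => simp only [Formula.subst, Subst.under_var, ih]
  | _ => simp_all [Formula.subst]

/-- Adjoining a value for `var σ 0` to a substitution. -/
def Subst.push {σ : Ty} (t : Tm σ) (s : Subst) : Subst := fun τ i =>
  if h : τ = σ then
    match i with
    | 0 => h ▸ t
    | j + 1 => s τ j
  else s τ i

theorem Subst.single_eq_push {σ : Ty} (t : Tm σ) :
    Subst.single t = Subst.push t (fun τ i => .var τ i) := by
  funext τ i
  by_cases h : τ = σ
  · subst h; cases i <;> simp [Subst.single, Subst.push]
  · simp [Subst.single, Subst.push, h]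

theorem Tm.shift_subst_push {σ τ : Ty} (t : Tm σ) (s : Subst) (u : Tm τ) :
    (u.rename (shift σ)).subst (Subst.push t s) = u.subst s := by
  rw [Tm.rename_subst]
  congr 1
  funext τ i
  by_cases h : τ = σ
  · subst h; simp [shift, Subst.push]
  · simp [shift, Subst.push, h]

theorem Subst.push_comp {σ : Ty} (t : Tm σ) (s s' : Subst) :
    (fun τ i => ((Subst.push t s) τ i).subst s') =
      Subst.push (t.subst s') (fun τ i => (s τ i).subst s') := by
  funext τ i
  by_cases h : τ = σ
  · subst h; cases i <;> simp [Subst.push]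
  · simp [Subst.push, h]

theorem Subst.under_comp_push {σ : Ty} (t : Tm σ) (s s' : Subst) :
    (fun τ i => ((s.under σ) τ i).subst (Subst.push t s')) =
      Subst.push t (fun τ i => (s τ i).subst s') := by
  funext τ i
  by_cases h : τ = σ
  · subst h; cases i with
    | zero => simp [Subst.push, Subst.under, Tm.subst]
    | succ j =>
      simp only [Subst.under, if_true, Tm.shift_subst_push]
      simp [Subst.push]
  · simp only [Subst.under, if_neg h, Tm.shift_subst_push]
    simp [Subst.push, h]

theorem Formula.subst_under_inst {σ : Ty} (φ : Formula) (s : Subst) (t : Tm σ) :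
    (φ.subst (s.under σ)).inst t = φ.subst (Subst.push t s) := by
  rw [Formula.inst, Formula.subst_subst, Subst.single_eq_push, Subst.under_comp_push]
  simp

theorem Formula.inst_subst {σ : Ty} (φ : Formula) (s : Subst) (t : Tm σ) :
    (φ.inst t).subst s = (φ.subst (s.under σ)).inst (t.subst s) := by
  rw [Formula.subst_under_inst, Formula.inst, Formula.subst_subst, Subst.single_eq_push,
    Subst.push_comp]
  simp [Tm.subst]

theorem Formula.lift_subst_under (σ : Ty) (φ : Formula) (s : Subst) :
    (φ.lift σ).subst (s.under σ) = (φ.subst s).lift σ := by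
  simp only [Formula.lift, Formula.subst_subst]
  congr 1
  funext τ i
  rw [← Tm.rename_eq_subst]
  exact Tm.shift_subst_under σ s (.var τ i)

theorem Formula.subst_neg (φ : Formula) (s : Subst) : φ.neg.subst s = (φ.subst s).neg := rfl

theorem Formula.subst_and (φ ψ : Formula) (s : Subst) :
    (φ.and ψ).subst s = (φ.subst s).and (ψ.subst s) := rfl

theorem Formula.subst_iff (φ ψ : Formula) (s : Subst) :
    (φ.iff ψ).subst s = (φ.subst s).iff (ψ.subst s) := rfl

theorem Formula.subst_ex (σ : Ty) (φ : Formula) (s : Subst) :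
    (Formula.ex σ φ).subst s = .ex σ (φ.subst (s.under σ)) := rfl

theorem eqAt_subst (τ : Ty) (t u : Tm τ) (s : Subst) :
    (eqAt τ t u).subst s = eqAt τ (t.subst s) (u.subst s) := by
  induction τ generalizing s with
  | nat => rfl
  | arrow σ τ _ ih =>
    simp only [eqAt, Formula.subst, ih, Tm.subst, Tm.shift_subst_under]
    simp [Subst.under]

theorem Formula.QF.subst {φ : Formula} (h : φ.QF) (s : Subst) : (φ.subst s).QF := by
  induction φ with
  | imp φ ψ ih₁ ih₂ => exact ⟨ih₁ h.1, ih₂ h.2⟩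
  | all => exact h.elim
  | _ => trivial

/-! ### Closure of derivability under substitution -/

/-- This is what allows a parameter to be renamed to a bound variable, and hence generalization on
fresh variables in the Henkin construction. -/
theorem Proves.subst {T : Set Formula} (hT : ∀ φ ∈ T, ∀ s, φ.subst s ∈ T) {Γ : List Formula}
    {φ : Formula} (h : Proves T Γ φ) (s : Subst) :
    Proves T (Γ.map (·.subst s)) (φ.subst s) := by
  induction h generalizing s with
  | ax h => exact .ax (hT _ h s)
  | hyp h => exact .hyp (List.mem_map_of_mem h)
  | impIntro _ ih => exact .impIntro (ih s)
  | impElim _ _ ih₁ ih₂ => exact .impElim (ih₁ s) (ih₂ s)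
  | byContra _ ih => exact .byContra (ih s)
  | @allIntro Γ σ φ _ ih =>
    refine .allIntro ?_
    have := ih (s.under σ)
    simpa only [List.map_map, Function.comp_def, Formula.lift_subst_under] using this
  | allElim t _ ih =>
    rw [Formula.inst_subst]
    exact .allElim _ (ih s)
  | eqRefl t => exact .eqRefl _
  | eqSubst φ _ _ ih₁ ih₂ =>
    rw [Formula.inst_subst]
    refine .eqSubst _ (ih₁ s) ?_
    rw [← Formula.inst_subst]
    exact ih₂ s

theorem Proves.weaken {T : Set Formula} {Γ Δ : List Formula} {φ : Formula} (h : Proves T Γ φ)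
    (hΓ : Γ ⊆ Δ) : Proves T Δ φ := by
  induction h generalizing Δ with
  | ax h => exact .ax h
  | hyp h => exact .hyp (hΓ h)
  | impIntro _ ih => exact .impIntro (ih (List.cons_subset_cons _ hΓ))
  | impElim _ _ ih₁ ih₂ => exact .impElim (ih₁ hΓ) (ih₂ hΓ)
  | byContra _ ih => exact .byContra (ih (List.cons_subset_cons _ hΓ))
  | allIntro _ ih => exact .allIntro (ih (List.map_subset _ hΓ))
  | allElim t _ ih => exact .allElim _ (ih hΓ)
  | eqRefl t => exact .eqRefl _
  | eqSubst φ _ _ ih₁ ih₂ => exact .eqSubst _ (ih₁ hΓ) (ih₂ hΓ)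

/-- Under a binder of type `0`, `s` fixes the bound variable and puts only shifted terms elsewhere;
shifted terms do not contain that variable, so replacing it by its successor does not touch them. -/
theorem Subst.succZero_comp_under (s : Subst) :
    (fun τ i => (Subst.succZero τ i).subst (s.under .nat)) =
      fun τ i => ((s.under .nat) τ i).subst Subst.succZero := by
  have key : ∀ {τ : Ty} (u : Tm τ),
      (u.rename (shift .nat)).subst Subst.succZero = u.rename (shift .nat) := by
    intro τ u
    rw [Tm.rename_subst, Tm.rename_eq_subst]
    congr 1
    funext τ i
    by_cases h : τ = .nat
    · subst h; simp [shift, Subst.succZero]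
    · cases τ <;> simp_all [shift, Subst.succZero]
  funext τ i
  by_cases h : τ = .nat
  · subst h
    cases i with
    | zero => simp [Subst.succZero, Subst.under, Tm.subst]
    | succ j => simp only [Subst.under, if_true, key]; simp [Subst.succZero, Tm.subst, Subst.under]
  · simp only [Subst.under, if_neg h, key]
    cases τ <;> simp_all [Subst.succZero, Tm.subst, Subst.under]

/-- De Bruijn indices are counted separately for each type, so binders of different types do not
interact. The choice scheme needs this, since its conclusion binds the functional outside the
type-`1` variable. -/
theorem Subst.under_comm {σ ρ : Ty} (h : σ ≠ ρ) (s : Subst) :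
    (s.under σ).under ρ = (s.under ρ).under σ := by
  have hs : ∀ {τ : Ty} (u : Tm τ), (u.rename (shift σ)).rename (shift ρ) =
      (u.rename (shift ρ)).rename (shift σ) := by
    intro τ u
    simp only [Tm.rename_eq_subst, Tm.subst_subst, Tm.subst]
    congr 1
    funext τ i
    simp only [shift]
    split_ifs <;> rfl
  funext τ i
  by_cases h₁ : τ = σ
  · subst h₁
    cases i <;> simp [Subst.under, h, Tm.rename, shift, hs]
  · by_cases h₂ : τ = ρ
    · subst h₂
      cases i <;> simp [Subst.under, h₁, Tm.rename, shift, hs]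
    · simp [Subst.under, h₁, h₂, hs]

theorem RCA.subst {φ : Formula} (h : RCA φ) (s : Subst) : RCA (φ.subst s) := by
  cases h with
  | succ_ne_zero x => exact .succ_ne_zero _
  | succ_inj x y => exact .succ_inj _ _
  | add_zero x => exact .add_zero _
  | add_succ x y => exact .add_succ _ _
  | mul_zero x => exact .mul_zero _
  | mul_succ x y => exact .mul_succ _ _
  | not_lt_zero x => exact .not_lt_zero _
  | lt_succ x y => exact .lt_succ _ _
  | combK x y => rw [eqAt_subst]; exact .combK _ _
  | combS x y z => rw [eqAt_subst]; exact .combS _ _ _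
  | rec_zero m f => exact .rec_zero _ _
  | rec_succ m f n => exact .rec_succ _ _ _
  | ext F x y =>
    simp only [Formula.subst, eqAt_subst]
    exact .ext _ _ _
  | induction A hA =>
    have := RCA.induction (A.subst (s.under .nat)) (hA.subst _)
    simp only [Formula.subst, Formula.inst_subst]
    rwa [Formula.subst_subst, ← Subst.succZero_comp_under, ← Formula.subst_subst] at this
  | choice A hA =>
    have := RCA.choice (A.subst ((s.under .one).under .nat)) (hA.subst _)
    have e : (((A.lift .two).inst (Tm.var .two 0 ⬝ .var .one 0)).subst
        ((s.under .two).under .one)) =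
        ((A.subst ((s.under .one).under .nat)).lift .two).inst
          (Tm.var .two 0 ⬝ .var .one 0) := by
      rw [Formula.inst_subst, ← Formula.lift_subst_under]
      have h1 : (Tm.var .two 0 ⬝ .var .one 0).subst ((s.under .two).under .one) =
        (Tm.var .two 0 ⬝ .var .one 0) := by simp [Tm.subst, Subst.under, Tm.rename, shift]
      rw [h1]
      rw [Subst.under_comm (σ := .two) (ρ := .one) (by decide),
        Subst.under_comm (σ := .two) (ρ := .nat) (by decide)]
    simp only [Formula.subst, Formula.subst_ex, e]
    exact this

theorem ACA.subst {φ : Formula} (h : φ ∈ ACA) (s : Subst) : φ.subst s ∈ ACA := by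
  rcases h with h | rfl
  · exact .inl (h.subst s)
  · right
    simp [existsTwo, Formula.subst_ex, Formula.subst_and, Formula.subst_iff, Formula.subst, le,
      Tm.subst, Subst.under, Tm.rename, shift]

end HigherOrderArith

namespace HigherOrderArith

/-! ### Enumeration of formulas -/

def Ty.code : Ty → ℕ
  | .nat => 0
  | .arrow σ τ => Nat.pair σ.code τ.code + 1

theorem Ty.code_injective : Function.Injective Ty.code := by
  intro σ
  induction σ with
  | nat => intro τ h; cases τ <;> simp_all [Ty.code]
  | arrow σ τ ih₁ ih₂ =>
    intro ρ h
    cases ρ with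
    | nat => simp [Ty.code] at h
    | arrow σ' τ' =>
      simp only [Ty.code, Nat.add_right_cancel_iff, Nat.pair_eq_pair] at h
      rw [ih₁ h.1, ih₂ h.2]

def Tm.code : {σ : Ty} → Tm σ → ℕ
  | _, .var σ i => Nat.pair 0 (Nat.pair σ.code i)
  | _, .zero => Nat.pair 1 0
  | _, .succ => Nat.pair 2 0
  | _, .add => Nat.pair 3 0
  | _, .mul => Nat.pair 4 0
  | _, .combK ρ τ => Nat.pair 5 (Nat.pair ρ.code τ.code)
  | _, .combS δ ρ τ => Nat.pair 6 (Nat.pair δ.code (Nat.pair ρ.code τ.code))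
  | _, .recursor => Nat.pair 7 0
  | _, .app f x => Nat.pair 8 (Nat.pair f.code x.code)

/-- The statement is heterogeneous because an application hides the type of its argument: that type
is recovered only together with the subterms. -/
theorem Tm.code_injective {σ τ : Ty} (t : Tm σ) (u : Tm τ) (h : t.code = u.code) :
    σ = τ ∧ HEq t u := by
  induction t generalizing τ with
  | app f x ih₁ ih₂ =>
    cases u with
    | app g y =>
      simp only [Tm.code, Nat.pair_eq_pair, true_and] at h
      obtain ⟨h₁, h₁'⟩ := ih₁ g h.1
      obtain ⟨h₂, h₂'⟩ := ih₂ y h.2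
      cases h₁; cases h₁'; cases h₂'
      exact ⟨rfl, HEq.rfl⟩
    | _ => simp [Tm.code, Nat.pair_eq_pair] at h
  | var σ i =>
    cases u with
    | var τ j =>
      simp only [Tm.code, Nat.pair_eq_pair, true_and] at h
      cases Ty.code_injective h.1; cases h.2
      exact ⟨rfl, HEq.rfl⟩
    | _ => simp [Tm.code, Nat.pair_eq_pair] at h
  | combK ρ τ =>
    cases u with
    | combK ρ' τ' =>
      simp only [Tm.code, Nat.pair_eq_pair, true_and] at h
      cases Ty.code_injective h.1; cases Ty.code_injective h.2
      exact ⟨rfl, HEq.rfl⟩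
    | _ => simp [Tm.code, Nat.pair_eq_pair] at h
  | combS δ ρ τ =>
    cases u with
    | combS δ' ρ' τ' =>
      simp only [Tm.code, Nat.pair_eq_pair, true_and] at h
      cases Ty.code_injective h.1; cases Ty.code_injective h.2.1; cases Ty.code_injective h.2.2
      exact ⟨rfl, HEq.rfl⟩
    | _ => simp [Tm.code, Nat.pair_eq_pair] at h
  | _ => cases u <;> simp [Tm.code, Nat.pair_eq_pair] at h ⊢

def Formula.code : Formula → ℕ
  | .eq t u => Nat.pair 0 (Nat.pair t.code u.code)
  | .lt t u => Nat.pair 1 (Nat.pair t.code u.code)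
  | .falsum => Nat.pair 2 0
  | .imp φ ψ => Nat.pair 3 (Nat.pair φ.code ψ.code)
  | .all σ φ => Nat.pair 4 (Nat.pair σ.code φ.code)

theorem Formula.code_injective : Function.Injective Formula.code := by
  have hT : ∀ {t u : Tm .nat}, t.code = u.code → t = u := fun h =>
    eq_of_heq (Tm.code_injective _ _ h).2
  intro φ
  induction φ with
  | eq t u =>
    intro ψ h
    cases ψ <;> simp [Formula.code, Nat.pair_eq_pair] at h ⊢
    exact ⟨hT h.1, hT h.2⟩
  | lt t u =>
    intro ψ h
    cases ψ <;> simp [Formula.code, Nat.pair_eq_pair] at h ⊢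
    exact ⟨hT h.1, hT h.2⟩
  | falsum => intro ψ h; cases ψ <;> simp [Formula.code, Nat.pair_eq_pair] at h ⊢
  | imp φ₁ φ₂ ih₁ ih₂ =>
    intro ψ h
    cases ψ <;> simp [Formula.code, Nat.pair_eq_pair] at h ⊢
    exact ⟨ih₁ h.1, ih₂ h.2⟩
  | all σ φ ih =>
    intro ψ h
    cases ψ <;> simp [Formula.code, Nat.pair_eq_pair] at h ⊢
    exact ⟨Ty.code_injective h.1, ih h.2⟩

instance : Countable Formula := Formula.code_injective.countable

instance : Inhabited Formula := ⟨.falsum⟩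

/-! ### Finite support of formulas -/

theorem Tm.exists_support {σ : Ty} (t : Tm σ) : ∃ n : ℕ, ∀ s s' : Subst,
    (∀ τ, ∀ i < n, s τ i = s' τ i) → t.subst s = t.subst s' := by
  induction t with
  | var σ i => exact ⟨i + 1, fun s s' h => h σ i (Nat.lt_succ_self i)⟩
  | app f x ih₁ ih₂ =>
    obtain ⟨n, hn⟩ := ih₁
    obtain ⟨m, hm⟩ := ih₂
    refine ⟨max n m, fun s s' h => ?_⟩
    simp only [Tm.subst]
    rw [hn s s' fun τ i hi => h τ i (lt_max_of_lt_left hi),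
      hm s s' fun τ i hi => h τ i (lt_max_of_lt_right hi)]
  | _ => exact ⟨0, fun _ _ _ => rfl⟩

/-- One bound serves for all types at once. A bound for the body also works for the quantified
formula, since passing under a binder only raises indices. -/
theorem Formula.exists_support (φ : Formula) : ∃ n : ℕ, ∀ s s' : Subst,
    (∀ τ, ∀ i < n, s τ i = s' τ i) → φ.subst s = φ.subst s' := by
  induction φ with
  | falsum => exact ⟨0, fun _ _ _ => rfl⟩
  | eq t u | lt t u =>
    obtain ⟨n, hn⟩ := t.exists_support
    obtain ⟨m, hm⟩ := u.exists_support
    refine ⟨max n m, fun s s' h => ?_⟩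
    simp only [Formula.subst]
    rw [hn s s' fun τ i hi => h τ i (lt_max_of_lt_left hi),
      hm s s' fun τ i hi => h τ i (lt_max_of_lt_right hi)]
  | imp φ ψ ih₁ ih₂ =>
    obtain ⟨n, hn⟩ := ih₁
    obtain ⟨m, hm⟩ := ih₂
    refine ⟨max n m, fun s s' h => ?_⟩
    simp only [Formula.subst]
    rw [hn s s' fun τ i hi => h τ i (lt_max_of_lt_left hi),
      hm s s' fun τ i hi => h τ i (lt_max_of_lt_right hi)]
  | all σ φ ih =>
    obtain ⟨n, hn⟩ := ih
    refine ⟨n, fun s s' h => ?_⟩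
    simp only [Formula.subst]
    rw [hn]
    intro τ i hi
    by_cases hτ : τ = σ
    · subst hτ
      cases i with
      | zero => simp [Subst.under]
      | succ j => simp [Subst.under, h _ j (by omega)]
    · simp [Subst.under, hτ, h _ i hi]

theorem exists_support_list (Γ : List Formula) : ∃ n : ℕ, ∀ φ ∈ Γ, ∀ s s' : Subst,
    (∀ τ, ∀ i < n, s τ i = s' τ i) → φ.subst s = φ.subst s' := by
  induction Γ with
  | nil => exact ⟨0, by simp⟩
  | cons φ Γ ih =>
    obtain ⟨n, hn⟩ := φ.exists_support
    obtain ⟨m, hm⟩ := ih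
    refine ⟨max n m, fun ψ hψ s s' h => ?_⟩
    rcases List.mem_cons.1 hψ with rfl | hψ
    · exact hn s s' fun τ i hi => h τ i (lt_max_of_lt_left hi)
    · exact hm ψ hψ s s' fun τ i hi => h τ i (lt_max_of_lt_right hi)

/-- Generalization on a fresh variable. -/
theorem Proves.exists_generalize {T : Set Formula} (hT : ∀ φ ∈ T, ∀ s, φ.subst s ∈ T)
    (Γ : List Formula) (σ : Ty) (φ : Formula) :
    ∃ i : ℕ, Proves T Γ (φ.inst (.var σ i)) → Proves T Γ (.all σ φ) := by
  obtain ⟨n, hn⟩ := exists_support_list (φ :: Γ)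
  refine ⟨n, fun h => .allIntro ?_⟩
  -- `r` sends the fresh variable to the bound one and shifts all others. On `Γ` it is therefore the
  -- lift, and on `φ` it undoes the instantiation.
  let r : Subst := fun τ j => if τ = σ ∧ j = n then .var τ 0 else .var τ (shift σ τ j)
  have h' := h.subst hT r
  have e₁ : Γ.map (·.subst r) = Γ.map (Formula.lift σ) := by
    refine List.map_congr_left fun ψ hψ => hn ψ (List.mem_cons_of_mem _ hψ) _ _ ?_
    intro τ i hi
    simp [r, hi.ne]
  have e₂ : (φ.inst (.var σ n)).subst r = φ := by
    rw [Formula.inst, Subst.single_eq_push, Formula.subst_subst, Subst.push_comp]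
    conv_rhs => rw [← φ.subst_var]
    refine hn φ List.mem_cons_self _ _ fun τ i hi => ?_
    by_cases hτ : τ = σ
    · subst hτ
      cases i with
      | zero => simp [Subst.push, Tm.subst, r]
      | succ j => simp [Subst.push, Tm.subst, r, shift, (show j ≠ n by omega)]
    · simp [Subst.push, Tm.subst, r, hτ, shift]
  rwa [e₁, e₂] at h'

/-! ### Henkin extensions -/

/-- A complete theory with witnesses, closed under derivability from `T`. -/
structure Henkin (T : Set Formula) (H : Set Formula) : Prop where
  closed : ∀ {Γ : List Formula} {φ : Formula}, (∀ ψ ∈ Γ, ψ ∈ H) → Proves T Γ φ → φ ∈ H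
  consistent : Formula.falsum ∉ H
  complete : ∀ φ, φ ∈ H ∨ φ.neg ∈ H
  witness : ∀ {σ : Ty} {φ : Formula}, (Formula.all σ φ).neg ∈ H → ∃ t : Tm σ, (φ.inst t).neg ∈ H

/-- Each stage is a finite list, so some variable is always fresh and can serve as the
counterexample to a refuted universal formula; no new constants are needed. -/
theorem exists_henkin_step {T : Set Formula} (hT : ∀ φ ∈ T, ∀ s, φ.subst s ∈ T)
    (Γ : {Γ : List Formula // ¬ Proves T Γ .falsum}) (φ : Formula) :
    ∃ Δ : {Γ : List Formula // ¬ Proves T Γ .falsum}, Γ.1 ⊆ Δ.1 ∧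
      (φ ∈ Δ.1 ∨ φ.neg ∈ Δ.1) ∧
      ∀ σ ψ, φ = .all σ ψ → φ ∈ Δ.1 ∨ ∃ t : Tm σ, (ψ.inst t).neg ∈ Δ.1 := by
  obtain ⟨Γ, hΓ⟩ := Γ
  by_cases h : Proves T (φ :: Γ) .falsum
  · have hn : ¬ Proves T (φ.neg :: Γ) .falsum := fun h' =>
      hΓ (.impElim (.impIntro h) (.byContra h'))
    by_cases ha : ∃ σ ψ, φ = .all σ ψ
    · obtain ⟨σ, ψ, rfl⟩ := ha
      obtain ⟨i, hi⟩ := Proves.exists_generalize hT ((Formula.all σ ψ).neg :: Γ) σ ψ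
      refine ⟨⟨(ψ.inst (.var σ i)).neg :: (Formula.all σ ψ).neg :: Γ, fun h' => hn ?_⟩,
        fun x hx => by simp [hx], .inr (by simp), ?_⟩
      -- If the counterexample were inconsistent, generalizing on the fresh variable would prove the
      -- universal formula just refuted.
      · exact .impElim (.hyp List.mem_cons_self) (hi (.byContra h'))
      · rintro σ' ψ' e
        cases e
        exact .inr ⟨.var σ i, List.mem_cons_self⟩
    · exact ⟨⟨φ.neg :: Γ, hn⟩, fun x hx => by simp [hx], .inr (by simp),
        fun σ ψ e => (ha ⟨σ, ψ, e⟩).elim⟩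
  · exact ⟨⟨φ :: Γ, h⟩, fun x hx => by simp [hx], .inl (by simp), fun _ _ _ => .inl (by simp)⟩

theorem exists_henkin {T : Set Formula} (hT : ∀ φ ∈ T, ∀ s, φ.subst s ∈ T) {φ : Formula}
    (hφ : ¬ Proves T [] φ) : ∃ H, Henkin T H ∧ φ.neg ∈ H := by
  obtain ⟨e, he⟩ := exists_surjective_nat Formula
  choose step h₁ h₂ h₃ using exists_henkin_step hT
  let Δ : ℕ → {Γ : List Formula // ¬ Proves T Γ .falsum} := fun n =>
    n.rec ⟨[φ.neg], fun h => hφ (.byContra h)⟩ fun n Γ => step Γ (e n)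
  have mono : ∀ {m n}, m ≤ n → (Δ m).1 ⊆ (Δ n).1 := by
    intro m n h
    induction h with
    | refl => exact fun _ h => h
    | step _ ih => exact fun x hx => h₁ _ _ (ih hx)
  have bound : ∀ Γ : List Formula, (∀ ψ ∈ Γ, ∃ n, ψ ∈ (Δ n).1) → ∃ n, Γ ⊆ (Δ n).1 := by
    intro Γ
    induction Γ with
    | nil => intro; exact ⟨0, by simp⟩
    | cons ψ Γ ih =>
      intro h
      obtain ⟨n, hn⟩ := h ψ List.mem_cons_self
      obtain ⟨m, hm⟩ := ih fun χ hχ => h χ (List.mem_cons_of_mem _ hχ)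
      refine ⟨max n m, List.cons_subset.2 ⟨mono (le_max_left _ _) hn, fun x hx => ?_⟩⟩
      exact mono (le_max_right _ _) (hm hx)
  have compl : ∀ ψ, (∃ n, ψ ∈ (Δ n).1) ∨ ∃ n, ψ.neg ∈ (Δ n).1 := by
    intro ψ
    obtain ⟨n, rfl⟩ := he ψ
    exact (h₂ (Δ n) (e n)).imp (fun h => ⟨n + 1, h⟩) fun h => ⟨n + 1, h⟩
  have clos : ∀ {Γ : List Formula} {ψ : Formula}, (∀ χ ∈ Γ, ∃ n, χ ∈ (Δ n).1) →
      Proves T Γ ψ → ∃ n, ψ ∈ (Δ n).1 := by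
    intro Γ ψ hΓ h
    refine (compl ψ).resolve_right fun hn => ?_
    obtain ⟨n, hn⟩ := bound (ψ.neg :: Γ) fun χ hχ => by
      rcases List.mem_cons.1 hχ with rfl | hχ
      exacts [hn, hΓ χ hχ]
    refine (Δ n).2 (Proves.weaken (Γ := ψ.neg :: Γ) ?_ hn)
    exact .impElim (.hyp List.mem_cons_self) (h.weaken (List.subset_cons_self _ _))
  have cons : ¬ ∃ n, Formula.falsum ∈ (Δ n).1 := fun ⟨n, hn⟩ => (Δ n).2 (.hyp hn)
  refine ⟨{ψ | ∃ n, ψ ∈ (Δ n).1}, ⟨clos, cons, compl, ?_⟩, 0, List.mem_cons_self⟩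
  intro σ ψ h
  obtain ⟨n, hn⟩ := he (.all σ ψ)
  -- The witness enters at the stage that decides the universal formula; had that stage accepted it,
  -- the theory would also contain its negation.
  rcases h₃ (Δ n) (e n) σ ψ hn with h' | ⟨t, ht⟩
  · refine (cons (clos (Γ := [(Formula.all σ ψ).neg, .all σ ψ]) ?_
      (.impElim (φ := .all σ ψ) (.hyp List.mem_cons_self) (.hyp (by simp))))).elim
    intro χ hχ
    simp only [List.mem_cons, List.not_mem_nil, or_false] at hχ
    rcases hχ with rfl | rfl
    · exact h
    · exact ⟨n + 1, hn ▸ h'⟩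
  · exact ⟨t, n + 1, ht⟩

end HigherOrderArith

namespace HigherOrderArith

/-! ### Structures and satisfaction -/

/-- A structure for the language `L_ω`, with an arbitrary domain for each type. -/
structure Str where
  Obj : Ty → Type
  app : {σ τ : Ty} → Obj (σ ⇾ τ) → Obj σ → Obj τ
  zero : Obj .nat
  succ : Obj (.nat ⇾ .nat)
  add : Obj (.nat ⇾ .nat ⇾ .nat)
  mul : Obj (.nat ⇾ .nat ⇾ .nat)
  combK (ρ τ : Ty) : Obj (ρ ⇾ τ ⇾ ρ)
  combS (δ ρ τ : Ty) : Obj ((δ ⇾ ρ ⇾ τ) ⇾ (δ ⇾ ρ) ⇾ δ ⇾ τ)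
  recursor : Obj (.nat ⇾ (.nat ⇾ .nat ⇾ .nat) ⇾ .nat ⇾ .nat)
  lt : Obj .nat → Obj .nat → Prop

namespace Str

/-- Assignments of objects to the variables. -/
abbrev Env (M : Str) := (σ : Ty) → ℕ → M.Obj σ

/-- Adjoining a value for `var σ 0` to an assignment. -/
def Env.push {M : Str} {σ : Ty} (x : M.Obj σ) (e : M.Env) : M.Env := fun τ i =>
  if h : τ = σ then
    match i with
    | 0 => h ▸ x
    | j + 1 => e τ j
  else e τ i

def eval (M : Str) (e : M.Env) : {σ : Ty} → Tm σ → M.Obj σ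
  | _, .var σ i => e σ i
  | _, .zero => M.zero
  | _, .succ => M.succ
  | _, .add => M.add
  | _, .mul => M.mul
  | _, .combK ρ τ => M.combK ρ τ
  | _, .combS δ ρ τ => M.combS δ ρ τ
  | _, .recursor => M.recursor
  | _, .app f x => M.app (M.eval e f) (M.eval e x)

def Sat (M : Str) : Formula → M.Env → Prop
  | .eq t u, e => M.eval e t = M.eval e u
  | .lt t u, e => M.lt (M.eval e t) (M.eval e u)
  | .falsum, _ => False
  | .imp φ ψ, e => M.Sat φ e → M.Sat ψ e
  | .all σ φ, e => ∀ x : M.Obj σ, M.Sat φ (e.push x)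

/-- Functional objects with the same values are equal. -/
def Extensional (M : Str) : Prop :=
  ∀ {σ τ : Ty} (F G : M.Obj (σ ⇾ τ)), (∀ x, M.app F x = M.app G x) → F = G

variable {M : Str}

theorem eval_rename (e : M.Env) (r : Ren) {σ : Ty} (t : Tm σ) :
    M.eval e (t.rename r) = M.eval (fun τ i => e τ (r τ i)) t := by
  induction t <;> simp_all [Tm.rename, eval]

theorem eval_subst (e : M.Env) (s : Subst) {σ : Ty} (t : Tm σ) :
    M.eval e (t.subst s) = M.eval (fun τ i => M.eval e (s τ i)) t := by
  induction t <;> simp_all [Tm.subst, eval]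

theorem push_shift (e : M.Env) {σ : Ty} (x : M.Obj σ) :
    (fun τ i => e.push x τ (shift σ τ i)) = e := by
  funext τ i
  by_cases h : τ = σ
  · subst h; simp [shift, Env.push]
  · simp [shift, Env.push, h]

theorem eval_shift (e : M.Env) {σ τ : Ty} (x : M.Obj σ) (t : Tm τ) :
    M.eval (e.push x) (t.rename (shift σ)) = M.eval e t := by
  rw [eval_rename, push_shift]

theorem sat_subst (φ : Formula) (e : M.Env) (s : Subst) :
    M.Sat (φ.subst s) e ↔ M.Sat φ (fun τ i => M.eval e (s τ i)) := by
  induction φ generalizing e s with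
  | eq t u => simp [Formula.subst, Sat, eval_subst]
  | lt t u => simp [Formula.subst, Sat, eval_subst]
  | falsum => rfl
  | imp φ ψ ih₁ ih₂ => simp [Formula.subst, Sat, ih₁, ih₂]
  | all σ φ ih =>
    simp only [Formula.subst, Sat, ih]
    refine forall_congr' fun x => ?_
    suffices h : (fun τ i => M.eval (e.push x) (s.under σ τ i)) =
        Env.push x (fun τ i => M.eval e (s τ i)) by rw [h]
    funext τ i
    by_cases h : τ = σ
    · subst h
      cases i with
      | zero => simp [Subst.under, Env.push, eval]
      | succ j => simp only [Subst.under, if_true, eval_shift]; simp [Env.push]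
    · simp only [Subst.under, if_neg h, eval_shift]; simp [Env.push, h]

theorem sat_inst {σ : Ty} (φ : Formula) (e : M.Env) (t : Tm σ) :
    M.Sat (φ.inst t) e ↔ M.Sat φ (e.push (M.eval e t)) := by
  rw [Formula.inst, sat_subst]
  suffices h : (fun τ i => M.eval e (Subst.single t τ i)) = e.push (M.eval e t) by rw [h]
  funext τ i
  by_cases h : τ = σ
  · subst h; cases i <;> simp [Subst.single, Env.push, eval]
  · simp [Subst.single, Env.push, h, eval]

theorem sat_lift {σ : Ty} (φ : Formula) (e : M.Env) (x : M.Obj σ) :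
    M.Sat (φ.lift σ) (e.push x) ↔ M.Sat φ e := by
  rw [Formula.lift, sat_subst]
  simp only [eval, push_shift]

theorem sat_neg (φ : Formula) (e : M.Env) : M.Sat φ.neg e ↔ ¬ M.Sat φ e := Iff.rfl

theorem sat_and (φ ψ : Formula) (e : M.Env) :
    M.Sat (φ.and ψ) e ↔ M.Sat φ e ∧ M.Sat ψ e := by
  simp [Formula.and, Formula.neg, Sat]

theorem sat_or (φ ψ : Formula) (e : M.Env) :
    M.Sat (φ.or ψ) e ↔ M.Sat φ e ∨ M.Sat ψ e := by
  simp only [Formula.or, Formula.neg, Sat]; tauto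

theorem sat_iff (φ ψ : Formula) (e : M.Env) :
    M.Sat (φ.iff ψ) e ↔ (M.Sat φ e ↔ M.Sat ψ e) := by
  simp only [Formula.iff, sat_and, Sat]; tauto

theorem sat_ex (σ : Ty) (φ : Formula) (e : M.Env) :
    M.Sat (.ex σ φ) e ↔ ∃ x : M.Obj σ, M.Sat φ (e.push x) := by
  simp [Formula.ex, Formula.neg, Sat]

theorem sat_eqAt (hM : M.Extensional) {τ : Ty} (t u : Tm τ) (e : M.Env) :
    M.Sat (eqAt τ t u) e ↔ M.eval e t = M.eval e u := by
  induction τ generalizing e with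
  | nat => rfl
  | arrow σ τ _ ih =>
    simp only [eqAt, Sat, ih, eval, eval_shift]
    have : ∀ x : M.Obj σ, e.push x σ 0 = x := fun x => by simp [Env.push]
    simp only [this]
    exact ⟨fun h => hM _ _ h, fun h x => by rw [h]⟩

end Str

/-! ### The term structure of a Henkin theory -/

namespace Henkin

variable {T H : Set Formula}

theorem imp_iff (h : Henkin T H) {φ ψ : Formula} : (φ ⟹ ψ) ∈ H ↔ (φ ∈ H → ψ ∈ H) := by
  constructor
  · intro h₁ h₂
    refine h.closed (Γ := [φ ⟹ ψ, φ]) ?_ (.impElim (φ := φ) (.hyp List.mem_cons_self) (.hyp (by simp)))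
    simp [h₁, h₂]
  · intro h'
    rcases h.complete φ with h₁ | h₁
    · exact h.closed (Γ := [ψ]) (by simpa using h' h₁) (.impIntro (.hyp (by simp)))
    · refine h.closed (Γ := [φ.neg]) (by simpa using h₁) (.impIntro (.byContra ?_))
      exact .impElim (φ := φ) (.hyp (by simp [Formula.neg])) (.hyp (by simp))

theorem all_iff (h : Henkin T H) {σ : Ty} {φ : Formula} :
    .all σ φ ∈ H ↔ ∀ t : Tm σ, φ.inst t ∈ H := by
  constructor
  · intro h₁ t
    exact h.closed (Γ := [.all σ φ]) (by simpa using h₁) (.allElim t (.hyp (by simp)))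
  · intro h'
    refine (h.complete _).resolve_right fun hn => ?_
    obtain ⟨t, ht⟩ := h.witness hn
    exact h.consistent (h.imp_iff.1 ht (h' t))

theorem ax (h : Henkin T H) {φ : Formula} (hφ : φ ∈ T) : φ ∈ H :=
  h.closed (Γ := []) (by simp) (.ax hφ)

theorem eqSubst (h : Henkin T H) {s t : Tm .nat} (φ : Formula) (h₁ : (s ≐ t) ∈ H)
    (h₂ : φ.inst s ∈ H) : φ.inst t ∈ H :=
  h.closed (Γ := [s ≐ t, φ.inst s]) (by simp [h₁, h₂])
    (.eqSubst (s := s) φ (.hyp (by simp)) (.hyp (by simp)))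

theorem _root_.HigherOrderArith.Tm.shift_subst_single {σ τ : Ty} (t : Tm σ) (u : Tm τ) :
    (u.rename (shift σ)).subst (Subst.single t) = u := by
  rw [Subst.single_eq_push, Tm.shift_subst_push, Tm.subst_var]

/-- Witnesses turn the quantifier in higher-type equality into one over terms. Equality is then
pointwise on the quotient, which makes the term structure extensional. -/
theorem eqAt_arrow_iff (h : Henkin T H) {σ τ : Ty} {f g : Tm (σ ⇾ τ)} :
    eqAt (σ ⇾ τ) f g ∈ H ↔ ∀ t : Tm σ, eqAt τ (f ⬝ t) (g ⬝ t) ∈ H := by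
  rw [eqAt, h.all_iff]
  refine forall_congr' fun t => ?_
  rw [Formula.inst, eqAt_subst]
  simp only [Tm.subst, Tm.shift_subst_single]
  simp [Subst.single]

theorem eqAt_refl (h : Henkin T H) {σ : Ty} (t : Tm σ) : eqAt σ t t ∈ H := by
  induction σ with
  | nat => exact h.closed (Γ := []) (by simp) (.eqRefl t)
  | arrow σ τ _ ih => exact h.eqAt_arrow_iff.2 fun _ => ih _

theorem eq_symm (h : Henkin T H) {t u : Tm .nat} (h₁ : (t ≐ u) ∈ H) : (u ≐ t) ∈ H := by
  have := h.eqSubst (s := t) (t := u) (.var .nat 0 ≐ t.rename (shift .nat)) h₁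
  simp only [Formula.inst, Formula.subst, Tm.shift_subst_single] at this
  simp only [Tm.subst, Subst.single] at this
  exact this (h.eqAt_refl t)

theorem eq_trans (h : Henkin T H) {t u v : Tm .nat} (h₁ : (t ≐ u) ∈ H) (h₂ : (u ≐ v) ∈ H) :
    (t ≐ v) ∈ H := by
  have := h.eqSubst (s := u) (t := v) (t.rename (shift .nat) ≐ .var .nat 0) h₂
  simp only [Formula.inst, Formula.subst, Tm.shift_subst_single] at this
  simp only [Tm.subst, Subst.single] at this
  exact this h₁

theorem lt_congr (h : Henkin T H) {t t' u u' : Tm .nat} (h₁ : (t ≐ t') ∈ H) (h₂ : (u ≐ u') ∈ H)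
    (h₃ : (t ≺ u) ∈ H) : (t' ≺ u') ∈ H := by
  have a := h.eqSubst (s := t) (t := t') (.var .nat 0 ≺ u.rename (shift .nat)) h₁
  have b := h.eqSubst (s := u) (t := u') (t'.rename (shift .nat) ≺ .var .nat 0) h₂
  simp only [Formula.inst, Formula.subst, Tm.shift_subst_single] at a b
  simp only [Tm.subst, Subst.single] at a b
  exact b (a h₃)

theorem eqAt_symm (h : Henkin T H) {σ : Ty} {t u : Tm σ} (h₁ : eqAt σ t u ∈ H) :
    eqAt σ u t ∈ H := by
  induction σ with
  | nat => exact h.eq_symm h₁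
  | arrow σ τ _ ih =>
    rw [h.eqAt_arrow_iff] at h₁ ⊢
    exact fun v => ih (h₁ v)

theorem eqAt_trans (h : Henkin T H) {σ : Ty} {t u v : Tm σ} (h₁ : eqAt σ t u ∈ H)
    (h₂ : eqAt σ u v ∈ H) : eqAt σ t v ∈ H := by
  induction σ with
  | nat => exact h.eq_trans h₁ h₂
  | arrow σ τ _ ih =>
    rw [h.eqAt_arrow_iff] at h₁ h₂ ⊢
    exact fun w => ih (h₁ w) (h₂ w)

/-- Provable extensional equality of terms. -/
def setoid (h : Henkin T H) (σ : Ty) : Setoid (Tm σ) where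
  r t u := eqAt σ t u ∈ H
  iseqv := ⟨h.eqAt_refl, h.eqAt_symm, h.eqAt_trans⟩

/-- The extensionality axiom handles the change of argument, and the pointwise definition of
equality handles the change of function. -/
theorem app_congr (h : Henkin T H) (hT : ∀ φ, RCA φ → φ ∈ T) {σ τ : Ty} {f g : Tm (σ ⇾ τ)}
    {t u : Tm σ} (h₁ : eqAt (σ ⇾ τ) f g ∈ H) (h₂ : eqAt σ t u ∈ H) :
    eqAt τ (f ⬝ t) (g ⬝ u) ∈ H :=
  h.eqAt_trans (h.imp_iff.1 (h.ax (hT _ (.ext f t u))) h₂) (h.eqAt_arrow_iff.1 h₁ u)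

/-- The structure of terms modulo provable extensional equality. -/
def termStr (h : Henkin T H) (hT : ∀ φ, RCA φ → φ ∈ T) : Str where
  Obj σ := Quotient (h.setoid σ)
  app := Quotient.map₂ (fun f t => f ⬝ t) fun _ _ h₁ _ _ h₂ => h.app_congr hT h₁ h₂
  zero := Quotient.mk _ .zero
  succ := Quotient.mk _ .succ
  add := Quotient.mk _ .add
  mul := Quotient.mk _ .mul
  combK ρ τ := Quotient.mk _ (.combK ρ τ)
  combS δ ρ τ := Quotient.mk _ (.combS δ ρ τ)
  recursor := Quotient.mk _ .recursor
  lt := Quotient.lift₂ (fun t u => (t ≺ u) ∈ H) fun _ _ _ _ h₁ h₂ =>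
    propext ⟨h.lt_congr h₁ h₂, h.lt_congr (h.eq_symm h₁) (h.eq_symm h₂)⟩

variable (h : Henkin T H) (hT : ∀ φ, RCA φ → φ ∈ T)

/-- The assignment of the class of `s σ i` to `var σ i`. -/
def env (s : Subst) : (h.termStr hT).Env := fun σ i => Quotient.mk (h.setoid σ) (s σ i)

theorem eval_env (s : Subst) {σ : Ty} (t : Tm σ) :
    (h.termStr hT).eval (h.env hT s) t = Quotient.mk (h.setoid σ) (t.subst s) := by
  induction t with
  | app f t ih₁ ih₂ => simp only [Str.eval, ih₁, ih₂]; rfl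
  | _ => rfl

theorem env_push {σ : Ty} (s : Subst) (t : Tm σ) :
    Str.Env.push (M := h.termStr hT) (Quotient.mk (h.setoid σ) t) (h.env hT s) =
      h.env hT (Subst.push t s) := by
  funext τ i
  by_cases e : τ = σ
  · subst e; cases i <;> simp [Str.Env.push, env, Subst.push] <;> rfl
  · simp [Str.Env.push, env, Subst.push, e]; rfl

/-- The truth lemma. The quantifier case works because every element of the quotient is the class of
a term. -/
theorem sat_env (φ : Formula) (s : Subst) :
    (h.termStr hT).Sat φ (h.env hT s) ↔ φ.subst s ∈ H := by
  induction φ generalizing s with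
  | eq t u =>
    simp only [Str.Sat, eval_env, Formula.subst]
    exact Quotient.eq (r := h.setoid .nat)
  | lt t u =>
    simp only [Str.Sat, eval_env, Formula.subst]
    rfl
  | falsum => exact ⟨False.elim, h.consistent⟩
  | imp φ ψ ih₁ ih₂ => simp only [Str.Sat, ih₁, ih₂, Formula.subst, h.imp_iff]
  | all σ φ ih =>
    simp only [Str.Sat, Formula.subst, h.all_iff, Formula.subst_under_inst, ← ih, ← env_push]
    exact ⟨fun h' t => h' _, fun h' x => Quotient.inductionOn x h'⟩

theorem exists_env (e : (h.termStr hT).Env) : ∃ s, h.env hT s = e :=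
  ⟨fun σ i => Quotient.out (s := h.setoid σ) (e σ i), by
    funext σ i
    exact Quotient.out_eq (s := h.setoid σ) (e σ i)⟩

theorem termStr_extensional : (h.termStr hT).Extensional := by
  intro σ τ F G
  refine Quotient.inductionOn₂ (s₁ := h.setoid _) (s₂ := h.setoid _) F G fun f g hfg => ?_
  refine Quotient.sound (s := h.setoid _) (h.eqAt_arrow_iff.2 fun t => ?_)
  exact Quotient.exact (s := h.setoid τ) (hfg (Quotient.mk _ t))

end Henkin

/-- Completeness of natural deduction for extensional structures. -/
theorem Proves.of_forall_sat {T : Set Formula} (hT : ∀ φ, RCA φ → φ ∈ T)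
    (hs : ∀ φ ∈ T, ∀ s, φ.subst s ∈ T) {φ : Formula}
    (h : ∀ M : Str, M.Extensional → (∀ ψ ∈ T, ∀ e, M.Sat ψ e) → ∀ e, M.Sat φ e) :
    Proves T [] φ := by
  by_contra hφ
  obtain ⟨H, hH, hn⟩ := exists_henkin hs hφ
  have := h (hH.termStr hT) (hH.termStr_extensional hT) (fun ψ hψ e => by
    -- Every assignment comes from a substitution, so closure of `T` under substitution makes its
    -- formulas true under all assignments.
    obtain ⟨s, rfl⟩ := hH.exists_env hT e
    exact (hH.sat_env hT ψ s).2 (hH.ax (hs ψ hψ s))) (hH.env hT fun σ i => .var σ i)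
  rw [hH.sat_env, Formula.subst_var] at this
  exact hH.consistent (hH.imp_iff.1 hn this)

end HigherOrderArith

namespace HigherOrderArith

/-! ### Laws of arithmetic structures -/

/-- Application in a structure. -/
infixl:90 " ⬩ " => Str.app _

/-- An extensional structure satisfying the axioms of `ACA₀^ω`. -/
class Str.IsModel (M : Str) : Prop where
  ext' : M.Extensional
  sat : ∀ φ ∈ ACA, ∀ e, M.Sat φ e

namespace Str

/-- The numbers of a structure. -/
abbrev N (M : Str) : Type := M.Obj .nat

def default (M : Str) : (σ : Ty) → M.Obj σ
  | .nat => M.zero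
  | .arrow _ τ => M.combK _ _ ⬩ M.default τ

instance (M : Str) (σ : Ty) : Nonempty (M.Obj σ) := ⟨M.default σ⟩

@[simp] theorem push_zero {M : Str} {σ : Ty} (e : M.Env) (x : M.Obj σ) : e.push x σ 0 = x := by
  simp [Env.push]

@[simp] theorem push_succ {M : Str} {σ : Ty} (e : M.Env) (x : M.Obj σ) (i : ℕ) :
    e.push x σ (i + 1) = e σ i := by
  simp [Env.push]

theorem push_of_ne {M : Str} {σ τ : Ty} (e : M.Env) (x : M.Obj σ) (i : ℕ) (h : τ ≠ σ) :
    e.push x τ i = e τ i := by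
  simp [Env.push, h]

theorem push_comm {M : Str} {σ τ : Ty} (h : σ ≠ τ) (e : M.Env) (x : M.Obj σ) (y : M.Obj τ) :
    (e.push x).push y = (e.push y).push x := by
  funext ρ i
  by_cases h₁ : ρ = σ
  · subst h₁
    rw [push_of_ne _ _ _ h]
    cases i
    · simp
    · simp [push_of_ne _ _ _ h]
  · rw [push_of_ne _ x _ h₁]
    by_cases h₂ : ρ = τ
    · subst h₂
      cases i
      · simp
      · simp [push_of_ne _ _ _ h₁]
    · simp [push_of_ne _ _ _ h₁, push_of_ne _ _ _ h₂]

variable {M : Str} [hM : M.IsModel]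

theorem ext {σ τ : Ty} {F G : M.Obj (σ ⇾ τ)} (h : ∀ x, F ⬩ x = G ⬩ x) : F = G :=
  IsModel.ext' F G h

theorem sat_rca {φ : Formula} (h : RCA φ) (e : M.Env) : M.Sat φ e := IsModel.sat _ (.inl h) e

/-- The assignment with default values. -/
def env₀ (M : Str) : M.Env := fun σ _ => M.default σ

theorem succ_ne_zero (x : M.N) : M.succ ⬩ x ≠ M.zero := by
  simpa [sat_neg, Sat, eval] using sat_rca (.succ_ne_zero (.var .nat 0)) (M.env₀.push x)

theorem succ_inj {x y : M.N} (h : M.succ ⬩ x = M.succ ⬩ y) : x = y := by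
  have := sat_rca (.succ_inj (.var .nat 1) (.var .nat 0)) ((M.env₀.push x).push y)
  simp only [Sat, eval, push_zero, push_succ] at this
  simpa using this (by simpa using h)

theorem app_add_zero (x : M.N) : M.add ⬩ x ⬩ M.zero = x := by
  simpa [Sat, eval] using sat_rca (.add_zero (.var .nat 0)) (M.env₀.push x)

theorem app_add_succ (x y : M.N) : M.add ⬩ x ⬩ (M.succ ⬩ y) = M.succ ⬩ (M.add ⬩ x ⬩ y) := by
  have := sat_rca (.add_succ (.var .nat 1) (.var .nat 0)) ((M.env₀.push x).push y)
  simpa [Sat, eval, Env.push] using this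

theorem app_mul_zero (x : M.N) : M.mul ⬩ x ⬩ M.zero = M.zero := by
  simpa [Sat, eval] using sat_rca (.mul_zero (.var .nat 0)) (M.env₀.push x)

theorem app_mul_succ (x y : M.N) : M.mul ⬩ x ⬩ (M.succ ⬩ y) = M.add ⬩ (M.mul ⬩ x ⬩ y) ⬩ x := by
  have := sat_rca (.mul_succ (.var .nat 1) (.var .nat 0)) ((M.env₀.push x).push y)
  simpa [Sat, eval, Env.push] using this

theorem not_lt_zero (x : M.N) : ¬ M.lt x M.zero := by
  simpa [sat_neg, Sat, eval] using sat_rca (.not_lt_zero (.var .nat 0)) (M.env₀.push x)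

theorem lt_succ (x y : M.N) : M.lt x (M.succ ⬩ y) ↔ M.lt x y ∨ x = y := by
  have := sat_rca (.lt_succ (.var .nat 1) (.var .nat 0)) ((M.env₀.push x).push y)
  simpa [sat_iff, sat_or, Sat, eval, Env.push] using this

theorem app_combK {ρ τ : Ty} (x : M.Obj ρ) (y : M.Obj τ) : M.combK ρ τ ⬩ x ⬩ y = x := by
  -- If the two types coincide, the second push moves `x` to index `1`.
  have := sat_rca (.combK (.var ρ (if ρ = τ then 1 else 0)) (.var τ 0))
    ((M.env₀.push x).push y)
  rw [sat_eqAt IsModel.ext'] at this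
  by_cases h : ρ = τ
  · subst h; simpa [eval, Env.push] using this
  · simpa [eval, Env.push, h] using this

theorem app_combS {δ ρ τ : Ty} (x : M.Obj (δ ⇾ ρ ⇾ τ)) (y : M.Obj (δ ⇾ ρ)) (z : M.Obj δ) :
    M.combS δ ρ τ ⬩ x ⬩ y ⬩ z = x ⬩ z ⬩ (y ⬩ z) := by
  classical
  -- The indices `0`, `1`, `2` keep the three variables apart even if some of their types coincide.
  let e : M.Env := fun σ i =>
    if h : i = 0 ∧ σ = (δ ⇾ ρ ⇾ τ) then h.2 ▸ x
    else if h : i = 1 ∧ σ = (δ ⇾ ρ) then h.2 ▸ y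
    else if h : i = 2 ∧ σ = δ then h.2 ▸ z
    else M.default σ
  have := sat_rca (.combS (.var (δ ⇾ ρ ⇾ τ) 0) (.var (δ ⇾ ρ) 1) (.var δ 2)) e
  rw [sat_eqAt IsModel.ext'] at this
  simpa [eval, e] using this

theorem recursor_zero (m : M.N) (f : M.Obj (.nat ⇾ .nat ⇾ .nat)) :
    M.recursor ⬩ m ⬩ f ⬩ M.zero = m := by
  have := sat_rca (.rec_zero (.var .nat 0) (.var _ 0)) ((M.env₀.push m).push f)
  simpa [Sat, eval, Env.push] using this

theorem recursor_succ (m : M.N) (f : M.Obj (.nat ⇾ .nat ⇾ .nat)) (n : M.N) :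
    M.recursor ⬩ m ⬩ f ⬩ (M.succ ⬩ n) = f ⬩ n ⬩ (M.recursor ⬩ m ⬩ f ⬩ n) := by
  have := sat_rca (.rec_succ (.var .nat 1) (.var _ 0) (.var .nat 0))
    (((M.env₀.push m).push n).push f)
  simpa [Sat, eval, Env.push] using this

/-- The only instance of the induction scheme that is used: every later induction is on the
characteristic function of a representable predicate. -/
theorem induction_zeros (f : M.Obj .one) (h₀ : f ⬩ M.zero = M.zero)
    (h₁ : ∀ n, f ⬩ n = M.zero → f ⬩ (M.succ ⬩ n) = M.zero) (n : M.N) : f ⬩ n = M.zero := by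
  have := sat_rca (.induction (.var .one 0 ⬝ .var .nat 0 ≐ .zero) trivial) (M.env₀.push f)
  simp only [Sat, sat_inst, sat_subst] at this
  simp [eval, Env.push, Subst.succZero] at this
  exact this h₀ h₁ n

theorem qf_choice {A : Formula} (hA : A.QF) (e : M.Env)
    (h : ∀ x : M.Obj .one, ∃ y : M.N, M.Sat A ((e.push x).push y)) :
    ∃ Y : M.Obj .two, ∀ x : M.Obj .one, M.Sat A ((e.push x).push (Y ⬩ x)) := by
  have := sat_rca (.choice A hA) e
  simp only [Sat, sat_ex, sat_inst] at this
  obtain ⟨Y, hY⟩ := this h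
  refine ⟨Y, fun x => ?_⟩
  have h' := hY x
  rw [push_comm (by decide) e Y x, push_comm (by decide) _ Y, sat_lift] at h'
  simpa [eval, Env.push] using h'

/-- The two values `x 0`, `x 1` of `x` decide `x 0 < x 1`. -/
theorem exists_ltTest : ∃ Y : M.Obj .two, ∀ x : M.Obj .one,
    Y ⬩ x = M.zero ↔ M.lt (x ⬩ M.zero) (x ⬩ (M.succ ⬩ M.zero)) := by
  let P : Formula := .var .one 0 ⬝ .zero ≺ .var .one 0 ⬝ (.succ ⬝ .zero)
  have hA : (Formula.and (P ⟹ .var .nat 0 ≐ .zero)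
    (P.neg ⟹ .var .nat 0 ≐ .succ ⬝ .zero)).QF := by simp [P, Formula.and, Formula.neg, Formula.QF]
  obtain ⟨Y, hY⟩ := qf_choice hA M.env₀ fun x => by
    by_cases h : M.lt (x ⬩ M.zero) (x ⬩ (M.succ ⬩ M.zero))
    · exact ⟨M.zero, by simp [P, sat_and, sat_neg, Sat, eval, Env.push, h]⟩
    · exact ⟨M.succ ⬩ M.zero, by simp [P, sat_and, sat_neg, Sat, eval, Env.push, h]⟩
  refine ⟨Y, fun x => ?_⟩
  have := hY x
  simp [P, sat_and, sat_neg, Sat, eval, Env.push] at this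
  refine ⟨fun h => ?_, this.1⟩
  by_contra hn
  exact succ_ne_zero _ ((this.2 hn).symm.trans h)

/-- The graph of a `0`/`1`-valued test is quantifier-free, so choice yields the test. Choice ranges
over type `1`, which is why the two numbers are packed into one sequence. -/
theorem exists_eqTest : ∃ Y : M.Obj .two, ∀ x : M.Obj .one,
    Y ⬩ x = M.zero ↔ x ⬩ M.zero = x ⬩ (M.succ ⬩ M.zero) := by
  let P : Formula := .var .one 0 ⬝ .zero ≐ .var .one 0 ⬝ (.succ ⬝ .zero)
  have hA : (Formula.and (P ⟹ .var .nat 0 ≐ .zero)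
    (P.neg ⟹ .var .nat 0 ≐ .succ ⬝ .zero)).QF := by simp [P, Formula.and, Formula.neg, Formula.QF]
  obtain ⟨Y, hY⟩ := qf_choice hA M.env₀ fun x => by
    by_cases h : x ⬩ M.zero = x ⬩ (M.succ ⬩ M.zero)
    · exact ⟨M.zero, by simp [P, sat_and, sat_neg, Sat, eval, Env.push, h]⟩
    · exact ⟨M.succ ⬩ M.zero, by simp [P, sat_and, sat_neg, Sat, eval, Env.push, h]⟩
  refine ⟨Y, fun x => ?_⟩
  have := hY x
  simp [P, sat_and, sat_neg, Sat, eval, Env.push] at this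
  refine ⟨fun h => ?_, this.1⟩
  by_contra hn
  exact succ_ne_zero _ ((this.2 hn).symm.trans h)

theorem exists_impTest : ∃ Y : M.Obj .two, ∀ x : M.Obj .one,
    Y ⬩ x = M.zero ↔ (x ⬩ M.zero = M.zero → x ⬩ (M.succ ⬩ M.zero) = M.zero) := by
  let P : Formula := .var .one 0 ⬝ .zero ≐ .zero ⟹ .var .one 0 ⬝ (.succ ⬝ .zero) ≐ .zero
  have hA : (Formula.and (P ⟹ .var .nat 0 ≐ .zero)
    (P.neg ⟹ .var .nat 0 ≐ .succ ⬝ .zero)).QF := by simp [P, Formula.and, Formula.neg, Formula.QF]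
  obtain ⟨Y, hY⟩ := qf_choice hA M.env₀ fun x => by
    by_cases h : x ⬩ M.zero = M.zero → x ⬩ (M.succ ⬩ M.zero) = M.zero
    · exact ⟨M.zero, by simp [P, sat_and, sat_neg, Sat, eval, Env.push]; tauto⟩
    · exact ⟨M.succ ⬩ M.zero, by simp [P, sat_and, sat_neg, Sat, eval, Env.push]; tauto⟩
  refine ⟨Y, fun x => ?_⟩
  have := hY x
  simp only [P, sat_and, sat_neg, Sat, eval] at this
  simp only [push_zero, push_of_ne _ _ _ (show Ty.one ≠ Ty.nat by decide)] at this
  refine ⟨fun h => ?_, this.1⟩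
  by_contra hn
  exact succ_ne_zero _ ((this.2 hn).symm.trans h)

/-- A zero of `f` is found by a functional, if there is one. -/
theorem exists_search : ∃ m : M.Obj .two, ∀ f : M.Obj .one,
    (∃ n, f ⬩ n = M.zero) → f ⬩ (m ⬩ f) = M.zero := by
  have h := IsModel.sat existsTwo (.inr rfl) M.env₀
  simp only [existsTwo, sat_ex, sat_and, sat_iff, Sat] at h
  obtain ⟨E, -, hE⟩ := h
  simp [eval, Env.push] at hE
  -- The equation `E x = 0` replaces the premise that a zero exists, and this makes the formula
  -- quantifier-free.
  obtain ⟨Y, hY⟩ := qf_choice (M := M)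
    (A := .var .two 0 ⬝ .var .one 0 ≐ .zero ⟹ .var .one 0 ⬝ .var .nat 0 ≐ .zero)
    ⟨trivial, trivial⟩ (M.env₀.push E) fun x => by
      by_cases h : E ⬩ x = M.zero
      · obtain ⟨n, hn⟩ := (hE x).2 h
        exact ⟨n, by simp [Sat, eval, Env.push, hn]⟩
      · exact ⟨M.zero, by simp [Sat, eval, Env.push, h]⟩
  refine ⟨Y, fun f hf => ?_⟩
  have := hY f
  simp [Sat, eval, Env.push] at this
  exact this ((hE f).1 hf)

end Str

end HigherOrderArith

namespace HigherOrderArith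
namespace Str

variable {M : Str}

/-! ### Representable functions -/

/-- Tuples of objects whose types are listed in `Γ`. -/
def Tuple (M : Str) : List Ty → Type
  | [] => Unit
  | σ :: Γ => M.Obj σ × M.Tuple Γ

/-- `p` is given by an object of the structure, by currying. -/
def Curried {τ : Ty} : (Γ : List Ty) → (M.Tuple Γ → M.Obj τ) → Prop
  | [], _ => True
  | σ :: Γ, p => ∃ F : M.Tuple Γ → M.Obj (σ ⇾ τ), Curried Γ F ∧ ∀ x c, p (x, c) = F c ⬩ x

/-- The next lemmas are bracket abstraction: `Π` absorbs an unused argument, `Σ` distributes an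
argument over an application, and `Σ Π Π` is the identity. -/
theorem Curried.const {τ : Ty} (Γ : List Ty) (x : M.Obj τ) [M.IsModel] :
    Curried Γ (fun _ => x) := by
  induction Γ generalizing τ with
  | nil => trivial
  | cons σ Γ ih => exact ⟨_, ih (M.combK _ _ ⬩ x), fun y c => (app_combK x y).symm⟩

theorem Curried.app {σ τ : Ty} {Γ : List Ty} {p : M.Tuple Γ → M.Obj (σ ⇾ τ)}
    {q : M.Tuple Γ → M.Obj σ} [M.IsModel] (hp : Curried Γ p) (hq : Curried Γ q) :
    Curried Γ (fun c => p c ⬩ q c) := by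
  induction Γ generalizing σ τ with
  | nil => trivial
  | cons ρ Γ ih =>
    obtain ⟨F, hF, hF'⟩ := hp
    obtain ⟨G, hG, hG'⟩ := hq
    refine ⟨_, ih (ih (Curried.const Γ (M.combS _ _ _)) hF) hG, fun x c => ?_⟩
    change p (x, c) ⬩ q (x, c) = _
    rw [app_combS, hF', hG']

theorem Curried.weaken {σ τ : Ty} {Γ : List Ty} {p : M.Tuple Γ → M.Obj τ} [M.IsModel]
    (hp : Curried Γ p) : Curried (σ :: Γ) (fun c => p c.2) :=
  ⟨_, (Curried.const Γ (M.combK _ _)).app hp, fun x c => (app_combK (p c) x).symm⟩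

theorem Curried.head {σ : Ty} {Γ : List Ty} [M.IsModel] :
    Curried (σ :: Γ) (fun c => c.1 : M.Tuple (σ :: Γ) → M.Obj σ) :=
  ⟨_, Curried.const Γ (M.combS σ (σ ⇾ σ) σ ⬩ M.combK _ _ ⬩ M.combK _ _), fun x c => by
    rw [app_combS, app_combK]⟩

/-- A type with a distinguished class of families indexed by tuples of objects. -/
class Space (M : Str) (A : Type) where
  plot : (Γ : List Ty) → (M.Tuple Γ → A) → Prop
  const : ∀ Γ a, plot Γ fun _ => a
  weaken : ∀ {Γ p} (σ : Ty), plot Γ p → plot (σ :: Γ) fun c => p c.2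

instance (σ : Ty) [M.IsModel] : Space M (M.Obj σ) where
  plot _ p := Curried _ p
  const Γ a := Curried.const Γ a
  weaken _ h := h.weaken

/-- Counting propositions as a space, with zero meaning truth, lets `fun_prop` treat terms,
relations and number quantifiers uniformly. -/
instance [M.IsModel] : Space M Prop where
  plot Γ P := ∃ χ : M.Tuple Γ → M.N, Curried Γ χ ∧ ∀ c, P c ↔ χ c = M.zero
  const Γ P := by
    by_cases h : P
    · exact ⟨_, Curried.const Γ M.zero, fun c => by simp [h]⟩
    · exact ⟨_, Curried.const Γ (M.succ ⬩ M.zero), fun c => by simp [h, succ_ne_zero]⟩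
  weaken _ := fun ⟨χ, h, h'⟩ => ⟨_, h.weaken, fun c => h' c.2⟩

instance {A B : Type} [Space M A] [Space M B] : Space M (A × B) where
  plot Γ p := Space.plot (M := M) Γ (fun c => (p c).1) ∧ Space.plot (M := M) Γ (fun c => (p c).2)
  const Γ a := ⟨Space.const Γ a.1, Space.const Γ a.2⟩
  weaken σ h := ⟨Space.weaken σ h.1, Space.weaken σ h.2⟩

/-- Representable functions: those that preserve the distinguished families. -/
@[fun_prop]
def Rep (M : Str) {A B : Type} [Space M A] [Space M B] (f : A → B) : Prop :=
  ∀ Γ (p : M.Tuple Γ → A), Space.plot (M := M) Γ p → Space.plot (M := M) Γ fun c => f (p c)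

namespace Rep

variable {A B C : Type} [Space M A] [Space M B] [Space M C]

@[fun_prop] theorem id : Rep M fun a : A => a := fun _ _ h => h

@[fun_prop] theorem const (b : B) : Rep M fun _ : A => b := fun Γ _ _ => Space.const Γ b

@[fun_prop] theorem comp {g : B → C} {f : A → B} (hg : Rep M g) (hf : Rep M f) :
    Rep M fun a => g (f a) := fun Γ _ h => hg Γ _ (hf Γ _ h)

@[fun_prop] theorem prodMk {f : A → B} {g : A → C} (hf : Rep M f) (hg : Rep M g) :
    Rep M fun a => (f a, g a) := fun Γ _ h => ⟨hf Γ _ h, hg Γ _ h⟩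

@[fun_prop] theorem fst {f : A → B × C} (hf : Rep M f) : Rep M fun a => (f a).1 :=
  fun Γ _ h => (hf Γ _ h).1

@[fun_prop] theorem snd {f : A → B × C} (hf : Rep M f) : Rep M fun a => (f a).2 :=
  fun Γ _ h => (hf Γ _ h).2

theorem curry_right {f : A → B → C}
    (hf : Rep M fun p : A × B => f p.1 p.2) (a : A) : Rep M (f a) := by
  have : Rep M fun b : B => (a, b) := by fun_prop
  exact comp (g := fun p : A × B => f p.1 p.2) hf this

end Rep

variable [M.IsModel] {A : Type} [Space M A]

@[fun_prop] theorem Rep.app {σ τ : Ty} {f : A → M.Obj (σ ⇾ τ)} {g : A → M.Obj σ}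
    (hf : Rep M f) (hg : Rep M g) : Rep M fun a => f a ⬩ g a :=
  fun Γ _ h => Curried.app (hf Γ _ h) (hg Γ _ h)

open Classical in
/-- The object representing `f`, if there is one. -/
noncomputable def lam {σ τ : Ty} (f : M.Obj σ → M.Obj τ) : M.Obj (σ ⇾ τ) :=
  Classical.epsilon fun F => ∀ x, F ⬩ x = f x

theorem lam_app {σ τ : Ty} {f : M.Obj σ → M.Obj τ} (hf : Rep M f) (x : M.Obj σ) :
    lam f ⬩ x = f x := by
  obtain ⟨F, -, hF⟩ := hf [σ] _ (Curried.head (Γ := []))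
  exact Classical.epsilon_spec (p := fun F => ∀ x, F ⬩ x = f x) ⟨F (), fun x => (hF x ()).symm⟩ x

@[fun_prop] theorem Rep.lam {σ τ : Ty} {f : A → M.Obj σ → M.Obj τ}
    (hf : Rep M fun p : A × M.Obj σ => f p.1 p.2) : Rep M fun a => lam (f a) := by
  intro Γ p hp
  obtain ⟨F, hF, hF'⟩ := hf (σ :: Γ) (fun c => (p c.2, c.1)) ⟨Space.weaken σ hp, Curried.head⟩
  -- `lam` chooses an object separately for each tuple, but extensionality leaves only one
  -- candidate, so the choices agree with the uniform `F`.
  suffices h : (fun c => Str.lam (f (p c))) = F by rw [h]; exact hF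
  funext c
  refine ext fun x => ?_
  rw [lam_app (hf.curry_right _), ← hF']

/-- The function with values `a` at `0` and `b` elsewhere. -/
def pairFun (a b : M.N) : M.Obj .one := M.recursor ⬩ a ⬩ (M.combK _ _ ⬩ (M.combK _ _ ⬩ b))

@[fun_prop] theorem Rep.pairFun {f g : A → M.N} (hf : Rep M f) (hg : Rep M g) :
    Rep M fun a => Str.pairFun (f a) (g a) := by
  unfold Str.pairFun; fun_prop

theorem pairFun_zero (a b : M.N) : pairFun a b ⬩ M.zero = a := recursor_zero _ _

theorem pairFun_one (a b : M.N) : pairFun a b ⬩ (M.succ ⬩ M.zero) = b := by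
  rw [pairFun, recursor_succ, app_combK, app_combK]

theorem rep_of_zero {P : A → Prop} {χ : A → M.N} (h : Rep M χ)
    (hP : ∀ a, P a ↔ χ a = M.zero) : Rep M P :=
  fun Γ p hp => ⟨_, h Γ p hp, fun _ => hP _⟩

theorem Rep.congr {P Q : A → Prop} (hP : Rep M P) (h : ∀ a, P a ↔ Q a) : Rep M Q := by
  rwa [show Q = P from funext fun a => propext (h a).symm]

theorem rep_eq : Rep M fun p : M.N × M.N => p.1 = p.2 := by
  obtain ⟨Y, hY⟩ := exists_eqTest (M := M)
  refine rep_of_zero (χ := fun p : M.N × M.N => Y ⬩ pairFun p.1 p.2) (by fun_prop) fun p => ?_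
  rw [hY, pairFun_zero, pairFun_one]

theorem rep_lt : Rep M fun p : M.N × M.N => M.lt p.1 p.2 := by
  obtain ⟨Y, hY⟩ := exists_ltTest (M := M)
  refine rep_of_zero (χ := fun p : M.N × M.N => Y ⬩ pairFun p.1 p.2) (by fun_prop) fun p => ?_
  rw [hY, pairFun_zero, pairFun_one]

@[fun_prop] theorem Rep.eq {f g : A → M.N} (hf : Rep M f) (hg : Rep M g) :
    Rep M fun a => f a = g a := rep_eq.comp (hf.prodMk hg)

@[fun_prop] theorem Rep.imp {P Q : A → Prop} (hP : Rep M P) (hQ : Rep M Q) : Rep M fun a => P a → Q a := by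
  obtain ⟨Y, hY⟩ := exists_impTest (M := M)
  intro Γ p hp
  obtain ⟨χ, h, h'⟩ := hP Γ p hp
  obtain ⟨ξ, k, k'⟩ := hQ Γ p hp
  have key : Rep M fun q : M.N × M.N => Y ⬩ Str.pairFun q.1 q.2 := by fun_prop
  refine ⟨_, key Γ (fun c => (χ c, ξ c)) ⟨h, k⟩, fun c => ?_⟩
  rw [hY, pairFun_zero, pairFun_one]
  exact imp_congr (h' c) (k' c)

@[fun_prop] theorem Rep.not {P : A → Prop} (hP : Rep M P) : Rep M fun a => ¬ P a :=
  hP.imp (Rep.const False)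

@[fun_prop] theorem Rep.or {P Q : A → Prop} (hP : Rep M P) (hQ : Rep M Q) :
    Rep M fun a => P a ∨ Q a := (hP.not.imp hQ).congr fun a => by tauto

@[fun_prop] theorem Rep.and {P Q : A → Prop} (hP : Rep M P) (hQ : Rep M Q) :
    Rep M fun a => P a ∧ Q a := (hP.imp hQ.not).not.congr fun a => by tauto

/-- A representable relation is given by a representable function into numbers. -/
theorem Rep.exists_search {P : A → M.N → Prop} (hP : Rep M fun p : A × M.N => P p.1 p.2)
    (Γ : List Ty) (p : M.Tuple Γ → A) (hp : Space.plot (M := M) Γ p) :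
    ∃ s : M.Tuple Γ → M.N, Curried Γ s ∧ ∀ c, (∃ n, P (p c) n) → P (p c) (s c) := by
  obtain ⟨m, hm⟩ := Str.exists_search (M := M)
  obtain ⟨χ, h, h'⟩ := hP (.nat :: Γ) (fun c => (p c.2, c.1)) ⟨Space.weaken _ hp, Curried.head⟩
  obtain ⟨F, hF, hF'⟩ := h
  refine ⟨_, (Curried.const Γ m).app hF, fun c ⟨n, hn⟩ => ?_⟩
  have := h' (m ⬩ F c, c)
  refine this.2 ?_
  rw [hF']
  refine hm _ ⟨n, ?_⟩
  rw [← hF']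
  exact (h' (n, c)).1 hn

-- An existential statement is equivalent to its matrix at the number found by the search
-- functional. Through this lemma `(∃²)` makes all arithmetical predicates available.
@[fun_prop] theorem Rep.exists {P : A → M.N → Prop} (hP : Rep M fun p : A × M.N => P p.1 p.2) :
    Rep M fun a => ∃ n, P a n := by
  intro Γ p hp
  obtain ⟨s, hs, h⟩ := hP.exists_search Γ p hp
  obtain ⟨χ, k, k'⟩ := hP Γ (fun c => (p c, s c)) ⟨hp, hs⟩
  exact ⟨χ, k, fun c => ⟨fun h' => (k' c).1 (h c h'), fun h' => ⟨_, (k' c).2 h'⟩⟩⟩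

@[fun_prop] theorem Rep.forall {P : A → M.N → Prop} (hP : Rep M fun p : A × M.N => P p.1 p.2) :
    Rep M fun a => ∀ n, P a n :=
  (hP.not.exists (P := fun a n => ¬ P a n)).not.congr fun a => by push Not; rfl

/-- A number-valued function with a representable graph is representable. -/
theorem Rep.of_graph {f : A → M.N} (h : Rep M fun p : A × M.N => f p.1 = p.2) : Rep M f := by
  intro Γ p hp
  obtain ⟨s, hs, h⟩ := h.exists_search (P := fun a n => f a = n) Γ p hp
  suffices e : (fun c => f (p c)) = s by rw [e]; exact hs
  exact funext fun c => h c ⟨_, rfl⟩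

@[fun_prop] theorem Rep.ite {P : A → Prop} [∀ a, Decidable (P a)] {f g : A → M.N} (hP : Rep M P) (hf : Rep M f)
    (hg : Rep M g) : Rep M fun a => if P a then f a else g a := by
  refine Rep.of_graph (Rep.congr (P := fun p : A × M.N =>
    (P p.1 ∧ f p.1 = p.2) ∨ (¬ P p.1 ∧ g p.1 = p.2)) (by fun_prop) fun p => ?_)
  by_cases h : P p.1 <;> simp [h]

/-- Induction for representable predicates. -/
theorem induction {P : M.N → Prop} (hP : Rep M P) (h₀ : P M.zero)
    (h₁ : ∀ n, P n → P (M.succ ⬩ n)) (n : M.N) : P n := by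
  obtain ⟨χ, ⟨F, -, hF⟩, h⟩ := hP [.nat] _ (Curried.head (Γ := []))
  have key : ∀ n, P n ↔ F () ⬩ n = M.zero := fun n => by
    rw [← hF n ()]; exact h (n, ())
  simp only [key] at h₀ h₁ ⊢
  exact induction_zeros _ h₀ h₁ n

/-- Primitive recursion. -/
noncomputable def natRec (a : M.N) (f : M.N → M.N → M.N) (n : M.N) : M.N :=
  M.recursor ⬩ a ⬩ lam (fun k => lam (f k)) ⬩ n

theorem natRec_zero (a : M.N) (f : M.N → M.N → M.N) : natRec a f M.zero = a := recursor_zero _ _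

theorem natRec_succ (a : M.N) {f : M.N → M.N → M.N} (hf : Rep M fun p : M.N × M.N => f p.1 p.2)
    (n : M.N) : natRec a f (M.succ ⬩ n) = f n (natRec a f n) := by
  rw [natRec, recursor_succ, lam_app (by fun_prop), lam_app (hf.curry_right _)]
  rfl

@[fun_prop] theorem Rep.natRec {a : A → M.N} {f : A → M.N → M.N → M.N} {n : A → M.N}
    (ha : Rep M a) (hf : Rep M fun p : (A × M.N) × M.N => f p.1.1 p.1.2 p.2) (hn : Rep M n) :
    Rep M fun x => Str.natRec (a x) (f x) (n x) := by
  unfold Str.natRec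
  have h : Rep M fun x => Str.lam fun k => Str.lam (f x k) :=
    Rep.lam (f := fun x k => Str.lam (f x k)) (Rep.lam (f := fun p : A × M.N => f p.1 p.2) hf)
  fun_prop

end Str

end HigherOrderArith

namespace HigherOrderArith
namespace Str

/-! ### Arithmetic of the numbers of a structure -/

variable {M : Str}

instance : Zero M.N := ⟨M.zero⟩
instance : One M.N := ⟨M.succ ⬩ M.zero⟩
instance : Add M.N := ⟨fun x y => M.add ⬩ x ⬩ y⟩
instance : Mul M.N := ⟨fun x y => M.mul ⬩ x ⬩ y⟩
instance : LT M.N := ⟨M.lt⟩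
instance : LE M.N := ⟨fun x y => x < y ∨ x = y⟩

theorem zero_def : M.zero = 0 := rfl
theorem add_def (x y : M.N) : M.add ⬩ x ⬩ y = x + y := rfl
theorem mul_def (x y : M.N) : M.mul ⬩ x ⬩ y = x * y := rfl
variable [M.IsModel] {A : Type} [Space M A]

theorem succ_def (x : M.N) : M.succ ⬩ x = x + 1 := by
  change _ = M.add ⬩ x ⬩ (M.succ ⬩ M.zero)
  rw [app_add_succ, app_add_zero]

@[fun_prop] theorem Rep.add {f g : A → M.N} (hf : Rep M f) (hg : Rep M g) :
    Rep M fun a => f a + g a := by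
  simp only [← add_def]; fun_prop

@[fun_prop] theorem Rep.mul {f g : A → M.N} (hf : Rep M f) (hg : Rep M g) :
    Rep M fun a => f a * g a := by
  simp only [← mul_def]; fun_prop

@[fun_prop] theorem Rep.lt {f g : A → M.N} (hf : Rep M f) (hg : Rep M g) :
    Rep M fun a => f a < g a := rep_lt.comp (hf.prodMk hg)

@[fun_prop] theorem Rep.le {f g : A → M.N} (hf : Rep M f) (hg : Rep M g) :
    Rep M fun a => f a ≤ g a := (hf.lt hg).or (hf.eq hg)

/-- Induction for representable predicates. -/
theorem rep_induction {P : M.N → Prop} (hP : Rep M P) (h₀ : P 0) (h₁ : ∀ n, P n → P (n + 1))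
    (n : M.N) : P n :=
  induction hP h₀ (fun n h => by rw [succ_def]; exact h₁ n h) n

namespace N

theorem add_one_ne_zero (x : M.N) : x + 1 ≠ 0 := by
  rw [← succ_def]; exact succ_ne_zero x

theorem add_one_inj {x y : M.N} (h : x + 1 = y + 1) : x = y := by
  rw [← succ_def, ← succ_def] at h; exact succ_inj h

protected theorem add_zero (x : M.N) : x + 0 = x := app_add_zero x

theorem add_add_one (x y : M.N) : x + (y + 1) = x + y + 1 := by
  rw [← succ_def y, ← succ_def (x + y)]; exact app_add_succ x y

protected theorem mul_zero (x : M.N) : x * 0 = 0 := app_mul_zero x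

theorem mul_add_one (x y : M.N) : x * (y + 1) = x * y + x := by
  rw [← succ_def]; exact app_mul_succ x y

protected theorem add_assoc (x y z : M.N) : x + y + z = x + (y + z) := by
  induction z using rep_induction with
  | hP => fun_prop
  | h₀ => rw [N.add_zero, N.add_zero]
  | h₁ z ih => rw [add_add_one, add_add_one, add_add_one, ih]

protected theorem zero_add (x : M.N) : 0 + x = x := by
  induction x using rep_induction with
  | hP => fun_prop
  | h₀ => rw [N.add_zero]
  | h₁ x ih => rw [add_add_one, ih]

theorem add_one_add (x y : M.N) : x + 1 + y = x + y + 1 := by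
  induction y using rep_induction with
  | hP => fun_prop
  | h₀ => rw [N.add_zero, N.add_zero]
  | h₁ y ih => rw [add_add_one, add_add_one, ih]

protected theorem add_comm (x y : M.N) : x + y = y + x := by
  induction y using rep_induction with
  | hP => fun_prop
  | h₀ => rw [N.add_zero, N.zero_add]
  | h₁ y ih => rw [add_add_one, add_one_add, ih]

protected theorem zero_mul (x : M.N) : 0 * x = 0 := by
  induction x using rep_induction with
  | hP => fun_prop
  | h₀ => rw [N.mul_zero]
  | h₁ x ih => rw [mul_add_one, ih, N.add_zero]

theorem add_one_mul (x y : M.N) : (x + 1) * y = x * y + y := by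
  induction y using rep_induction with
  | hP => fun_prop
  | h₀ => rw [N.mul_zero, N.mul_zero, N.add_zero]
  | h₁ y ih =>
    rw [mul_add_one, mul_add_one, ih, add_add_one, add_add_one, N.add_assoc (x * y),
      N.add_assoc (x * y), N.add_comm y x, add_add_one, ← N.add_assoc (x * y)]

protected theorem mul_comm (x y : M.N) : x * y = y * x := by
  induction y using rep_induction with
  | hP => fun_prop
  | h₀ => rw [N.mul_zero, N.zero_mul]
  | h₁ y ih => rw [mul_add_one, add_one_mul, ih]

protected theorem mul_add (x y z : M.N) : x * (y + z) = x * y + x * z := by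
  induction z using rep_induction with
  | hP => fun_prop
  | h₀ => rw [N.add_zero, N.mul_zero, N.add_zero]
  | h₁ z ih => rw [add_add_one, mul_add_one, mul_add_one, ih, N.add_assoc]

protected theorem mul_assoc (x y z : M.N) : x * y * z = x * (y * z) := by
  induction z using rep_induction with
  | hP => fun_prop
  | h₀ => rw [N.mul_zero, N.mul_zero, N.mul_zero]
  | h₁ z ih => rw [mul_add_one, mul_add_one, N.mul_add, ih]

protected theorem mul_one (x : M.N) : x * 1 = x := by
  rw [← N.zero_add 1, mul_add_one, N.mul_zero, N.zero_add]

end N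

instance : CommSemiring M.N where
  add_assoc := N.add_assoc
  zero_add := N.zero_add
  add_zero := N.add_zero
  add_comm := N.add_comm
  left_distrib := N.mul_add
  right_distrib x y z := by rw [N.mul_comm, N.mul_add, N.mul_comm z, N.mul_comm z]
  zero_mul := N.zero_mul
  mul_zero := N.mul_zero
  mul_assoc := N.mul_assoc
  one_mul x := by rw [N.mul_comm, N.mul_one]
  mul_one := N.mul_one
  mul_comm := N.mul_comm
  nsmul := nsmulRec

namespace N

theorem lt_add_one_iff' {x y : M.N} : x < y + 1 ↔ x < y ∨ x = y := by
  rw [← succ_def]; exact lt_succ x y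

protected theorem not_lt_zero (x : M.N) : ¬ x < 0 := Str.not_lt_zero x

protected theorem lt_trans {x y z : M.N} (h₁ : x < y) (h₂ : y < z) : x < z := by
  induction z using rep_induction with
  | hP => fun_prop
  | h₀ => exact (N.not_lt_zero _ h₂).elim
  | h₁ z ih =>
    rw [lt_add_one_iff'] at h₂ ⊢
    rcases h₂ with h₂ | rfl
    · exact .inl (ih h₂)
    · exact .inl h₁

theorem add_one_lt {x y : M.N} (h : x < y) : x + 1 < y + 1 := by
  induction y using rep_induction with
  | hP => fun_prop
  | h₀ => exact (N.not_lt_zero _ h).elim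
  | h₁ y ih =>
    rw [lt_add_one_iff']
    rcases lt_add_one_iff'.1 h with h | rfl
    · exact .inl (ih h)
    · exact .inr rfl

protected theorem lt_irrefl (x : M.N) : ¬ x < x := by
  induction x using rep_induction with
  | hP => fun_prop
  | h₀ => exact N.not_lt_zero _
  | h₁ x ih =>
    intro h
    have hx : x < x + 1 := lt_add_one_iff'.2 (.inr rfl)
    rcases lt_add_one_iff'.1 h with h | h
    · exact ih (N.lt_trans hx h)
    · rw [h] at hx; exact ih hx

protected theorem zero_lt_add_one (x : M.N) : 0 < x + 1 := by
  induction x using rep_induction with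
  | hP => fun_prop
  | h₀ => exact lt_add_one_iff'.2 (.inr rfl)
  | h₁ x ih => exact lt_add_one_iff'.2 (.inl ih)

protected theorem lt_trichotomy (x y : M.N) : x < y ∨ x = y ∨ y < x := by
  induction x using rep_induction with
  | hP => fun_prop
  | h₀ =>
    induction y using rep_induction with
    | hP => fun_prop
    | h₀ => exact .inr (.inl rfl)
    | h₁ y ih => exact .inl (N.zero_lt_add_one y)
  | h₁ x ih =>
    rcases ih with h | rfl | h
    · exact (lt_add_one_iff'.1 (add_one_lt h)).imp_right .inl
    · exact .inr (.inr (lt_add_one_iff'.2 (.inr rfl)))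
    · exact .inr (.inr (lt_add_one_iff'.2 (.inl h)))

end N

noncomputable instance : LinearOrder M.N where
  le_refl x := .inr rfl
  le_trans x y z h₁ h₂ := by
    rcases h₁ with h₁ | rfl
    · rcases h₂ with h₂ | rfl
      · exact .inl (N.lt_trans h₁ h₂)
      · exact .inl h₁
    · exact h₂
  lt_iff_le_not_ge x y := by
    constructor
    · refine fun h => ⟨.inl h, ?_⟩
      rintro (h' | rfl)
      · exact N.lt_irrefl _ (N.lt_trans h h')
      · exact N.lt_irrefl _ h
    · rintro ⟨h | rfl, h'⟩
      · exact h
      · exact (h' (.inr rfl)).elim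
  le_antisymm x y h₁ h₂ := by
    rcases h₁ with h₁ | h₁
    · rcases h₂ with h₂ | h₂
      · exact (N.lt_irrefl _ (N.lt_trans h₁ h₂)).elim
      · exact h₂.symm
    · exact h₁
  le_total x y := by
    rcases N.lt_trichotomy x y with h | h | h
    · exact .inl (.inl h)
    · exact .inl (.inr h)
    · exact .inr (.inl h)
  toDecidableLE := Classical.decRel _

namespace N

theorem lt_add_one_iff {x y : M.N} : x < y + 1 ↔ x ≤ y := by
  rw [lt_add_one_iff', le_iff_lt_or_eq]

protected theorem zero_le (x : M.N) : 0 ≤ x := lt_add_one_iff.1 (N.zero_lt_add_one x)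

theorem le_iff_exists_add {x y : M.N} : x ≤ y ↔ ∃ z, y = x + z := by
  constructor
  · intro h
    induction y using rep_induction with
    | hP => fun_prop
    | h₀ => exact ⟨0, by rw [add_zero]; exact le_antisymm (N.zero_le _) h⟩
    | h₁ y ih =>
      rcases h.lt_or_eq with h | rfl
      · obtain ⟨z, rfl⟩ := ih (lt_add_one_iff.1 h)
        exact ⟨z + 1, add_assoc _ _ _⟩
      · exact ⟨0, (add_zero _).symm⟩
  · rintro ⟨z, rfl⟩
    induction z using rep_induction with
    | hP => fun_prop
    | h₀ => rw [add_zero]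
    | h₁ z ih => rw [← add_assoc]; exact (lt_add_one_iff.2 ih).le

protected theorem add_left_lt {x y : M.N} (h : x < y) (z : M.N) : z + x < z + y := by
  rw [add_comm z, add_comm z]
  induction z using rep_induction with
  | hP => fun_prop
  | h₀ => rwa [add_zero, add_zero]
  | h₁ z ih => rw [← add_assoc, ← add_assoc]; exact add_one_lt ih

end N

instance : IsOrderedCancelAddMonoid M.N where
  add_le_add_left x y h z := by
    rcases h.lt_or_eq with h | rfl
    · rw [add_comm x, add_comm y]; exact (N.add_left_lt h z).le
    · exact le_rfl
  le_of_add_le_add_left x y z h := by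
    by_contra hn
    exact (N.add_left_lt (not_le.1 hn) x).not_ge h

instance : Nontrivial M.N := ⟨1, 0, succ_ne_zero _⟩

instance : CanonicallyOrderedAdd M.N where
  exists_add_of_le h := N.le_iff_exists_add.1 h
  le_add_self x y := by rw [add_comm]; exact N.le_iff_exists_add.2 ⟨y, rfl⟩
  le_self_add x y := N.le_iff_exists_add.2 ⟨y, rfl⟩

theorem N.mul_left_lt {x y z : M.N} (hz : 0 < z) (h : x < y) : z * x < z * y := by
  obtain ⟨d, rfl⟩ := N.le_iff_exists_add.1 h.le
  rw [mul_add]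
  refine lt_add_of_pos_right _ ?_
  have hd : d ≠ 0 := by rintro rfl; simp at h
  obtain ⟨e, rfl⟩ : ∃ e, d = e + 1 := by
    obtain ⟨e, he⟩ := N.le_iff_exists_add.1 (N.add_one_lt (pos_iff_ne_zero.2 hd) |> N.lt_add_one_iff.1)
    exact ⟨e, by rw [he, zero_add, add_comm]⟩
  rw [mul_add, mul_one]
  exact hz.trans_le le_add_self

instance : IsStrictOrderedRing M.N where
  zero_le_one := N.zero_le _
  mul_lt_mul_of_pos_left _ hz _ _ h := N.mul_left_lt hz h
  mul_lt_mul_of_pos_right z hz x y h := by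
    rw [mul_comm x, mul_comm y]; exact N.mul_left_lt hz h

theorem N.add_one_le_iff {x y : M.N} : x + 1 ≤ y ↔ x < y := by
  rw [← N.lt_add_one_iff]; exact ⟨fun h => lt_of_add_lt_add_right h, N.add_one_lt⟩

theorem N.one_le_iff_pos {x : M.N} : 1 ≤ x ↔ 0 < x := by
  rw [← N.add_one_le_iff, zero_add]

theorem N.exists_add_one {x : M.N} (h : x ≠ 0) : ∃ y, x = y + 1 := by
  obtain ⟨y, hy⟩ := N.le_iff_exists_add.1 (N.add_one_le_iff.2 (pos_iff_ne_zero.2 h))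
  exact ⟨y, by rw [hy, zero_add, add_comm]⟩

/-! ### Least numbers and the minimum operator. -/

/-- The least number principle. -/
theorem exists_least {P : M.N → Prop} (hP : Rep M P) (h : ∃ n, P n) :
    ∃ n, P n ∧ ∀ m < n, ¬ P m := by
  by_contra! hn
  obtain ⟨n, hn'⟩ := h
  -- Course-of-values form; the bounded quantifier keeps the induction predicate representable.
  have key : ∀ n, ∀ m, m < n → ¬ P m := fun n => by
    have hP' : Rep M fun p : M.N × M.N => P p.2 := hP.comp (by fun_prop)
    induction n using rep_induction with
    | hP => fun_prop
    | h₀ => exact fun m hm => (N.not_lt_zero _ hm).elim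
    | h₁ n ih =>
      intro m hm hPm
      obtain ⟨k, hk, hPk⟩ := hn m hPm
      exact ih k (hk.trans_le (N.lt_add_one_iff.1 hm)) hPk
  exact key (n + 1) n (N.lt_add_one_iff.2 le_rfl) hn'

open Classical in
/-- The least number with property `P`, or `0` if there is none. -/
noncomputable def mu (P : M.N → Prop) : M.N :=
  if h : ∃ n, P n ∧ ∀ m < n, ¬ P m then h.choose else 0

/-- `mu` is defined by external choice, but its graph is arithmetical in `P`; this makes it
representable by `Rep.of_graph`. -/
theorem mu_eq_iff {P : M.N → Prop} {n : M.N} : mu P = n ↔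
    (P n ∧ ∀ m, m < n → ¬ P m) ∨ (n = 0 ∧ ¬ ∃ k, P k ∧ ∀ m, m < k → ¬ P m) := by
  unfold mu
  by_cases h : ∃ n, P n ∧ ∀ m < n, ¬ P m
  · rw [dif_pos h]
    constructor
    · rintro rfl; exact .inl h.choose_spec
    · rintro (⟨h₁, h₂⟩ | ⟨-, h'⟩)
      · rcases lt_trichotomy h.choose n with h' | h' | h'
        · exact (h₂ _ h' h.choose_spec.1).elim
        · exact h'
        · exact (h.choose_spec.2 _ h' h₁).elim
      · exact (h' h).elim
  · rw [dif_neg h]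
    constructor
    · rintro rfl; exact .inr ⟨rfl, h⟩
    · rintro (h' | ⟨rfl, -⟩)
      · exact (h ⟨n, h'⟩).elim
      · rfl

theorem mu_spec {P : M.N → Prop} (hP : Rep M P) (h : ∃ n, P n) : P (mu P) := by
  rcases (mu_eq_iff (P := P)).1 rfl with h' | h'
  · exact h'.1
  · exact (h'.2 (exists_least hP h)).elim

theorem not_of_lt_mu {P : M.N → Prop} {n : M.N} (h : n < mu P) : ¬ P n := by
  rcases (mu_eq_iff (P := P)).1 rfl with h' | h'
  · exact h'.2 n h
  · rw [h'.1] at h; exact (N.not_lt_zero _ h).elim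

theorem mu_eq {P : M.N → Prop} {n : M.N} (h : P n) (h' : ∀ m < n, ¬ P m) : mu P = n :=
  mu_eq_iff.2 (.inl ⟨h, h'⟩)

@[fun_prop] theorem Rep.mu {P : A → M.N → Prop} (hP : Rep M fun p : A × M.N => P p.1 p.2) :
    Rep M fun a => Str.mu (P a) := by
  refine Rep.of_graph (Rep.congr ?_ fun p => mu_eq_iff.symm)
  -- The graph of `mu` mentions `P` under up to two nested number quantifiers; the three versions
  -- supply `P` at each depth.
  have h₁ : Rep M fun p : A × M.N => P p.1 p.2 := hP
  have h₂ : Rep M fun p : (A × M.N) × M.N => P p.1.1 p.2 :=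
    hP.comp (f := fun p : (A × M.N) × M.N => (p.1.1, p.2)) (by fun_prop)
  have h₃ : Rep M fun p : ((A × M.N) × M.N) × M.N => P p.1.1.1 p.2 :=
    hP.comp (f := fun p : ((A × M.N) × M.N) × M.N => (p.1.1.1, p.2)) (by fun_prop)
  fun_prop

theorem natRec_zero' (a : M.N) (f : M.N → M.N → M.N) : natRec a f 0 = a := natRec_zero a f

theorem natRec_add_one (a : M.N) {f : M.N → M.N → M.N}
    (hf : Rep M fun p : M.N × M.N => f p.1 p.2) (n : M.N) :
    natRec a f (n + 1) = f n (natRec a f n) := by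
  rw [← succ_def, natRec_succ a hf]

end Str
end HigherOrderArith
namespace HigherOrderArith

/-! ### The ordered field of fractions of an ordered semiring -/

section OrderedFractions

variable (R : Type) [CommSemiring R] [LinearOrder R] [IsStrictOrderedRing R]

/-- Formal differences of elements of `R`. -/
def diffSetoid : Setoid (R × R) where
  r p q := p.1 + q.2 = q.1 + p.2
  iseqv :=
    ⟨fun _ => rfl, fun h => h.symm, fun {p q r} h₁ h₂ => by
      refine add_right_cancel (b := q.2) ?_
      calc p.1 + r.2 + q.2 = (p.1 + q.2) + r.2 := by ring
        _ = (q.1 + r.2) + p.2 := by rw [h₁]; ring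
        _ = r.1 + p.2 + q.2 := by rw [h₂]; ring⟩

/-- The ring of differences of elements of `R`. -/
def DiffRing : Type := Quotient (diffSetoid R)

namespace DiffRing

variable {R}

def mk (p : R × R) : DiffRing R := Quotient.mk (diffSetoid R) p

theorem mk_eq_mk {p q : R × R} : mk p = mk q ↔ p.1 + q.2 = q.1 + p.2 :=
  Quotient.eq (r := diffSetoid R)

instance : Zero (DiffRing R) := ⟨mk (0, 0)⟩
instance : One (DiffRing R) := ⟨mk (1, 0)⟩
instance : Add (DiffRing R) := ⟨Quotient.map₂ (fun p q => (p.1 + q.1, p.2 + q.2))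
  fun p p' (h : _ = _) q q' (h' : _ = _) => by
    change p.1 + q.1 + (p'.2 + q'.2) = p'.1 + q'.1 + (p.2 + q.2)
    calc _ = (p.1 + p'.2) + (q.1 + q'.2) := by ring
      _ = _ := by rw [h, h']; ring⟩
instance : Neg (DiffRing R) := ⟨Quotient.map (fun p => (p.2, p.1))
  fun p p' (h : _ = _) => by
    change p.2 + p'.1 = p'.2 + p.1
    rw [add_comm p.2, ← h, add_comm]⟩
instance : Mul (DiffRing R) := ⟨Quotient.map₂
  (fun p q => (p.1 * q.1 + p.2 * q.2, p.1 * q.2 + p.2 * q.1))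
  fun p p' (h : _ = _) q q' (h' : _ = _) => by
    have h₁ : mk (p.1 * q.1 + p.2 * q.2, p.1 * q.2 + p.2 * q.1) =
        mk (p'.1 * q.1 + p'.2 * q.2, p'.1 * q.2 + p'.2 * q.1) := by
      rw [mk_eq_mk]
      calc _ = (p.1 + p'.2) * q.1 + (p'.1 + p.2) * q.2 := by ring
        _ = (p'.1 + p.2) * q.1 + (p.1 + p'.2) * q.2 := by rw [h]
        _ = _ := by ring
    have h₂ : mk (p'.1 * q.1 + p'.2 * q.2, p'.1 * q.2 + p'.2 * q.1) =
        mk (p'.1 * q'.1 + p'.2 * q'.2, p'.1 * q'.2 + p'.2 * q'.1) := by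
      rw [mk_eq_mk]
      calc _ = p'.1 * (q.1 + q'.2) + p'.2 * (q'.1 + q.2) := by ring
        _ = p'.1 * (q'.1 + q.2) + p'.2 * (q.1 + q'.2) := by rw [h']
        _ = _ := by ring
    exact mk_eq_mk.1 (h₁.trans h₂)⟩

theorem ind {P : DiffRing R → Prop} (h : ∀ p, P (mk p)) (x : DiffRing R) : P x :=
  Quotient.inductionOn x h

theorem mk_add (p q : R × R) : mk p + mk q = mk (p.1 + q.1, p.2 + q.2) := rfl
theorem mk_mul (p q : R × R) :
    mk p * mk q = mk (p.1 * q.1 + p.2 * q.2, p.1 * q.2 + p.2 * q.1) := rfl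
theorem mk_neg (p : R × R) : -mk p = mk (p.2, p.1) := rfl
theorem zero_def : (0 : DiffRing R) = mk (0, 0) := rfl
theorem one_def : (1 : DiffRing R) = mk (1, 0) := rfl

instance : CommRing (DiffRing R) where
  add_assoc x y z := by
    induction x using ind; induction y using ind; induction z using ind
    simp only [mk_add, mk_eq_mk]; ring
  zero_add x := by induction x using ind; simp only [zero_def, mk_add, mk_eq_mk]; ring
  add_zero x := by induction x using ind; simp only [zero_def, mk_add, mk_eq_mk]; ring
  add_comm x y := by
    induction x using ind; induction y using ind
    simp only [mk_add, mk_eq_mk]; ring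
  left_distrib x y z := by
    induction x using ind; induction y using ind; induction z using ind
    simp only [mk_add, mk_mul, mk_eq_mk]; ring
  right_distrib x y z := by
    induction x using ind; induction y using ind; induction z using ind
    simp only [mk_add, mk_mul, mk_eq_mk]; ring
  zero_mul x := by induction x using ind; simp only [zero_def, mk_mul, mk_eq_mk]; ring
  mul_zero x := by induction x using ind; simp only [zero_def, mk_mul, mk_eq_mk]; ring
  mul_assoc x y z := by
    induction x using ind; induction y using ind; induction z using ind
    simp only [mk_mul, mk_eq_mk]; ring
  one_mul x := by induction x using ind; simp only [one_def, mk_mul, mk_eq_mk]; ring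
  mul_one x := by induction x using ind; simp only [one_def, mk_mul, mk_eq_mk]; ring
  mul_comm x y := by
    induction x using ind; induction y using ind
    simp only [mk_mul, mk_eq_mk]; ring
  neg_add_cancel x := by
    induction x using ind; simp only [zero_def, mk_add, mk_neg, mk_eq_mk]; ring
  nsmul := nsmulRec
  zsmul := zsmulRec

/-- The embedding of `R` into its ring of differences. -/
def of : R →+* DiffRing R where
  toFun a := mk (a, 0)
  map_zero' := rfl
  map_one' := rfl
  map_add' x y := by simp only [mk_add, mk_eq_mk]; ring
  map_mul' x y := by simp only [mk_mul, mk_eq_mk]; ring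

theorem of_injective : Function.Injective (of (R := R)) := fun a b h => by
  simpa using mk_eq_mk.1 h

variable [CanonicallyOrderedAdd R]

/-- In a canonically ordered semiring the larger of two elements is the smaller plus a remainder.
Questions about differences thus reduce, up to sign, to `R`. -/
theorem eq_of_or_neg_of (x : DiffRing R) : (∃ a, x = of a) ∨ ∃ a, x = -of a := by
  induction x using ind with | h p =>
  rcases le_total p.2 p.1 with h | h
  · obtain ⟨c, hc⟩ := exists_add_of_le h
    exact .inl ⟨c, mk_eq_mk.2 (by simp [hc, add_comm])⟩
  · obtain ⟨c, hc⟩ := exists_add_of_le h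
    exact .inr ⟨c, mk_eq_mk.2 (by simp [hc])⟩

instance : Nontrivial (DiffRing R) := of_injective.nontrivial

instance : NoZeroDivisors (DiffRing R) where
  eq_zero_or_eq_zero_of_mul_eq_zero {x y} h := by
    have key : ∀ a b : R, of a * of b = 0 → of a = 0 ∨ of b = 0 := fun a b h => by
      rw [← map_mul, ← map_zero of] at h
      rcases mul_eq_zero.1 (of_injective h) with rfl | rfl
      · exact .inl (map_zero _)
      · exact .inr (map_zero _)
    rcases eq_of_or_neg_of x with ⟨a, rfl⟩ | ⟨a, rfl⟩ <;>
      rcases eq_of_or_neg_of y with ⟨b, rfl⟩ | ⟨b, rfl⟩ <;>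
      simpa using key a b (by simpa using h)

instance : IsDomain (DiffRing R) := NoZeroDivisors.to_isDomain _

end DiffRing

variable [CanonicallyOrderedAdd R]

/-- The field of fractions of the ordered semiring `R`. -/
def FracField : Type := FractionRing (DiffRing R)

namespace FracField

variable {R}

noncomputable instance : Field (FracField R) := inferInstanceAs (Field (FractionRing (DiffRing R)))

/-- The embedding of `R` into its field of fractions. -/
noncomputable def of : R →+* FracField R :=
  (algebraMap (DiffRing R) (FractionRing (DiffRing R))).comp DiffRing.of

theorem of_injective : Function.Injective (of (R := R)) :=
  (IsFractionRing.injective (DiffRing R) (FractionRing (DiffRing R))).comp DiffRing.of_injective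

theorem of_ne_zero {a : R} (h : a ≠ 0) : of a ≠ 0 := by
  rw [← map_zero of]; exact of_injective.ne h

/-- The cone of fractions of elements of `R`. -/
def Nonneg (x : FracField R) : Prop := ∃ a d : R, d ≠ 0 ∧ x = of a / of d

theorem nonneg_or_neg (x : FracField R) : Nonneg x ∨ Nonneg (-x) := by
  let j : DiffRing R →+* FracField R := algebraMap (DiffRing R) (FractionRing (DiffRing R))
  obtain ⟨z, w, hw, hx⟩ : ∃ z w, w ∈ nonZeroDivisors (DiffRing R) ∧ j z / j w = x :=
    IsFractionRing.div_surjective (A := DiffRing R) (K := FractionRing (DiffRing R)) x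
  have hw := nonZeroDivisors.ne_zero hw
  subst hx
  rcases DiffRing.eq_of_or_neg_of w with ⟨d, rfl⟩ | ⟨d, rfl⟩ <;>
    rcases DiffRing.eq_of_or_neg_of z with ⟨a, rfl⟩ | ⟨a, rfl⟩ <;>
    have hd : d ≠ 0 := by rintro rfl; simp at hw
  · exact .inl ⟨a, d, hd, rfl⟩
  · exact .inr ⟨a, d, hd, by rw [map_neg, neg_div, neg_neg]; rfl⟩
  · exact .inr ⟨a, d, hd, by rw [map_neg, div_neg, neg_neg]; rfl⟩
  · exact .inl ⟨a, d, hd, by rw [map_neg, map_neg, neg_div_neg_eq]; rfl⟩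

theorem Nonneg.add {x y : FracField R} (hx : Nonneg x) (hy : Nonneg y) : Nonneg (x + y) := by
  obtain ⟨a, d, hd, rfl⟩ := hx
  obtain ⟨b, e, he, rfl⟩ := hy
  refine ⟨a * e + d * b, d * e, mul_ne_zero hd he, ?_⟩
  rw [div_add_div _ _ (of_ne_zero hd) (of_ne_zero he)]
  simp only [map_add, map_mul]

theorem Nonneg.mul {x y : FracField R} (hx : Nonneg x) (hy : Nonneg y) : Nonneg (x * y) := by
  obtain ⟨a, d, hd, rfl⟩ := hx
  obtain ⟨b, e, he, rfl⟩ := hy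
  refine ⟨a * b, d * e, mul_ne_zero hd he, ?_⟩
  rw [div_mul_div_comm]
  simp only [map_mul]

/-- After clearing denominators, a sum of two elements of `R` vanishes; as both are nonnegative,
each of them does. -/
theorem Nonneg.eq_zero {x : FracField R} (hx : Nonneg x) (hx' : Nonneg (-x)) : x = 0 := by
  obtain ⟨a, d, hd, rfl⟩ := hx
  obtain ⟨b, e, he, h⟩ := hx'
  rw [neg_eq_iff_add_eq_zero, div_add_div _ _ (of_ne_zero hd) (of_ne_zero he),
    div_eq_zero_iff, ← map_mul, ← map_mul, ← map_add, ← map_mul] at h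
  have h := h.resolve_right (of_ne_zero (mul_ne_zero hd he))
  rw [← map_zero of] at h
  have h' := (add_eq_zero_iff_of_nonneg (zero_le (a := a * e)) zero_le).1 (of_injective h)
  have : a = 0 := (mul_eq_zero.1 h'.1).resolve_right he
  rw [this, map_zero, zero_div]

noncomputable instance : LinearOrder (FracField R) where
  le x y := Nonneg (y - x)
  le_refl x := ⟨0, 1, one_ne_zero, by simp⟩
  le_trans x y z h₁ h₂ := by
    have := Nonneg.add h₁ h₂
    rwa [show y - x + (z - y) = z - x by ring] at this
  le_antisymm x y h₁ h₂ := by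
    have := Nonneg.eq_zero h₁ (by rwa [neg_sub])
    exact (sub_eq_zero.1 this).symm
  le_total x y := by
    rcases nonneg_or_neg (y - x) with h | h
    · exact .inl h
    · exact .inr (by rwa [neg_sub] at h)
  toDecidableLE := Classical.decRel _

theorem le_def {x y : FracField R} : x ≤ y ↔ Nonneg (y - x) := Iff.rfl

instance : IsOrderedAddMonoid (FracField R) where
  add_le_add_left x y h z := by rw [le_def] at h ⊢; rwa [add_sub_add_right_eq_sub]

instance : ZeroLEOneClass (FracField R) where
  zero_le_one := by rw [le_def, sub_zero]; exact ⟨1, 1, one_ne_zero, by simp⟩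

instance : IsStrictOrderedRing (FracField R) := .of_mul_pos fun x y hx hy => by
  refine lt_of_le_of_ne ?_ (mul_ne_zero hx.ne' hy.ne').symm
  have h₁ := le_def.1 hx.le
  have h₂ := le_def.1 hy.le
  rw [sub_zero] at h₁ h₂
  rw [le_def, sub_zero]
  exact h₁.mul h₂

theorem of_nonneg (a : R) : 0 ≤ of a := by
  rw [le_def, sub_zero]; exact ⟨a, 1, one_ne_zero, by simp⟩

theorem of_le_of {a b : R} : of a ≤ of b ↔ a ≤ b := by
  have h : ∀ {a b : R}, a ≤ b → of a ≤ of b := fun h => by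
    obtain ⟨c, rfl⟩ := exists_add_of_le h
    rw [map_add]
    exact le_add_of_nonneg_right (of_nonneg c)
  refine ⟨fun h' => ?_, h⟩
  by_contra hn
  exact hn (of_injective (le_antisymm h' (h (not_le.1 hn).le))).le

theorem of_lt_of {a b : R} : of a < of b ↔ a < b := by
  rw [← not_le, of_le_of, not_le]

theorem exists_eq_div {x : FracField R} (hx : 0 ≤ x) : ∃ a d : R, d ≠ 0 ∧ x = of a / of d := by
  rwa [le_def, sub_zero] at hx

end FracField

end OrderedFractions

end HigherOrderArith

namespace HigherOrderArith
namespace Str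

/-! ### Rational numbers of a structure -/

variable {M : Str}

/-- The code of the pair `(i, j)`. -/
def pairCode (i j : M.N) : M.N := (i + j) * (i + j) + i

/-- The code of `(a - b) / (d + 1)`. -/
def code (a b d : M.N) : M.N := pairCode (pairCode a b) d

/-- `q` is the code of a rational number. -/
def Valid (q : M.N) : Prop := ∃ a b d, q = code a b d

theorem valid_code (a b d : M.N) : Valid (code a b d) := ⟨a, b, d, rfl⟩

variable [M.IsModel] {A : Type} [Space M A]

/-- The ordered field of fractions of the numbers of a structure. -/
abbrev K (M : Str) [M.IsModel] : Type := FracField M.N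

/-- The embedding of numbers into fractions. -/
noncomputable abbrev ι : M.N →+* M.K := FracField.of

/-- The powers of two. -/
def pw (n : M.N) : M.N := M.recursor ⬩ 1 ⬩ (M.combK _ _ ⬩ (M.mul ⬩ 2)) ⬩ n

@[fun_prop] theorem Rep.pw {f : A → M.N} (hf : Rep M f) : Rep M fun a => Str.pw (f a) := by
  unfold Str.pw; fun_prop

theorem pw_zero : pw (0 : M.N) = 1 := recursor_zero _ _

theorem pw_add_one (n : M.N) : pw (n + 1) = 2 * pw n := by
  rw [pw, ← succ_def, recursor_succ, app_combK]; rfl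

theorem pw_add (m n : M.N) : pw (m + n) = pw m * pw n := by
  induction n using rep_induction with
  | hP => fun_prop
  | h₀ => rw [add_zero, pw_zero, mul_one]
  | h₁ n ih => rw [← add_assoc, pw_add_one, ih, pw_add_one]; ring

theorem lt_pw (n : M.N) : n < pw n := by
  induction n using rep_induction with
  | hP => fun_prop
  | h₀ => rw [pw_zero]; exact one_pos
  | h₁ n ih =>
    rw [pw_add_one, two_mul]
    exact add_lt_add_of_lt_of_le ih (N.one_le_iff_pos.2 ((N.zero_le n).trans_lt ih))

theorem pw_pos (n : M.N) : 0 < pw n := (N.zero_le n).trans_lt (lt_pw n)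

theorem ι_nonneg (n : M.N) : (0 : M.K) ≤ ι n := FracField.of_nonneg n

theorem ι_le {m n : M.N} : ι m ≤ ι n ↔ m ≤ n := FracField.of_le_of

theorem ι_lt {m n : M.N} : ι m < ι n ↔ m < n := FracField.of_lt_of

theorem ι_pos {n : M.N} : 0 < ι n ↔ 0 < n := by rw [← map_zero ι, ι_lt]

/-- The Archimedean property relative to the numbers of `M`; with respect to the standard numbers it
can fail. -/
theorem exists_lt_ι (x : M.K) : ∃ n, x < ι n := by
  rcases lt_or_ge x 0 with h | h
  · exact ⟨0, by rwa [map_zero]⟩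
  · obtain ⟨a, d, hd, rfl⟩ := FracField.exists_eq_div h
    refine ⟨a + 1, (div_le_self (ι_nonneg a) ?_).trans_lt (ι_lt.2 (N.lt_add_one_iff.2 le_rfl))⟩
    rw [← map_one ι, ι_le]
    exact N.one_le_iff_pos.2 (pos_iff_ne_zero.2 hd)

/-- The number `2 ^ (-n)`. -/
noncomputable def eps (n : M.N) : M.K := 1 / ι (pw n)

theorem eps_zero : eps (0 : M.N) = 1 := by rw [eps, pw_zero, map_one, div_one]

theorem eps_pos (n : M.N) : 0 < eps n := one_div_pos.2 (ι_pos.2 (pw_pos n))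

theorem eps_add_one (n : M.N) : eps (n + 1) = eps n / 2 := by
  rw [eps, eps, pw_add_one, map_mul, map_ofNat, div_div, mul_comm]

theorem eps_add_le (m n : M.N) : eps (m + n) ≤ eps m := by
  refine one_div_le_one_div_of_le (ι_pos.2 (pw_pos m)) (ι_le.2 ?_)
  rw [pw_add]
  exact le_mul_of_one_le_right (N.zero_le _) (N.one_le_iff_pos.2 (pw_pos n))

theorem exists_eps_lt {x : M.K} (hx : 0 < x) : ∃ n : M.N, eps n < x := by
  obtain ⟨n, hn⟩ := exists_lt_ι x⁻¹
  refine ⟨n, ?_⟩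
  rw [eps, one_div]
  exact inv_lt_of_inv_lt₀ hx (hn.trans (ι_lt.2 (lt_pw n)))

/-! ### Codes of rational numbers -/

/-- With `s = i + j`, the code lies between `s ^ 2` and `s ^ 2 + s`, hence below `(s + 1) ^ 2`; so
it determines `s`, and then `i`. -/
theorem pairCode_inj {i j i' j' : M.N} (h : pairCode i j = pairCode i' j') : i = i' ∧ j = j' := by
  have key : ∀ {i j i' j' : M.N}, pairCode i j = pairCode i' j' → i' + j' ≤ i + j := by
    intro i j i' j' h
    by_contra! hn
    have h₁ := mul_self_le_mul_self (N.zero_le _) (N.add_one_le_iff.2 hn)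
    have h₂ : pairCode i j < pairCode i' j' := by
      calc pairCode i j ≤ (i + j) * (i + j) + (i + j) := by unfold pairCode; gcongr; exact le_self_add
        _ ≤ (i + j) * (i + j) + (i + j) + (i + j) := le_self_add
        _ < (i + j) * (i + j) + (i + j) + (i + j) + 1 := N.lt_add_one_iff.2 le_rfl
        _ = (i + j + 1) * (i + j + 1) := by ring
        _ ≤ (i' + j') * (i' + j') := h₁
        _ ≤ pairCode i' j' := le_self_add
    exact h₂.ne h
  have hs := le_antisymm (key h.symm) (key h)
  unfold pairCode at h
  rw [hs] at h
  have hi := add_left_cancel h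
  rw [hi] at hs
  exact ⟨hi, add_left_cancel hs⟩

@[fun_prop] theorem Rep.code {f g h : A → M.N} (hf : Rep M f) (hg : Rep M g) (hh : Rep M h) :
    Rep M fun a => Str.code (f a) (g a) (h a) := by
  unfold Str.code pairCode; fun_prop

theorem code_inj {a b d a' b' d' : M.N} (h : code a b d = code a' b' d') :
    a = a' ∧ b = b' ∧ d = d' := by
  obtain ⟨h₁, h₂⟩ := pairCode_inj h
  obtain ⟨h₃, h₄⟩ := pairCode_inj h₁
  exact ⟨h₃, h₄, h₂⟩

/-- The rational number with code `q`. -/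
noncomputable def val (q : M.N) : M.K :=
  Classical.epsilon fun z => ∀ a b d, q = code a b d → z = (ι a - ι b) / (ι d + 1)

theorem val_code (a b d : M.N) : val (code a b d) = (ι a - ι b) / (ι d + 1) :=
  Classical.epsilon_spec (p := fun z => ∀ a' b' d', code a b d = code a' b' d' →
    z = (ι a' - ι b') / (ι d' + 1)) ⟨_, fun a' b' d' h => by
      obtain ⟨rfl, rfl, rfl⟩ := code_inj h; rfl⟩ a b d rfl

/-- `q` and `r` are codes of rational numbers with `q - r ≤ c / 2 ^ k`. -/
def DiffLe (q r k c : M.N) : Prop := ∃ a b d a' b' d', q = code a b d ∧ r = code a' b' d' ∧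
  pw k * (a * (d' + 1) + b' * (d + 1)) ≤
    c * ((d + 1) * (d' + 1)) + pw k * (b * (d' + 1) + a' * (d + 1))

@[fun_prop] theorem Rep.diffLe {f g h k : A → M.N} (hf : Rep M f) (hg : Rep M g) (hh : Rep M h)
    (hk : Rep M k) : Rep M fun a => DiffLe (f a) (g a) (h a) (k a) := by
  unfold DiffLe; fun_prop

theorem diffLe_iff {q r k c : M.N} :
    DiffLe q r k c ↔ Valid q ∧ Valid r ∧ val q - val r ≤ ι c * eps k := by
  have key : ∀ a b d a' b' d' : M.N, pw k * (a * (d' + 1) + b' * (d + 1)) ≤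
      c * ((d + 1) * (d' + 1)) + pw k * (b * (d' + 1) + a' * (d + 1)) ↔
      val (code a b d) - val (code a' b' d') ≤ ι c * eps k := by
    intro a b d a' b' d'
    rw [val_code, val_code, eps, mul_one_div, ← ι_le]
    have hd : (0 : M.K) < ι d + 1 := add_pos_of_nonneg_of_pos (ι_nonneg d) one_pos
    have hd' : (0 : M.K) < ι d' + 1 := add_pos_of_nonneg_of_pos (ι_nonneg d') one_pos
    have hk : (0 : M.K) < ι (pw k) := ι_pos.2 (pw_pos k)
    rw [div_sub_div _ _ hd.ne' hd'.ne', div_le_div_iff₀ (mul_pos hd hd') hk]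
    simp only [map_add, map_mul, map_one]
    rw [← sub_nonneg, ← sub_nonneg (b := _ * ι (pw k))]
    ring_nf
  constructor
  · rintro ⟨a, b, d, a', b', d', rfl, rfl, h⟩
    exact ⟨valid_code _ _ _, valid_code _ _ _, (key _ _ _ _ _ _).1 h⟩
  · rintro ⟨⟨a, b, d, rfl⟩, ⟨a', b', d', rfl⟩, h⟩
    exact ⟨a, b, d, a', b', d', rfl, rfl, (key _ _ _ _ _ _).2 h⟩

/-! ### Real numbers of a structure -/

/-- `x` is a fast-converging sequence of rationals. -/
def IsReal (x : M.Obj .one) : Prop :=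
  ∀ k i, DiffLe (x ⬩ k) (x ⬩ (k + i)) k 1 ∧ DiffLe (x ⬩ (k + i)) (x ⬩ k) k 1

/-- `x =_ℝ y`. -/
def RealEq (x y : M.Obj .one) : Prop := ∀ k, DiffLe (x ⬩ k) (y ⬩ k) k 2 ∧ DiffLe (y ⬩ k) (x ⬩ k) k 2

/-- `x ≤_ℝ y`. -/
def RealLe (x y : M.Obj .one) : Prop := ∀ k, DiffLe (x ⬩ k) (y ⬩ k) k 2

/-- The fraction `z` is smaller than the real number `x`. -/
def Below (z : M.K) (x : M.Obj .one) : Prop := ∃ k, z + eps k < val (x ⬩ k)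

variable {x y : M.Obj .one} {z z' : M.K}

theorem IsReal.valid (hx : IsReal x) (k : M.N) : Valid (x ⬩ k) := (diffLe_iff.1 (hx k 0).1).1

theorem IsReal.le_add (hx : IsReal x) (k i : M.N) : val (x ⬩ k) ≤ val (x ⬩ (k + i)) + eps k := by
  have := (diffLe_iff.1 (hx k i).1).2.2
  rw [map_one, one_mul] at this
  linarith

theorem IsReal.add_le (hx : IsReal x) (k i : M.N) : val (x ⬩ (k + i)) ≤ val (x ⬩ k) + eps k := by
  have := (diffLe_iff.1 (hx k i).2).2.2
  rw [map_one, one_mul] at this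
  linarith

theorem realEq_iff (hx : IsReal x) (hy : IsReal y) : RealEq x y ↔
    ∀ k, val (x ⬩ k) ≤ val (y ⬩ k) + 2 * eps k ∧ val (y ⬩ k) ≤ val (x ⬩ k) + 2 * eps k := by
  simp only [RealEq, diffLe_iff, hx.valid, hy.valid, true_and, map_ofNat, sub_le_iff_le_add']

theorem RealEq.symm (h : RealEq x y) : RealEq y x := fun k => ⟨(h k).2, (h k).1⟩

theorem Below.mono (h : Below z x) (hz : z' ≤ z) : Below z' x := by
  obtain ⟨k, hk⟩ := h
  exact ⟨k, by linarith⟩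

theorem Below.lt (h : Below z x) (hx : IsReal x) (m : M.N) : z < val (x ⬩ m) + eps m := by
  obtain ⟨k, hk⟩ := h
  rcases le_total k m with h | h
  · obtain ⟨i, rfl⟩ := N.le_iff_exists_add.1 h
    have := hx.le_add k i
    have := eps_pos (k + i)
    linarith
  · obtain ⟨i, rfl⟩ := N.le_iff_exists_add.1 h
    have := hx.add_le m i
    have := eps_pos (m + i)
    linarith

theorem le_of_not_below (h : ¬ Below z x) (m : M.N) : val (x ⬩ m) ≤ z + eps m := by
  by_contra! hn
  exact h ⟨m, hn⟩

theorem not_below_of_le (hx : IsReal x) (h : ∀ k, val (x ⬩ k) ≤ z + 2 * eps k) : ¬ Below z x := by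
  rintro ⟨k, hk⟩
  -- Half the gap, because the assumed bound has error `2 * eps (k + n)`.
  obtain ⟨n, hn⟩ := exists_eps_lt (x := (val (x ⬩ k) - (z + eps k)) / 2) (by linarith)
  have h₁ := h (k + n)
  have h₂ := hx.le_add k n
  have h₃ := eps_add_le n k
  rw [add_comm n k] at h₃
  linarith

theorem not_below_of_forall_eps (h : ∀ n, ¬ Below (z + eps n) x) : ¬ Below z x := by
  rintro ⟨k, hk⟩
  obtain ⟨n, hn⟩ := exists_eps_lt (x := val (x ⬩ k) - (z + eps k)) (by linarith)
  exact h n ⟨k, by linarith⟩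

theorem Below.congr (h : Below z x) (hx : IsReal x) (hy : IsReal y) (hxy : RealEq x y) :
    Below z y := by
  rw [realEq_iff hx hy] at hxy
  obtain ⟨k, hk⟩ := h
  -- A third of the gap: two units of `eps (k + n)` are lost in passing from `x` to `y`, and one is
  -- the margin that `Below` demands.
  obtain ⟨n, hn⟩ := exists_eps_lt (x := (val (x ⬩ k) - (z + eps k)) / 3) (by linarith)
  refine ⟨k + n, ?_⟩
  have h₁ := (hxy (k + n)).1
  have h₂ := hx.le_add k n
  have h₃ := eps_add_le n k
  rw [add_comm n k] at h₃
  linarith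

/-- Real numbers in the same arbitrarily small intervals are equal. -/
theorem realEq_of_cells (hx : IsReal x) (hy : IsReal y)
    (h : ∀ n, ∃ z, Below z x ∧ ¬ Below (z + eps n) x ∧ Below z y ∧ ¬ Below (z + eps n) y) :
    RealEq x y := by
  have key : ∀ {x y : M.Obj .one}, IsReal y →
      (∀ n, ∃ z, ¬ Below (z + eps n) x ∧ Below z y) →
      ∀ k, val (x ⬩ k) ≤ val (y ⬩ k) + 2 * eps k := by
    intro x y hy h k
    by_contra! hn
    obtain ⟨n, hn⟩ := exists_eps_lt (x := val (x ⬩ k) - (val (y ⬩ k) + 2 * eps k)) (by linarith)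
    obtain ⟨z, h₁, h₂⟩ := h n
    have h₃ := le_of_not_below h₁ k
    have h₄ := h₂.lt hy k
    linarith
  rw [realEq_iff hx hy]
  refine fun k => ⟨key hy (fun n => ?_) k, key hx (fun n => ?_) k⟩
  · obtain ⟨z, h₁, h₂, h₃, h₄⟩ := h n; exact ⟨z, h₂, h₃⟩
  · obtain ⟨z, h₁, h₂, h₃, h₄⟩ := h n; exact ⟨z, h₄, h₁⟩

/-- The rational number with code `q` is smaller than `x`. -/
def BelowCode (q : M.N) (x : M.Obj .one) : Prop := ∃ k, ¬ DiffLe (x ⬩ k) q k 1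

@[fun_prop] theorem Rep.belowCode {f : A → M.N} {g : A → M.Obj .one} (hf : Rep M f)
    (hg : Rep M g) : Rep M fun a => BelowCode (f a) (g a) := by
  unfold BelowCode; fun_prop

/-- Fractions in `K` are external to `M`. Comparisons are computed with `Below` there, while
definitions and inductions use the representable relation on codes. -/
theorem belowCode_iff (hx : IsReal x) {q : M.N} (hq : Valid q) :
    BelowCode q x ↔ Below (val q) x := by
  refine exists_congr fun k => ?_
  rw [diffLe_iff, map_one, one_mul]
  simp only [hx.valid, hq, true_and, not_le, lt_sub_iff_add_lt']

end Str

end HigherOrderArith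

namespace HigherOrderArith
namespace Str

variable {M : Str} [M.IsModel] {A : Type} [Space M A]

/-! ### Case distinctions and parity. -/

theorem mu_of_not_exists {P : M.N → Prop} (h : ¬ ∃ n, P n) : mu P = 0 :=
  mu_eq_iff.2 (.inr ⟨rfl, fun ⟨n, hn, _⟩ => h ⟨n, hn⟩⟩)

namespace N

theorem add_two_ne_one (k : M.N) : k + 2 ≠ 1 := fun h => by
  rw [← one_add_one_eq_two, ← add_assoc] at h
  exact add_one_ne_zero k (add_one_inj (h.trans (zero_add 1).symm))

theorem add_two_ne_zero (k : M.N) : k + 2 ≠ 0 := fun h => by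
  rw [← one_add_one_eq_two, ← add_assoc] at h
  exact add_one_ne_zero _ h

theorem cases_two (k : M.N) : k = 0 ∨ k = 1 ∨ ∃ l, k = l + 2 := by
  by_cases h₀ : k = 0
  · exact .inl h₀
  obtain ⟨l, rfl⟩ := exists_add_one h₀
  by_cases h₁ : l = 0
  · exact .inr (.inl (by rw [h₁, zero_add]))
  obtain ⟨m, rfl⟩ := exists_add_one h₁
  exact .inr (.inr ⟨m, by rw [add_assoc, one_add_one_eq_two]⟩)

theorem two_mul_ne_two_mul_add_one (i j : M.N) : 2 * i ≠ 2 * j + 1 := by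
  rcases le_or_gt i j with h | h
  · exact (lt_add_one_iff.2 (mul_le_mul_right h 2)).ne
  · have := mul_le_mul_right (add_one_le_iff.2 h) 2
    refine (lt_of_lt_of_le ?_ this).ne'
    rw [mul_add, mul_one, ← one_add_one_eq_two (R := M.N), ← add_assoc]
    exact lt_add_one_iff.2 le_rfl

theorem even_or_odd (c : M.N) : ∃ i, c = 2 * i ∨ c = 2 * i + 1 := by
  induction c using rep_induction with
  | hP => fun_prop
  | h₀ => exact ⟨0, .inl (mul_zero _).symm⟩
  | h₁ c ih =>
    obtain ⟨i, rfl | rfl⟩ := ih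
    · exact ⟨i, .inr rfl⟩
    · exact ⟨i + 1, .inl (by ring)⟩

end N

/-! ### Coding of integers -/

/-- The positive part of the integer coded by `c`. -/
noncomputable def posPart (c : M.N) : M.N := mu fun i => c = 2 * i

/-- The negative part of the integer coded by `c`. -/
noncomputable def negPart (c : M.N) : M.N := mu fun j => c + 1 = 2 * j

@[fun_prop] theorem Rep.posPart {f : A → M.N} (hf : Rep M f) :
    Rep M fun a => Str.posPart (f a) := by
  unfold Str.posPart; fun_prop

@[fun_prop] theorem Rep.negPart {f : A → M.N} (hf : Rep M f) :
    Rep M fun a => Str.negPart (f a) := by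
  unfold Str.negPart; fun_prop

/-- The integer coded by `c`. -/
noncomputable def sg (c : M.N) : M.K := ι (posPart c) - ι (negPart c)

theorem sg_even (i : M.N) : sg (2 * i) = ι i := by
  have h₁ : posPart (2 * i) = i :=
    (mul_left_cancel₀ two_ne_zero (mu_spec (P := fun j => 2 * i = 2 * j) (by fun_prop)
      ⟨i, rfl⟩)).symm
  -- The defining equation has no solution, so `mu` returns its default value `0`.
  have h₂ : negPart (2 * i) = 0 :=
    mu_of_not_exists fun ⟨j, hj⟩ => N.two_mul_ne_two_mul_add_one j i hj.symm
  rw [sg, h₁, h₂, map_zero, sub_zero]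

theorem sg_odd (i : M.N) : sg (2 * i + 1) = -ι (i + 1) := by
  have h₁ : posPart (2 * i + 1) = 0 :=
    mu_of_not_exists fun ⟨j, hj⟩ => N.two_mul_ne_two_mul_add_one j i hj.symm
  have h₂ : negPart (2 * i + 1) = i + 1 :=
    (mul_left_cancel₀ two_ne_zero (((show 2 * (i + 1) = 2 * i + 1 + 1 by ring)).trans
      (mu_spec (P := fun j => 2 * i + 1 + 1 = 2 * j) (by fun_prop) ⟨i + 1, by ring⟩))).symm
  rw [sg, h₁, h₂, map_zero, zero_sub]

theorem sg_zero : sg (0 : M.N) = 0 := by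
  rw [← mul_zero 2, sg_even, map_zero]

theorem exists_sg_eq (i j : M.N) : ∃ c, sg c = ι i - ι j := by
  rcases le_or_gt j i with h | h
  · obtain ⟨k, rfl⟩ := N.le_iff_exists_add.1 h
    exact ⟨2 * k, by rw [sg_even, map_add]; ring⟩
  · obtain ⟨k, rfl⟩ := N.le_iff_exists_add.1 (N.add_one_le_iff.2 h)
    exact ⟨2 * k + 1, by rw [sg_odd]; simp only [map_add, map_one]; ring⟩

theorem sg_add_one_le {c c' : M.N} (h : sg c < sg c') : sg c + 1 ≤ sg c' := by
  have h₁ : posPart c + negPart c' < posPart c' + negPart c := by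
    rw [← ι_lt, map_add, map_add]; unfold sg at h; linarith
  have h₂ := ι_le.2 (N.add_one_le_iff.2 h₁)
  simp only [map_add, map_one] at h₂
  unfold sg; linarith

/-- Even codes give the nonnegative integers and odd codes the negative ones, each once. Without
repetitions, the integer part of a real has a unique code. -/
theorem sg_injective : Function.Injective (sg : M.N → M.K) := by
  have key : ∀ i j : M.N, sg (2 * i) ≠ sg (2 * j + 1) := by
    intro i j h
    rw [sg_even, sg_odd] at h
    have h₁ := ι_nonneg i
    have h₂ := ι_pos.2 (N.zero_lt_add_one j)
    linarith
  intro c c' h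
  obtain ⟨i, rfl | rfl⟩ := N.even_or_odd c <;> obtain ⟨j, rfl | rfl⟩ := N.even_or_odd c'
  · rw [sg_even, sg_even] at h; rw [FracField.of_injective h]
  · exact (key _ _ h).elim
  · exact (key _ _ h.symm).elim
  · rw [sg_odd, sg_odd] at h; rw [N.add_one_inj (FracField.of_injective (neg_injective h))]

/-- The code of the dyadic rational `sg c + n / 2 ^ p`. -/
noncomputable def pt (c n p : M.N) : M.N :=
  code (posPart c * pw p + n) (negPart c * pw p) (mu fun d => d + 1 = pw p)

@[fun_prop] theorem Rep.pt {f g h : A → M.N} (hf : Rep M f) (hg : Rep M g) (hh : Rep M h) :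
    Rep M fun a => Str.pt (f a) (g a) (h a) := by
  unfold Str.pt; fun_prop

theorem valid_pt (c n p : M.N) : Valid (pt c n p) := valid_code _ _ _

theorem ι_pw_mul_eps (p : M.N) : ι (pw p) * eps p = 1 :=
  mul_one_div_cancel (ι_pos.2 (pw_pos p)).ne'

theorem eps_add (m n : M.N) : eps (m + n) = eps m * eps n := by
  rw [eps, eps, eps, pw_add, map_mul, div_mul_div_comm, one_mul]

theorem val_pt (c n p : M.N) : val (pt c n p) = sg c + ι n * eps p := by
  obtain ⟨d, hd⟩ := N.exists_add_one (pw_pos p).ne'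
  -- Codes store the denominator less one.
  have h : (mu fun d => d + 1 = pw p) + 1 = pw p :=
    mu_spec (P := fun d => d + 1 = pw p) (by fun_prop) ⟨d, hd.symm⟩
  rw [pt, val_code, ← map_one ι, ← map_add, h, eps, sg]
  have hp := (ι_pos.2 (pw_pos p)).ne'
  simp only [map_add, map_mul]
  field_simp
  ring

/-! ### Binary expansions -/

variable {x y : M.Obj .one}

/-- The real number `x` is in the interval `(sg c + n / 2 ^ p, sg c + (n + 1) / 2 ^ p]`. -/
def InCell (x : M.Obj .one) (c n p : M.N) : Prop :=
  Below (sg c + ι n * eps p) x ∧ ¬ Below (sg c + (ι n + 1) * eps p) x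

theorem InCell.congr {c n p : M.N} (h : InCell x c n p) (hx : IsReal x) (hy : IsReal y)
    (hxy : RealEq x y) : InCell y c n p :=
  ⟨h.1.congr hx hy hxy, fun h' => h.2 (h'.congr hy hx hxy.symm)⟩

theorem InCell.eq {c n m p : M.N} (hn : InCell x c n p) (hm : InCell x c m p) : n = m := by
  have key : ∀ {n m}, InCell x c n p → InCell x c m p → ¬ n < m := by
    intro n m hn hm h
    refine hn.2 (hm.1.mono ?_)
    have h₁ := ι_le.2 (N.add_one_le_iff.2 h)
    rw [map_add, map_one] at h₁
    have := mul_le_mul_of_nonneg_right h₁ (eps_pos p).le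
    linarith
  exact le_antisymm (not_lt.1 (key hm hn)) (not_lt.1 (key hn hm))

theorem inCell_zero_iff {c : M.N} : InCell x c 0 0 ↔ Below (sg c) x ∧ ¬ Below (sg c + 1) x := by
  rw [InCell, map_zero, zero_mul, add_zero, zero_add, eps_zero, one_mul]

theorem InCell.eq_int {c c' : M.N} (h : InCell x c 0 0) (h' : InCell x c' 0 0) : c = c' := by
  rw [inCell_zero_iff] at h h'
  refine sg_injective (le_antisymm ?_ ?_)
  · exact not_lt.1 fun hn => h'.2 (h.1.mono (sg_add_one_le hn))
  · exact not_lt.1 fun hn => h.2 (h'.1.mono (sg_add_one_le hn))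

/-- The midpoint either is below `x` or is not, which selects the right or the left half. -/
theorem InCell.refine {c n p : M.N} (h : InCell x c n p) :
    InCell x c (2 * n) (p + 1) ∨ InCell x c (2 * n + 1) (p + 1) := by
  unfold InCell at h ⊢
  simp only [eps_add_one, map_add, map_mul, map_ofNat, map_one]
  rw [show sg c + 2 * ι n * (eps p / 2) = sg c + ι n * eps p by ring,
    show sg c + (2 * ι n + 1 + 1) * (eps p / 2) = sg c + (ι n + 1) * eps p by ring]
  tauto

theorem IsReal.exists_inCell (hx : IsReal x) : ∃ c, InCell x c 0 0 := by
  obtain ⟨n₁, h₁⟩ := exists_lt_ι (val (x ⬩ 0))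
  obtain ⟨n₂, h₂⟩ := exists_lt_ι (-val (x ⬩ 0))
  have hval : ∀ n, val (code n (n₂ + 2) 0) = ι n - ι (n₂ + 2) := fun n => by
    rw [val_code, map_zero, zero_add, div_one]
  -- The least `n` with `x ≤ n + 1 - (n₂ + 2)` is sought. The translation lets a natural number
  -- range over integers, starting at `-(n₂ + 2)`, which lies strictly below `x`; this settles the
  -- case `n = 0`.
  let P : M.N → Prop := fun n => ¬ BelowCode (code (n + 1) (n₂ + 2) 0) x
  have hP' : ∀ n, P n ↔ ¬ Below (ι (n + 1) - ι (n₂ + 2)) x := fun n => by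
    simp only [P, belowCode_iff hx (valid_code _ _ _), hval]
  have hP : Rep M P := by fun_prop
  obtain ⟨n, hn, hm⟩ := exists_least hP ⟨n₁ + n₂ + 2, by
    rw [hP']
    rintro ⟨k, hk⟩
    have h := hx.add_le 0 k
    rw [zero_add, eps_zero] at h
    have := eps_pos k
    simp only [map_add, map_ofNat, map_one] at hk
    linarith⟩
  obtain ⟨c, hc⟩ := exists_sg_eq n (n₂ + 2)
  refine ⟨c, inCell_zero_iff.2 ⟨?_, ?_⟩⟩
  · rw [hc]
    by_cases h₀ : n = 0
    · refine ⟨0, ?_⟩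
      rw [h₀, map_zero, eps_zero, map_add, map_ofNat]
      linarith
    · obtain ⟨m, rfl⟩ := N.exists_add_one h₀
      simpa only [hP', not_not] using hm m (N.lt_add_one_iff.2 le_rfl)
  · rw [hP', map_add, map_one] at hn
    rwa [hc, sub_add_eq_add_sub]

/-- The code of the integer `z` with `z < x ≤ z + 1`. -/
noncomputable def intPart (x : M.Obj .one) : M.N :=
  mu fun c => BelowCode (pt c 0 0) x ∧ ¬ BelowCode (pt c 1 0) x

@[fun_prop] theorem Rep.intPart {f : A → M.Obj .one} (hf : Rep M f) :
    Rep M fun a => Str.intPart (f a) := by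
  unfold Str.intPart; fun_prop

theorem IsReal.belowCode_pt (hx : IsReal x) (c n p : M.N) :
    BelowCode (pt c n p) x ↔ Below (sg c + ι n * eps p) x := by
  rw [belowCode_iff hx (valid_pt _ _ _), val_pt]

theorem IsReal.inCell_intPart (hx : IsReal x) : InCell x (intPart x) 0 0 := by
  have h : ∀ c, (BelowCode (pt c 0 0) x ∧ ¬ BelowCode (pt c 1 0) x) ↔ InCell x c 0 0 := fun c => by
    rw [hx.belowCode_pt, hx.belowCode_pt, InCell, map_zero, zero_add, map_one]
  obtain ⟨c, hc⟩ := hx.exists_inCell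
  exact (h _).1 (mu_spec (P := fun c => BelowCode (pt c 0 0) x ∧ ¬ BelowCode (pt c 1 0) x)
    (by fun_prop) ⟨c, (h c).2 hc⟩)

/-- The number `n` with `x - z` in `(n / 2 ^ p, (n + 1) / 2 ^ p]`, for `z` the integer part. -/
noncomputable def approx (x : M.Obj .one) (p : M.N) : M.N :=
  mu fun n => ¬ BelowCode (pt (intPart x) (n + 1) p) x

@[fun_prop] theorem Rep.approx {f : A → M.Obj .one} {g : A → M.N} (hf : Rep M f) (hg : Rep M g) :
    Rep M fun a => Str.approx (f a) (g a) := by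
  unfold Str.approx; fun_prop

theorem IsReal.inCell_approx (hx : IsReal x) (p : M.N) :
    InCell x (intPart x) (approx x p) p := by
  have h := inCell_zero_iff.1 hx.inCell_intPart
  constructor
  · by_cases h₀ : approx x p = 0
    · rw [h₀, map_zero, zero_mul, add_zero]; exact h.1
    · obtain ⟨m, hm⟩ := N.exists_add_one h₀
      have := not_of_lt_mu (P := fun n => ¬ BelowCode (pt (intPart x) (n + 1) p) x)
        (show m < approx x p by rw [hm]; exact N.lt_add_one_iff.2 le_rfl)
      rwa [not_not, hx.belowCode_pt, ← hm] at this
  · obtain ⟨d, hd⟩ := N.exists_add_one (pw_pos p).ne'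
    have := mu_spec (P := fun n => ¬ BelowCode (pt (intPart x) (n + 1) p) x) (by fun_prop)
      ⟨d, by rw [hx.belowCode_pt, ← hd, ι_pw_mul_eps]; exact h.2⟩
    rwa [hx.belowCode_pt, map_add, map_one] at this

theorem IsReal.approx_eq (hx : IsReal x) {c n p : M.N} (hc : InCell x c 0 0)
    (hn : InCell x c n p) : approx x p = n := by
  have h := hx.inCell_approx p
  rw [hx.inCell_intPart.eq_int hc] at h
  exact h.eq hn

theorem IsReal.approx_add_one (hx : IsReal x) (p : M.N) :
    approx x (p + 1) = 2 * approx x p ∨ approx x (p + 1) = 2 * approx x p + 1 :=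
  (hx.inCell_approx p).refine.imp (hx.approx_eq hx.inCell_intPart) (hx.approx_eq hx.inCell_intPart)

/-- The binary digit of `x` of weight `2 ^ (-(p + 1))` is `1`. -/
def Bit (x : M.Obj .one) (p : M.N) : Prop := approx x (p + 1) = 2 * approx x p + 1

@[fun_prop] theorem Rep.bit {f : A → M.Obj .one} {g : A → M.N} (hf : Rep M f) (hg : Rep M g) :
    Rep M fun a => Bit (f a) (g a) := by
  unfold Bit; fun_prop

/-- If all digits from `p` on were `0`, the cells of `x` would keep the same left end while
shrinking, forcing `x` to be at most that end; but cells are open on the left. -/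
theorem IsReal.exists_bit (hx : IsReal x) (p : M.N) : ∃ q, p ≤ q ∧ Bit x q := by
  by_contra! hn
  have h : ∀ j, approx x (p + j) = approx x p * pw j := fun j => by
    induction j using rep_induction with
    | hP => fun_prop
    | h₀ => rw [add_zero, pw_zero, mul_one]
    | h₁ j ih =>
      rw [← add_assoc, (hx.approx_add_one _).resolve_right (hn _ le_self_add), ih, pw_add_one]
      ring
  refine not_below_of_forall_eps (fun j hj => ?_) (hx.inCell_approx p).1
  refine (hx.inCell_approx (p + j)).2 (hj.mono ?_)
  have h₁ := ι_pw_mul_eps j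
  have h₂ := eps_add_le j p
  rw [h, map_mul, add_mul, one_mul]
  rw [add_comm j p] at h₂
  have h₃ : ι (approx x p) * ι (pw j) * eps (p + j) = ι (approx x p) * eps p := by
    rw [eps_add, ← mul_one (ι (approx x p) * eps p), ← h₁]; ring
  linarith

/-- The position of the `(k + 1)`-st digit `1` of `x`. -/
noncomputable def onePos (x : M.Obj .one) (k : M.N) : M.N :=
  natRec (mu fun p => Bit x p) (fun _ r => mu fun p => r < p ∧ Bit x p) k

@[fun_prop] theorem Rep.onePos {f : A → M.Obj .one} {g : A → M.N} (hf : Rep M f) (hg : Rep M g) :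
    Rep M fun a => Str.onePos (f a) (g a) := by
  unfold Str.onePos; fun_prop

theorem onePos_zero (x : M.Obj .one) : onePos x 0 = mu fun p => Bit x p := natRec_zero' _ _

theorem onePos_add_one (x : M.Obj .one) (k : M.N) :
    onePos x (k + 1) = mu fun p => onePos x k < p ∧ Bit x p :=
  natRec_add_one _ (by fun_prop) k

theorem IsReal.onePos_add_one_spec (hx : IsReal x) (k : M.N) :
    onePos x k < onePos x (k + 1) ∧ Bit x (onePos x (k + 1)) := by
  rw [onePos_add_one]
  obtain ⟨q, hq, hq'⟩ := hx.exists_bit (onePos x k + 1)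
  exact mu_spec (P := fun p => onePos x k < p ∧ Bit x p) (by fun_prop)
    ⟨q, N.add_one_le_iff.1 hq, hq'⟩

theorem IsReal.bit_onePos (hx : IsReal x) (k : M.N) : Bit x (onePos x k) := by
  by_cases h : k = 0
  · rw [h, onePos_zero]
    obtain ⟨q, -, hq⟩ := hx.exists_bit 0
    exact mu_spec (P := fun p => Bit x p) (by fun_prop) ⟨q, hq⟩
  · obtain ⟨j, rfl⟩ := N.exists_add_one h
    exact (hx.onePos_add_one_spec j).2

theorem IsReal.le_onePos (hx : IsReal x) (k : M.N) : k ≤ onePos x k := by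
  induction k using rep_induction with
  | hP => fun_prop
  | h₀ => exact N.zero_le _
  | h₁ k ih => exact N.add_one_le_iff.2 (ih.trans_lt (hx.onePos_add_one_spec k).1)

/-- For the first `k` with `p ≤ onePos x k`, strict inequality is impossible: `p` would have been an
earlier candidate for the minimum defining `onePos x k`. -/
theorem IsReal.bit_iff (hx : IsReal x) (p : M.N) : Bit x p ↔ ∃ k, onePos x k = p := by
  refine ⟨fun hp => ?_, fun ⟨k, hk⟩ => hk ▸ hx.bit_onePos k⟩
  obtain ⟨k, hk, hk'⟩ := exists_least (P := fun k => p ≤ onePos x k) (by fun_prop)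
    ⟨p, hx.le_onePos p⟩
  refine ⟨k, le_antisymm (not_lt.1 fun hlt => ?_) hk⟩
  by_cases h : k = 0
  · rw [h, onePos_zero] at hlt
    exact not_of_lt_mu hlt hp
  · obtain ⟨j, rfl⟩ := N.exists_add_one h
    rw [onePos_add_one] at hlt
    exact not_of_lt_mu hlt ⟨not_le.1 (hk' j (N.lt_add_one_iff.2 le_rfl)), hp⟩

end Str
end HigherOrderArith

namespace HigherOrderArith
namespace Str

variable {M : Str} [M.IsModel] {A : Type} [Space M A] {x y : M.Obj .one}

/-! ### From real numbers to Baire space -/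

/-- The element of Baire space coding the integer part of `x` and the lengths of the gaps between
the digits `1` of `x`. -/
noncomputable def toBaire (x : M.Obj .one) : M.Obj .one :=
  lam fun j => mu fun v => (j = 0 ∧ v = intPart x) ∨ (j = 1 ∧ v = onePos x 0) ∨
    ∃ k, j = k + 2 ∧ onePos x (k + 1) = onePos x k + v + 1

@[fun_prop] theorem Rep.toBaire {f : A → M.Obj .one} (hf : Rep M f) :
    Rep M fun a => Str.toBaire (f a) := by
  unfold Str.toBaire; fun_prop

theorem toBaire_app (x : M.Obj .one) (j : M.N) : toBaire x ⬩ j = mu fun v =>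
    (j = 0 ∧ v = intPart x) ∨ (j = 1 ∧ v = onePos x 0) ∨
      ∃ k, j = k + 2 ∧ onePos x (k + 1) = onePos x k + v + 1 :=
  lam_app (by fun_prop) j

theorem toBaire_zero (x : M.Obj .one) : toBaire x ⬩ 0 = intPart x := by
  rw [toBaire_app]
  have := mu_spec (P := fun v => ((0 : M.N) = 0 ∧ v = intPart x) ∨ ((0 : M.N) = 1 ∧ v = onePos x 0) ∨
      ∃ k, 0 = k + 2 ∧ onePos x (k + 1) = onePos x k + v + 1) (by fun_prop)
      ⟨_, .inl ⟨rfl, rfl⟩⟩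
  rcases this with h | h | ⟨k, h, -⟩
  · exact h.2
  · exact (zero_ne_one h.1).elim
  · exact (N.add_two_ne_zero k h.symm).elim

theorem toBaire_one (x : M.Obj .one) : toBaire x ⬩ 1 = onePos x 0 := by
  rw [toBaire_app]
  have := mu_spec (P := fun v => ((1 : M.N) = 0 ∧ v = intPart x) ∨ ((1 : M.N) = 1 ∧ v = onePos x 0) ∨
      ∃ k, 1 = k + 2 ∧ onePos x (k + 1) = onePos x k + v + 1) (by fun_prop)
      ⟨_, .inr (.inl ⟨rfl, rfl⟩)⟩
  rcases this with h | h | ⟨k, h, -⟩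
  · exact (one_ne_zero h.1).elim
  · exact h.2
  · exact (N.add_two_ne_one k h.symm).elim

/-- Successive positions differ by at least one. Storing the difference less one makes every
sequence of numbers a code. -/
theorem IsReal.toBaire_add_two (hx : IsReal x) (k : M.N) :
    onePos x (k + 1) = onePos x k + toBaire x ⬩ (k + 2) + 1 := by
  rw [toBaire_app]
  obtain ⟨d, hd⟩ := N.le_iff_exists_add.1 (N.add_one_le_iff.2 (hx.onePos_add_one_spec k).1)
  have := mu_spec (P := fun v => (k + 2 = 0 ∧ v = intPart x) ∨ (k + 2 = 1 ∧ v = onePos x 0) ∨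
      ∃ l, k + 2 = l + 2 ∧ onePos x (l + 1) = onePos x l + v + 1) (by fun_prop)
      ⟨d, .inr (.inr ⟨k, rfl, by rw [hd, add_right_comm]⟩)⟩
  rcases this with h | h | ⟨l, h, h'⟩
  · exact (N.add_two_ne_zero k h.1).elim
  · exact (N.add_two_ne_one k h.1).elim
  · rw [← add_right_cancel h] at h'; exact h'

/-- Equal reals lie in the same cells, and the coding depends only on the cells. -/
theorem toBaire_congr (hx : IsReal x) (hy : IsReal y) (h : RealEq x y) :
    toBaire x = toBaire y := by
  have hi : intPart x = intPart y := (hx.inCell_intPart.congr hx hy h).eq_int hy.inCell_intPart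
  have ha : ∀ p, approx x p = approx y p := fun p => by
    have h₁ := (hx.inCell_approx p).congr hx hy h
    rw [hi] at h₁
    exact h₁.eq (hy.inCell_approx p)
  have hb : ∀ p, Bit x p = Bit y p := fun p => by unfold Bit; rw [ha, ha]
  have ho : ∀ k, onePos x k = onePos y k := fun k => by unfold onePos; simp only [hb]
  unfold toBaire
  simp only [hi, ho]

/-! ### From Baire space to real numbers -/

variable (f : M.Obj .one)

/-- The position of the `(k + 1)`-st digit `1` in the expansion coded by `f`. -/
noncomputable def gapPos (k : M.N) : M.N := natRec (f ⬩ 1) (fun k r => r + f ⬩ (k + 2) + 1) k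

/-- The first `p` binary digits of the expansion coded by `f`, as a number. -/
noncomputable def digits (p : M.N) : M.N :=
  natRec 0 (fun p r => mu fun n => (n = 2 * r + 1 ∧ ∃ k, gapPos f k = p) ∨
    (n = 2 * r ∧ ¬ ∃ k, gapPos f k = p)) p

/-- The real number coded by `f`. -/
noncomputable def fromBaire : M.Obj .one := lam fun p => pt (f ⬩ 0) (digits f p) p

variable {f}

@[fun_prop] theorem Rep.gapPos {f : A → M.Obj .one} {g : A → M.N} (hf : Rep M f) (hg : Rep M g) :
    Rep M fun a => Str.gapPos (f a) (g a) := by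
  unfold Str.gapPos; fun_prop

@[fun_prop] theorem Rep.digits {f : A → M.Obj .one} {g : A → M.N} (hf : Rep M f) (hg : Rep M g) :
    Rep M fun a => Str.digits (f a) (g a) := by
  unfold Str.digits; fun_prop

@[fun_prop] theorem Rep.fromBaire {f : A → M.Obj .one} (hf : Rep M f) :
    Rep M fun a => Str.fromBaire (f a) := by
  unfold Str.fromBaire; fun_prop

theorem gapPos_zero : gapPos f 0 = f ⬩ 1 := natRec_zero' _ _

theorem gapPos_add_one (k : M.N) : gapPos f (k + 1) = gapPos f k + f ⬩ (k + 2) + 1 :=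
  natRec_add_one _ (by fun_prop) k

theorem gapPos_lt (k : M.N) : gapPos f k < gapPos f (k + 1) := by
  rw [gapPos_add_one]; exact N.lt_add_one_iff.2 le_self_add

theorem gapPos_mono {k l : M.N} (h : k ≤ l) : gapPos f k ≤ gapPos f l := by
  obtain ⟨i, rfl⟩ := N.le_iff_exists_add.1 h
  clear h
  induction i using rep_induction with
  | hP => fun_prop
  | h₀ => rw [add_zero]
  | h₁ i ih => rw [← add_assoc]; exact ih.trans (gapPos_lt _).le

theorem le_gapPos (k : M.N) : k ≤ gapPos f k := by
  induction k using rep_induction with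
  | hP => fun_prop
  | h₀ => exact N.zero_le _
  | h₁ k ih => exact N.add_one_le_iff.2 (ih.trans_lt (gapPos_lt k))

theorem digits_zero : digits f 0 = 0 := natRec_zero' _ _

theorem digits_add_one (p : M.N) : digits f (p + 1) = mu fun n =>
    (n = 2 * digits f p + 1 ∧ ∃ k, gapPos f k = p) ∨
      (n = 2 * digits f p ∧ ¬ ∃ k, gapPos f k = p) :=
  natRec_add_one _ (by fun_prop) p

theorem digits_of_exists {p : M.N} (h : ∃ k, gapPos f k = p) :
    digits f (p + 1) = 2 * digits f p + 1 := by
  rw [digits_add_one]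
  have := mu_spec (P := fun n => (n = 2 * digits f p + 1 ∧ ∃ k, gapPos f k = p) ∨
      (n = 2 * digits f p ∧ ¬ ∃ k, gapPos f k = p)) (by fun_prop) ⟨_, .inl ⟨rfl, h⟩⟩
  tauto

theorem digits_of_not_exists {p : M.N} (h : ¬ ∃ k, gapPos f k = p) :
    digits f (p + 1) = 2 * digits f p := by
  rw [digits_add_one]
  have := mu_spec (P := fun n => (n = 2 * digits f p + 1 ∧ ∃ k, gapPos f k = p) ∨
      (n = 2 * digits f p ∧ ¬ ∃ k, gapPos f k = p)) (by fun_prop) ⟨_, .inr ⟨rfl, h⟩⟩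
  tauto

theorem fromBaire_app (p : M.N) : fromBaire f ⬩ p = pt (f ⬩ 0) (digits f p) p :=
  lam_app (by fun_prop) p

theorem val_fromBaire (p : M.N) :
    val (fromBaire f ⬩ p) = sg (f ⬩ 0) + ι (digits f p) * eps p := by
  rw [fromBaire_app, val_pt]

/-- Appending `i` digits multiplies by `2 ^ i` and adds at most `2 ^ i - 1`. The nesting of the
intervals of `fromBaire f` follows. -/
theorem digits_bounds (p i : M.N) : digits f p * pw i ≤ digits f (p + i) ∧
    digits f (p + i) + 1 ≤ (digits f p + 1) * pw i := by
  induction i using rep_induction with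
  | hP => fun_prop
  | h₀ => simp only [add_zero, pw_zero, mul_one, le_refl, and_self]
  | h₁ i ih =>
    have h₁ := mul_le_mul_right ih.1 2
    have h₂ := mul_le_mul_right ih.2 2
    rw [← add_assoc, pw_add_one, mul_left_comm, mul_left_comm _ 2]
    rw [mul_add, mul_one] at h₂
    by_cases h : ∃ k, gapPos f k = p + i
    · rw [digits_of_exists h]
      refine ⟨h₁.trans le_self_add, le_trans (le_of_eq ?_) h₂⟩
      rw [add_assoc, one_add_one_eq_two]
    · rw [digits_of_not_exists h]
      refine ⟨h₁, le_trans ?_ h₂⟩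
      gcongr
      exact one_le_two

theorem val_fromBaire_bounds (p i : M.N) :
    val (fromBaire f ⬩ p) ≤ val (fromBaire f ⬩ (p + i)) ∧
    val (fromBaire f ⬩ (p + i)) + eps (p + i) ≤ val (fromBaire f ⬩ p) + eps p := by
  obtain ⟨h₁, h₂⟩ := digits_bounds (f := f) p i
  have h₁ := mul_le_mul_of_nonneg_right (ι_le.2 h₁) (eps_pos (p + i)).le
  have h₂ := mul_le_mul_of_nonneg_right (ι_le.2 h₂) (eps_pos (p + i)).le
  have e : ι (pw i) * eps (p + i) = eps p := by
    rw [eps_add, mul_left_comm, ι_pw_mul_eps, mul_one]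
  simp only [map_add, map_mul, map_one, mul_assoc, e] at h₁ h₂
  rw [val_fromBaire, val_fromBaire]
  constructor <;> linarith

theorem isReal_fromBaire (f : M.Obj .one) : IsReal (fromBaire f) := by
  intro k i
  have h := val_fromBaire_bounds (f := f) k i
  have := eps_pos k
  have := eps_pos (k + i)
  have hv : ∀ p, Valid (fromBaire f ⬩ p) := fun p => by rw [fromBaire_app]; exact valid_pt _ _ _
  simp only [diffLe_iff, hv, true_and, map_one, one_mul]
  constructor <;> linarith

theorem inCell_fromBaire (f : M.Obj .one) (p : M.N) :
    InCell (fromBaire f) (f ⬩ 0) (digits f p) p := by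
  have hv := val_fromBaire (f := f) p
  constructor
  · rw [← hv]
    -- The digit `1` at position `gapPos f p ≥ p` puts the real strictly above the left end of the
    -- cell.
    obtain ⟨i, hi⟩ := N.le_iff_exists_add.1 (le_gapPos (f := f) p)
    have h₁ := (val_fromBaire_bounds (f := f) p i).1
    have h₂ : val (fromBaire f ⬩ (p + i)) + eps (p + i + 1) =
        val (fromBaire f ⬩ (p + i + 1)) := by
      rw [val_fromBaire, val_fromBaire, digits_of_exists ⟨p, hi⟩, eps_add_one]
      simp only [map_add, map_mul, map_ofNat, map_one]
      ring
    have h₃ := (val_fromBaire_bounds (f := f) (p + i + 1) 1).1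
    have h₄ := eps_add_one (p + i + 1)
    have h₅ := eps_pos (p + i + 1)
    -- The extra stage is needed because `Below` asks for a strict margin: `eps` halves once more,
    -- while the digit already contributes `eps (p + i + 1)`.
    exact ⟨p + i + 1 + 1, by linarith⟩
  · rw [add_mul, one_mul, ← add_assoc, ← hv]
    rintro ⟨k, hk⟩
    have h₁ := eps_pos k
    have h₂ := eps_pos p
    rcases le_total p k with h | h
    · obtain ⟨i, rfl⟩ := N.le_iff_exists_add.1 h
      have := (val_fromBaire_bounds (f := f) p i).2
      linarith
    · obtain ⟨i, rfl⟩ := N.le_iff_exists_add.1 h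
      have := (val_fromBaire_bounds (f := f) k i).1
      linarith

theorem intPart_fromBaire (f : M.Obj .one) : intPart (fromBaire f) = f ⬩ 0 := by
  have h := inCell_fromBaire f 0
  rw [digits_zero] at h
  exact (isReal_fromBaire f).inCell_intPart.eq_int h

theorem approx_fromBaire (f : M.Obj .one) (p : M.N) : approx (fromBaire f) p = digits f p := by
  have h := inCell_fromBaire f 0
  rw [digits_zero] at h
  exact (isReal_fromBaire f).approx_eq h (inCell_fromBaire f p)

theorem bit_fromBaire (f : M.Obj .one) (p : M.N) :
    Bit (fromBaire f) p ↔ ∃ k, gapPos f k = p := by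
  rw [Bit, approx_fromBaire, approx_fromBaire]
  refine ⟨fun h => ?_, digits_of_exists⟩
  by_contra hn
  rw [digits_of_not_exists hn] at h
  exact N.two_mul_ne_two_mul_add_one _ _ h

theorem onePos_fromBaire (f : M.Obj .one) (k : M.N) : onePos (fromBaire f) k = gapPos f k := by
  induction k using rep_induction with
  | hP => fun_prop
  | h₀ =>
    rw [onePos_zero]
    refine mu_eq ((bit_fromBaire f _).2 ⟨0, rfl⟩) fun m hm hb => ?_
    obtain ⟨l, rfl⟩ := (bit_fromBaire f _).1 hb
    exact (gapPos_mono (N.zero_le l)).not_gt hm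
  | h₁ k ih =>
    rw [onePos_add_one, ih]
    refine mu_eq ⟨gapPos_lt k, (bit_fromBaire f _).2 ⟨k + 1, rfl⟩⟩ fun m hm ⟨hk, hb⟩ => ?_
    obtain ⟨l, rfl⟩ := (bit_fromBaire f _).1 hb
    rcases le_or_gt l k with h | h
    · exact (gapPos_mono h).not_gt hk
    · exact (gapPos_mono (N.add_one_le_iff.2 h)).not_gt hm

theorem toBaire_fromBaire (f : M.Obj .one) : toBaire (fromBaire f) = f := by
  refine ext fun j => ?_
  rcases N.cases_two j with rfl | rfl | ⟨k, rfl⟩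
  · rw [toBaire_zero, intPart_fromBaire]
  · rw [toBaire_one, onePos_fromBaire, gapPos_zero]
  · have := (isReal_fromBaire f).toBaire_add_two k
    rw [onePos_fromBaire, onePos_fromBaire, gapPos_add_one, add_assoc, add_assoc] at this
    exact (add_right_cancel (add_left_cancel this)).symm

theorem IsReal.gapPos_toBaire (hx : IsReal x) (k : M.N) : gapPos (toBaire x) k = onePos x k := by
  induction k using rep_induction with
  | hP => fun_prop
  | h₀ => rw [gapPos_zero, toBaire_one]
  | h₁ k ih => rw [gapPos_add_one, ih, hx.toBaire_add_two]

theorem IsReal.digits_toBaire (hx : IsReal x) (p : M.N) : digits (toBaire x) p = approx x p := by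
  have hb : ∀ p, (∃ k, gapPos (toBaire x) k = p) ↔ Bit x p := fun p => by
    simp only [hx.gapPos_toBaire, hx.bit_iff]
  induction p using rep_induction with
  | hP => fun_prop
  | h₀ => rw [digits_zero, hx.approx_eq hx.inCell_intPart hx.inCell_intPart]
  | h₁ p ih =>
    by_cases h : Bit x p
    · rw [digits_of_exists ((hb p).2 h), ih]; exact h.symm
    · rw [digits_of_not_exists (by rwa [hb]), ih]
      exact ((hx.approx_add_one p).resolve_right h).symm

/-- The code determines the integer part and all digits, so both reals lie in a common cell at every
scale. -/
theorem realEq_of_toBaire_eq (hx : IsReal x) (hy : IsReal y) (h : toBaire x = toBaire y) :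
    RealEq x y := by
  have hi : intPart x = intPart y := by rw [← toBaire_zero, h, toBaire_zero]
  refine realEq_of_cells hx hy fun n => ⟨sg (intPart x) + ι (approx x n) * eps n, ?_⟩
  have h₁ := hx.inCell_approx n
  have h₂ := hy.inCell_approx n
  rw [← hi, ← hy.digits_toBaire, ← h, hx.digits_toBaire] at h₂
  unfold InCell at h₁ h₂
  rw [add_mul, one_mul, ← add_assoc] at h₁ h₂
  exact ⟨h₁.1, h₁.2, h₂.1, h₂.2⟩

theorem realEq_fromBaire_toBaire (hx : IsReal x) : RealEq (fromBaire (toBaire x)) x :=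
  realEq_of_toBaire_eq (isReal_fromBaire _) hx (toBaire_fromBaire _)

/-! ### The unit interval -/

/-- The constant sequence with value `q`. -/
def constSeq (q : M.N) : M.Obj .one := M.combK _ _ ⬩ q

theorem constSeq_app (q k : M.N) : constSeq q ⬩ k = q := app_combK q k

/-- `x ∈ [0, 1]`. -/
def InUnit (x : M.Obj .one) : Prop :=
  IsReal x ∧ RealLe (constSeq (code 0 0 0)) x ∧ RealLe x (constSeq (code 1 0 0))

theorem val_code_zero : val (code 0 0 0 : M.N) = 0 := by simp [val_code]

theorem val_code_one : val (code 1 0 0 : M.N) = 1 := by simp [val_code]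

theorem zero_realLe_iff (hx : IsReal x) :
    RealLe (constSeq (code 0 0 0)) x ↔ ∀ k, 0 ≤ val (x ⬩ k) + 2 * eps k := by
  simp only [RealLe, diffLe_iff, hx.valid, constSeq_app, valid_code, true_and, val_code_zero,
    map_ofNat, sub_le_iff_le_add']

theorem realLe_one_iff (hx : IsReal x) :
    RealLe x (constSeq (code 1 0 0)) ↔ ∀ k, val (x ⬩ k) ≤ 1 + 2 * eps k := by
  simp only [RealLe, diffLe_iff, hx.valid, constSeq_app, valid_code, true_and, val_code_one,
    map_ofNat, sub_le_iff_le_add']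

theorem inUnit_zero : InUnit (constSeq (code 0 0 0) : M.Obj .one) := by
  have hx : IsReal (constSeq (code 0 0 0) : M.Obj .one) := fun k i => by
    simp only [constSeq_app, diffLe_iff, valid_code, sub_self, map_one, one_mul,
      (eps_pos k).le, and_self]
  refine ⟨hx, (zero_realLe_iff hx).2 fun k => ?_, (realLe_one_iff hx).2 fun k => ?_⟩ <;>
  · have := eps_pos k
    rw [constSeq_app, val_code_zero]; linarith

/-- The code `0` stands for the integer `0`, whose cell is `(0, 1]`: this is the unit interval
without its left endpoint. -/
theorem intPart_eq_zero_iff (hx : IsReal x) : intPart x = 0 ↔ Below 0 x ∧ ¬ Below 1 x := by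
  have h : InCell x 0 0 0 ↔ Below 0 x ∧ ¬ Below 1 x := by
    rw [inCell_zero_iff, sg_zero, zero_add]
  rw [← h]
  exact ⟨fun h' => h' ▸ hx.inCell_intPart, fun h' => hx.inCell_intPart.eq_int h'⟩

theorem InUnit.of_intPart (hx : IsReal x) (h : intPart x = 0) : InUnit x := by
  rw [intPart_eq_zero_iff hx] at h
  refine ⟨hx, (zero_realLe_iff hx).2 fun k => ?_, (realLe_one_iff hx).2 fun k => ?_⟩
  · have := h.1.lt hx k
    have := eps_pos k
    linarith
  · have := le_of_not_below h.2 k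
    have := eps_pos k
    linarith

theorem InUnit.intPart_eq_zero (hx : InUnit x) (h : Below 0 x) : intPart x = 0 :=
  (intPart_eq_zero_iff hx.1).2
    ⟨h, not_below_of_le hx.1 ((realLe_one_iff hx.1).1 hx.2.2)⟩

theorem InUnit.realEq_zero (hx : InUnit x) (h : ¬ Below 0 x) :
    RealEq x (constSeq (code 0 0 0)) := by
  rw [realEq_iff hx.1 inUnit_zero.1]
  intro k
  have h₁ := le_of_not_below h k
  have h₂ := (zero_realLe_iff hx.1).1 hx.2.1 k
  have h₃ := eps_pos k
  rw [constSeq_app, val_code_zero]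
  constructor <;> linarith

theorem not_below_zero : ¬ Below 0 (constSeq (code 0 0 0) : M.Obj .one) := by
  rintro ⟨k, hk⟩
  rw [constSeq_app, val_code_zero] at hk
  linarith [eps_pos k]

end Str
end HigherOrderArith

namespace HigherOrderArith
namespace Str

section Bijections

variable {M : Str} [M.IsModel]

/-! ### Bijections with the natural numbers -/

/-- Some `Y` of type `2` is a bijection from `X`, with equality `E`, to the numbers. -/
def Bij (X : M.Obj .one → Prop) (E : M.Obj .one → M.Obj .one → Prop) : Prop :=
  ∃ Y : M.Obj .two, (∀ f g, X f → X g → E f g → Y ⬩ f = Y ⬩ g) ∧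
    (∀ f g, X f → X g → Y ⬩ f = Y ⬩ g → E f g) ∧ ∀ n, ∃ g, X g ∧ Y ⬩ g = n

theorem bij_real_of_bij_baire (h : Bij (M := M) (fun _ => True) Eq) : Bij (M := M) IsReal RealEq := by
  obtain ⟨Y, -, hi, hs⟩ := h
  have hY : ∀ x, (lam fun x => Y ⬩ toBaire x) ⬩ x = Y ⬩ toBaire x := lam_app (by fun_prop)
  refine ⟨lam fun x => Y ⬩ toBaire x, fun x y hx hy hxy => ?_, fun x y hx hy hxy => ?_, fun n => ?_⟩
  · rw [hY, hY, toBaire_congr hx hy hxy]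
  · rw [hY, hY] at hxy
    exact realEq_of_toBaire_eq hx hy (hi _ _ trivial trivial hxy)
  · obtain ⟨f, -, hf⟩ := hs n
    exact ⟨fromBaire f, isReal_fromBaire f, by rw [hY, toBaire_fromBaire, hf]⟩

theorem bij_baire_of_bij_real (h : Bij (M := M) IsReal RealEq) : Bij (M := M) (fun _ => True) Eq := by
  obtain ⟨Y, hc, hi, hs⟩ := h
  have hY : ∀ f, (lam fun f => Y ⬩ fromBaire f) ⬩ f = Y ⬩ fromBaire f := lam_app (by fun_prop)
  refine ⟨lam fun f => Y ⬩ fromBaire f, fun f g _ _ hfg => hfg ▸ rfl, fun f g _ _ hfg => ?_,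
    fun n => ?_⟩
  · rw [hY, hY] at hfg
    have hf := isReal_fromBaire f
    have hg := isReal_fromBaire g
    rw [← toBaire_fromBaire f, ← toBaire_fromBaire g, toBaire_congr hf hg (hi _ _ hf hg hfg)]
  · obtain ⟨x, hx, hn⟩ := hs n
    refine ⟨toBaire x, trivial, ?_⟩
    rw [hY, hc _ _ (isReal_fromBaire _) hx (realEq_fromBaire_toBaire hx), hn]

/-! ### Leading zeros: Baire space and the interval `(0, 1]`. -/

/-- The sequence with first entry `0` and then the entries of `f`. -/
noncomputable def consZero (f : M.Obj .one) : M.Obj .one :=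
  lam fun n => mu fun v => ∃ k, n = k + 1 ∧ v = f ⬩ k

/-- The sequence `f` without its first entry. -/
noncomputable def tail (f : M.Obj .one) : M.Obj .one := lam fun n => f ⬩ (n + 1)

theorem consZero_zero (f : M.Obj .one) : consZero f ⬩ 0 = 0 := by
  rw [consZero, lam_app (by fun_prop)]
  -- The leading `0` is the default value of `mu`.
  exact mu_of_not_exists fun ⟨_, k, hk, _⟩ => N.add_one_ne_zero k hk.symm

theorem consZero_add_one (f : M.Obj .one) (n : M.N) : consZero f ⬩ (n + 1) = f ⬩ n := by
  rw [consZero, lam_app (by fun_prop)]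
  obtain ⟨k, hk, h⟩ := mu_spec (P := fun v => ∃ k, n + 1 = k + 1 ∧ v = f ⬩ k) (by fun_prop)
    ⟨f ⬩ n, n, rfl, rfl⟩
  rw [h, add_right_cancel hk]

theorem tail_app (f : M.Obj .one) (n : M.N) : tail f ⬩ n = f ⬩ (n + 1) := lam_app (by fun_prop) n

theorem tail_consZero (f : M.Obj .one) : tail (consZero f) = f :=
  ext fun n => by rw [tail_app, consZero_add_one]

theorem consZero_tail {f : M.Obj .one} (h : f ⬩ 0 = 0) : consZero (tail f) = f := by
  refine ext fun n => ?_
  by_cases hn : n = 0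
  · rw [hn, consZero_zero, h]
  · obtain ⟨k, rfl⟩ := N.exists_add_one hn
    rw [consZero_add_one, tail_app]

theorem inUnit_fromBaire_consZero (f : M.Obj .one) : InUnit (fromBaire (consZero f)) :=
  .of_intPart (isReal_fromBaire _) (by rw [intPart_fromBaire, consZero_zero])

theorem below_zero_fromBaire_consZero (f : M.Obj .one) : Below 0 (fromBaire (consZero f)) :=
  ((intPart_eq_zero_iff (isReal_fromBaire _)).1 (by rw [intPart_fromBaire, consZero_zero])).1

open Classical in
-- The endpoint `0` receives the number `0`; points of `(0, 1]` are numbered through Baire space and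
-- moved up by one. The case distinction is representable because `BelowCode` is.
theorem bij_unit_of_bij_baire (h : Bij (M := M) (fun _ => True) Eq) :
    Bij (M := M) InUnit RealEq := by
  obtain ⟨Y, -, hi, hs⟩ := h
  let Z : M.Obj .one → M.N := fun x =>
    if BelowCode (code 0 0 0) x then Y ⬩ tail (toBaire x) + 1 else 0
  have hZ : Rep M Z := by unfold Z tail; fun_prop
  have hb : ∀ {x : M.Obj .one}, InUnit x → (BelowCode (code 0 0 0) x ↔ Below 0 x) := fun hx => by
    rw [belowCode_iff hx.1 (valid_code _ _ _), val_code_zero]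
  have hZ₁ : ∀ {x : M.Obj .one}, InUnit x → Below 0 x → Z x = Y ⬩ tail (toBaire x) + 1 :=
    fun hx h => if_pos ((hb hx).2 h)
  have hZ₀ : ∀ {x : M.Obj .one}, InUnit x → ¬ Below 0 x → Z x = 0 :=
    fun hx h => if_neg (mt (hb hx).1 h)
  refine ⟨lam Z, fun x y hx hy hxy => ?_, fun x y hx hy hxy => ?_, fun n => ?_⟩
  · rw [lam_app hZ, lam_app hZ]
    by_cases h : Below 0 x
    · rw [hZ₁ hx h, hZ₁ hy (h.congr hx.1 hy.1 hxy), toBaire_congr hx.1 hy.1 hxy]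
    · rw [hZ₀ hx h, hZ₀ hy fun h' => h (h'.congr hy.1 hx.1 hxy.symm)]
  · rw [lam_app hZ, lam_app hZ] at hxy
    by_cases h : Below 0 x <;> by_cases h' : Below 0 y
    · rw [hZ₁ hx h, hZ₁ hy h'] at hxy
      have ht := hi _ _ trivial trivial (N.add_one_inj hxy)
      refine realEq_of_toBaire_eq hx.1 hy.1 ?_
      rw [← consZero_tail ((toBaire_zero x).trans (hx.intPart_eq_zero h)), ht,
        consZero_tail ((toBaire_zero y).trans (hy.intPart_eq_zero h'))]
    · rw [hZ₁ hx h, hZ₀ hy h'] at hxy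
      exact (N.add_one_ne_zero _ hxy).elim
    · rw [hZ₀ hx h, hZ₁ hy h'] at hxy
      exact (N.add_one_ne_zero _ hxy.symm).elim
    -- Both points are the endpoint `0`, and the intervals `(-eps n, 0]` serve as common cells.
    · have h₀ : ∀ n : M.N, Below (-eps n) (constSeq (code 0 0 0)) := fun n =>
        ⟨n + 1, by rw [constSeq_app, val_code_zero, eps_add_one]; linarith [eps_pos n]⟩
      refine realEq_of_cells hx.1 hy.1 fun n => ⟨-eps n, ?_, ?_, ?_, ?_⟩
      · exact (h₀ n).congr inUnit_zero.1 hx.1 (hx.realEq_zero h).symm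
      · rwa [neg_add_cancel]
      · exact (h₀ n).congr inUnit_zero.1 hy.1 (hy.realEq_zero h').symm
      · rwa [neg_add_cancel]
  · by_cases hn : n = 0
    · refine ⟨_, inUnit_zero, ?_⟩
      rw [lam_app hZ, hZ₀ inUnit_zero not_below_zero, hn]
    · obtain ⟨m, rfl⟩ := N.exists_add_one hn
      obtain ⟨f, -, hf⟩ := hs m
      refine ⟨_, inUnit_fromBaire_consZero f, ?_⟩
      rw [lam_app hZ, hZ₁ (inUnit_fromBaire_consZero f) (below_zero_fromBaire_consZero f),
        toBaire_fromBaire, tail_consZero, hf]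

open Classical in
-- Baire space is sent onto `(0, 1]`, which misses exactly the number `a` of the endpoint `0`;
-- closing up this one gap restores surjectivity.
theorem bij_baire_of_bij_unit (h : Bij (M := M) InUnit RealEq) :
    Bij (M := M) (fun _ => True) Eq := by
  obtain ⟨Y, hc, hi, hs⟩ := h
  obtain ⟨a, ha⟩ : ∃ a, Y ⬩ constSeq (code 0 0 0) = a := ⟨_, rfl⟩
  -- `r` maps the numbers other than `a` bijectively onto all numbers: those above `a` move down by
  -- one. Its value at `a` plays no role.
  let r : M.N → M.N := fun n => if n < a then n else mu fun v => v + 1 = n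
  have hr : Rep M r := by unfold r; fun_prop
  have hr₁ : ∀ {n}, n < a → r n = n := fun h => if_pos h
  have hr₂ : ∀ {n}, a < n → r n + 1 = n := fun {n} h => by
    obtain ⟨m, hm⟩ := N.exists_add_one ((N.zero_le a).trans_lt h).ne'
    have := mu_spec (P := fun v => v + 1 = n) (by fun_prop) ⟨m, hm.symm⟩
    rwa [show r n = mu fun v => v + 1 = n from if_neg h.not_gt]
  have hrinj : ∀ {m n}, m ≠ a → n ≠ a → r m = r n → m = n := by
    intro m n hm hn h
    rcases hm.lt_or_gt with hm | hm <;> rcases hn.lt_or_gt with hn | hn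
    · rwa [hr₁ hm, hr₁ hn] at h
    · rw [hr₁ hm] at h
      rw [← hr₂ hn, ← h] at hn
      exact (N.lt_add_one_iff.1 hn |>.not_gt hm).elim
    · rw [hr₁ hn] at h
      rw [← hr₂ hm, h] at hm
      exact (N.lt_add_one_iff.1 hm |>.not_gt hn).elim
    · rw [← hr₂ hm, h, hr₂ hn]
  have hrsurj : ∀ m, ∃ n, n ≠ a ∧ r n = m := by
    intro m
    rcases lt_or_ge m a with h | h
    · exact ⟨m, h.ne, hr₁ h⟩
    · have h' := N.lt_add_one_iff.2 h
      exact ⟨m + 1, h'.ne', N.add_one_inj (hr₂ h')⟩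
  let Z : M.Obj .one → M.N := fun f => r (Y ⬩ fromBaire (consZero f))
  have hZ : Rep M Z := hr.comp (by unfold consZero; fun_prop)
  have hne : ∀ f, Y ⬩ fromBaire (consZero f) ≠ a := fun f h => by
    have h' := inUnit_fromBaire_consZero f
    exact not_below_zero ((below_zero_fromBaire_consZero f).congr h'.1 inUnit_zero.1
      (hi _ _ h' inUnit_zero (h.trans ha.symm)))
  refine ⟨lam Z, fun f g _ _ hfg => hfg ▸ rfl, fun f g _ _ hfg => ?_, fun n => ?_⟩
  · rw [lam_app hZ, lam_app hZ] at hfg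
    have hf := inUnit_fromBaire_consZero f
    have hg := inUnit_fromBaire_consZero g
    have := toBaire_congr hf.1 hg.1 (hi _ _ hf hg (hrinj (hne f) (hne g) hfg))
    rw [toBaire_fromBaire, toBaire_fromBaire] at this
    rw [← tail_consZero f, this, tail_consZero]
  · obtain ⟨m, hm, hrm⟩ := hrsurj n
    obtain ⟨x, hx, hxm⟩ := hs m
    have hx₀ : Below 0 x := by
      by_contra h
      exact hm (hxm.symm.trans (hc _ _ hx inUnit_zero (hx.realEq_zero h) |>.trans ha))
    have hcons : consZero (tail (toBaire x)) = toBaire x :=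
      consZero_tail ((toBaire_zero x).trans (hx.intPart_eq_zero hx₀))
    have hu := inUnit_fromBaire_consZero (tail (toBaire x))
    rw [hcons] at hu
    refine ⟨tail (toBaire x), trivial, ?_⟩
    rw [lam_app hZ]
    change r _ = n
    rw [hcons, hc _ _ hu hx (realEq_fromBaire_toBaire hx.1), hxm, hrm]

end Bijections

/-! ### Satisfaction of the sentences -/

section Satisfaction

variable {M : Str}

theorem eval_ratCode (a b d : Tm .nat) (e : M.Env) :
    M.eval e (ratCode a b d) = code (M.eval e a) (M.eval e b) (M.eval e d) := rfl

theorem eval_liftNat_six {σ : Ty} (t : Tm σ) (e : M.Env) (a b c d p q : M.N) :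
    M.eval (((((((e.push a).push b).push c).push d).push p).push q)) (t.liftNat 6) =
      M.eval e t := by
  rw [Tm.liftNat, eval_rename]
  congr 1
  funext τ i
  by_cases h : τ = .nat
  · subst h; simp [Env.push]
  · simp [Env.push, h]

theorem eval_liftNat_two {σ : Ty} (t : Tm σ) (e : M.Env) (a b : M.N) :
    M.eval ((e.push a).push b) (t.liftNat 2) = M.eval e t := by
  rw [Tm.liftNat, eval_rename]
  congr 1
  funext τ i
  by_cases h : τ = .nat
  · subst h; simp [Env.push]
  · simp [Env.push, h]

theorem eval_liftNat_one {σ : Ty} (t : Tm σ) (e : M.Env) (a : M.N) :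
    M.eval (e.push a) (t.liftNat 1) = M.eval e t := by
  rw [Tm.liftNat, eval_rename]
  congr 1
  funext τ i
  by_cases h : τ = .nat
  · subst h; simp [Env.push]
  · simp [Env.push, h]

theorem eval_add (s t : Tm .nat) (e : M.Env) :
    M.eval e (.add ⬝ s ⬝ t) = M.eval e s + M.eval e t := rfl

theorem eval_mul (s t : Tm .nat) (e : M.Env) :
    M.eval e (.mul ⬝ s ⬝ t) = M.eval e s * M.eval e t := rfl

theorem sat_noBijection {X : Tm .one → Formula} {E : Tm .one → Tm .one → Formula}
    {X' : M.Obj .one → Prop} {E' : M.Obj .one → M.Obj .one → Prop}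
    (hX : ∀ t e, M.Sat (X t) e ↔ X' (M.eval e t))
    (hE : ∀ s t e, M.Sat (E s t) e ↔ E' (M.eval e s) (M.eval e t)) (e : M.Env) :
    M.Sat (noBijection X E) e ↔ ¬ Bij X' E' := by
  simp only [noBijection, sat_neg, sat_ex, sat_and, Sat, hX, hE, eval]
  simp [Env.push, Bij]

variable [M.IsModel]

theorem eval_num (c : ℕ) (e : M.Env) : M.eval e (num c) = (c : M.N) := by
  induction c with
  | zero => rw [Nat.cast_zero]; rfl
  | succ n ih => rw [Nat.cast_succ, ← succ_def, ← ih]; rfl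

theorem eval_pow2 (k : Tm .nat) (e : M.Env) : M.eval e (pow2 k) = pw (M.eval e k) := by
  simp only [pow2, eval, eval_num, Nat.cast_one, Nat.cast_ofNat]
  rfl

theorem sat_le (s t : Tm .nat) (e : M.Env) : M.Sat (le s t) e ↔ M.eval e s ≤ M.eval e t := by
  rw [← N.lt_add_one_iff, ← succ_def]; rfl

theorem eval_succ (t : Tm .nat) (e : M.Env) : M.eval e (.succ ⬝ t) = M.eval e t + 1 := succ_def _

theorem sat_diffLe (q r k : Tm .nat) (c : ℕ) (e : M.Env) :
    M.Sat (diffLe q r k c) e ↔ DiffLe (M.eval e q) (M.eval e r) (M.eval e k) c := by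
  simp only [diffLe, sat_ex, sat_and, sat_le, Sat.eq_1, eval_ratCode, eval_add, eval_mul, eval_succ,
    eval_pow2, eval_num, eval_liftNat_six]
  simp only [eval, Env.push, dite_true]
  rfl

theorem sat_distLe (q r k : Tm .nat) (c : ℕ) (e : M.Env) :
    M.Sat (distLe q r k c) e ↔ DiffLe (M.eval e q) (M.eval e r) (M.eval e k) c ∧
      DiffLe (M.eval e r) (M.eval e q) (M.eval e k) c := by
  rw [distLe, sat_and, sat_diffLe, sat_diffLe]

theorem sat_isReal (t : Tm .one) (e : M.Env) : M.Sat (isReal t) e ↔ IsReal (M.eval e t) := by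
  simp only [isReal, Sat, sat_distLe, eval, eval_liftNat_two, push_zero, push_succ, Nat.cast_one]
  rfl

theorem sat_realEq (s t : Tm .one) (e : M.Env) :
    M.Sat (realEq s t) e ↔ RealEq (M.eval e s) (M.eval e t) := by
  simp only [realEq, Sat, sat_distLe, eval, eval_liftNat_one, push_zero, Nat.cast_ofNat]
  rfl

theorem sat_realLe (s t : Tm .one) (e : M.Env) :
    M.Sat (realLe s t) e ↔ RealLe (M.eval e s) (M.eval e t) := by
  simp only [realLe, Sat, sat_diffLe, eval, eval_liftNat_one, push_zero, Nat.cast_ofNat]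
  rfl

theorem sat_inUnitInterval (t : Tm .one) (e : M.Env) :
    M.Sat (inUnitInterval t) e ↔ InUnit (M.eval e t) := by
  simp only [inUnitInterval, sat_and, sat_isReal, sat_realLe]
  rfl

theorem sat_NBI (e : M.Env) : M.Sat NBI e ↔ ¬ Bij (M := M) InUnit RealEq :=
  sat_noBijection sat_inUnitInterval sat_realEq e

theorem sat_NBIReal (e : M.Env) : M.Sat NBIReal e ↔ ¬ Bij (M := M) IsReal RealEq :=
  sat_noBijection sat_isReal sat_realEq e

theorem sat_NBIBaire (e : M.Env) : M.Sat NBIBaire e ↔ ¬ Bij (M := M) (fun _ => True) Eq :=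
  sat_noBijection (fun t e => by simp [sat_neg, Sat]) (fun s t e => sat_eqAt IsModel.ext' s t e) e

end Satisfaction

end Str

end HigherOrderArith

theorem mainTheorem6 :
    HigherOrderArith.Proves HigherOrderArith.ACA []
        (HigherOrderArith.Formula.iff HigherOrderArith.NBI HigherOrderArith.NBIReal) ∧
      HigherOrderArith.Proves HigherOrderArith.ACA []
        (HigherOrderArith.Formula.imp HigherOrderArith.NBI HigherOrderArith.NBIBaire) := by
  open HigherOrderArith HigherOrderArith.Str in
  constructor
  · refine Proves.of_forall_sat (fun _ h => .inl h) (fun _ h s => ACA.subst h s) fun M hM h e => ?_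
    have : M.IsModel := ⟨hM, h⟩
    rw [sat_iff, sat_NBI, sat_NBIReal, not_iff_not]
    -- Both directions pass through Baire space.
    exact ⟨fun h => bij_real_of_bij_baire (bij_baire_of_bij_unit h),
      fun h => bij_unit_of_bij_baire (bij_baire_of_bij_real h)⟩
  · refine Proves.of_forall_sat (fun _ h => .inl h) (fun _ h s => ACA.subst h s) fun M hM h e => ?_
    have : M.IsModel := ⟨hM, h⟩
    change M.Sat NBI e → M.Sat NBIBaire e
    rw [sat_NBI, sat_NBIBaire]
    exact mt bij_unit_of_bij_baire
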